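/- Let $N\in\{1,2,3\}$, let $\Omega\subset\mathbb R^N$ be a bounded Lipschitz domain, $T>0$, $\mu>0$, $\lambda\ge 0$ (with $\lambda>0$ if $N=1$), $a>0$, $\gamma>1$, $q\in C_c^\infty(0,\infty)$, and put $$p(\varrho)=a\varrho^\gamma+q(\varrho),\quad \mathbb S(\nabla u)=\mu\Big(\nabla u+\nabla^t u-\tfrac2N\operatorname{div}u\,\mathbb I\Big)+\lambda\operatorname{div}u\,\mathbb I,\quad P(\varrho)=\frac{a}{\gamma-1}\varrho^\gamma+\varrho\int_1^\varrho\frac{q(z)}{z^2}\,dz .$$ Consider the compressible Navier--Stokes system $$\partial_t\varrho+\operatorname{div}(\varrho u)=0,\qquad \partial_t(\varrho u)+\operatorname{div}(\varrho u\otimes u)+\nabla p(\varrho)=\operatorname{div}\mathbb S(\nabla u),\qquad u|_{\partial\Omega}=0. \tag{NS}$$ A pair $[\varrho,u]$ is a dissipative weak solution on $[0,T]$ if $\varrho\ge 0$, $\varrho\in L^\infty(0,T;L^\gamma(\Omega))$, $u\in L^2(0,T;W^{1,2}_0(\Omega;\mathbb R^N))$, $\varrho u\in L^\infty(0,T;L^{2\gamma/(\gamma+1)}(\Omega;\mathbb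 R^N))$, the instantaneous values $\varrho(\tau,\cdot)$ and $(\varrho u)(\tau,\cdot)$ are integrable functions on $\Omega$ for every $\tau\in[0,T]$, and: (i) for all $\tau\in[0,T]$ and $\varphi\in C^1([0,T]\times\overline\Omega)$, $$\Big[\int_\Omega\varrho\varphi\,dx\Big]_{t=0}^{t=\tau}=\int_0^\tau\!\!\int_\Omega\big[\varrho\,\partial_t\varphi+\varrho u\cdot\nabla\varphi\big]\,dx\,dt;$$ (ii) for all $\tau\in[0,T]$ and $\phi\in C^1([0,T]\times\overline\Omega;\mathbb R^N)$ with $\phi|_{\partial\Omega}=0$, $$\Big[\int_\Omega\varrho u\cdot\phi\,dx\Big]_{t=0}^{t=\tau}=\int_0^\tau\!\!\int_\Omega\big[\varrho u\cdot\partial_t\phi+\varrho u\otimes u:\nabla\phi+p(\varrho)\operatorname{div}\phi\big]\,dx\,dt-\int_0^\tau\!\!\int_\Omega\mathbb S(\nabla u):\nabla\phi\,dx\,dt;$$ (iii) for all $\tau\in[0,T]$, $\varphi\in C^1([0,T]\times\overline\Omega)$ and $b\in C^1[0,\infty)$ with $b'\in C_c[0,\infty)$, $$\Big[\int_\Omega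 b(\varrho)\varphi\,dx\Big]_{t=0}^{t=\tau}=\int_0^\tau\!\!\int_\Omega\big[b(\varrho)\partial_t\varphi+b(\varrho)u\cdot\nabla\varphi+(b(\varrho)-b'(\varrho)\varrho)\operatorname{div}u\,\varphi\big]\,dx\,dt;$$ (iv) the energy $\int_\Omega\big(\tfrac12\varrho|u|^2+P(\varrho)\big)dx$ is finite at $t=0$ and at almost all times, and for almost all $\tau\in(0,T)$, $$\Big[\int_\Omega\big(\tfrac12\varrho|u|^2+P(\varrho)\big)\,dx\Big]_{t=0}^{t=\tau}+\int_0^\tau\!\!\int_\Omega\mathbb S(\nabla u):\nabla u\,dx\,dt\le 0 .$$ A pair $[r,U]$ is a classical solution on $[0,T]$ if $r\in C^1([0,T]\times\overline\Omega)$, $r\ge0$, $U\in C^1([0,T]\times\overline\Omega;\mathbb R^N)$, $U|_{\partial\Omega}=0$, $U(t,\cdot)\in C^2(\Omega)$ for each $t\in(0,T)$, and (NS) holds for $[r,U]$ at every point of $(0,T)\times\Omega$. **Theorem 1.** Let $[\varrho,u]$ be a dissipative weak solution and $[r,U]$ a classical solution of (NS) on $[0,T]$ such that $$\varrho(0,\cdot)=r(0,\cdot),\qquad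 (\varrho u)(0,\cdot)=r(0,\cdot)U(0,\cdot)\quad\text{a.e. in }\Omega,\qquad r(0,\cdot)>0\ \text{ on }\overline\Omega .$$ Then $\varrho=r$ and $u=U$ almost everywhere in $(0,T)\times\Omega$. -/

import Mathlib

open MeasureTheory Set Filter Topology
open scoped ENNReal ContDiff

noncomputable section

namespace CompressibleNS

/-- Euclidean space `ℝ^N`. -/
abbrev Eucl (N : ℕ) : Type := EuclideanSpace ℝ (Fin N)

/-- The `j`-th vector of the standard basis. -/
def stdVec {N : ℕ} (j : Fin N) : Eucl N := EuclideanSpace.single j (1 : ℝ)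

/-! ### Lipschitz domains -/

/-- Bounded Lipschitz domain: a bounded, open, connected (nonempty) set which near each of its
boundary points is, for a suitable unit vector `e`, the part strictly above the graph over the
hyperplane `e^⊥` of a Lipschitz function (`x - ⟪e, x⟫ e` is the projection of `x` onto `e^⊥`). -/
structure IsBoundedLipschitzDomain {N : ℕ} (Ω : Set (Eucl N)) : Prop where
  isOpen : IsOpen Ω
  isConnected : IsConnected Ω
  isBounded : Bornology.IsBounded Ω
  boundary_graph : ∀ x₀ ∈ frontier Ω, ∃ e : Eucl N, ‖e‖ = 1 ∧
    ∃ g : Eucl N → ℝ, (∃ K : NNReal, LipschitzWith K g) ∧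
      ∃ δ : ℝ, 0 < δ ∧ ∀ x ∈ Metric.ball x₀ δ,
        (x ∈ Ω ↔ g (x - (inner ℝ e x : ℝ) • e) < (inner ℝ e x : ℝ))

/-! ### Tensor algebra and the constitutive relations

A tensor is a linear map; the velocity gradient is `fderiv ℝ u x`, that is `(∇u)_{ij} = ∂_j u_i`. -/

/-- Trace of a tensor; `tr (∇u) = div u`. -/
def tr {N : ℕ} (A : Eucl N →L[ℝ] Eucl N) : ℝ := ∑ j, (A (stdVec j)) j

/-- The scalar product `A : B = ∑_{i,j} A_{ij} B_{ij}` of two tensors. -/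
def frob {N : ℕ} (A B : Eucl N →L[ℝ] Eucl N) : ℝ :=
  ∑ i, ∑ j, (A (stdVec j)) i * (B (stdVec j)) i

/-- The tensor `v ⊗ w`. -/
def tensor {N : ℕ} (v w : Eucl N) : Eucl N →L[ℝ] Eucl N := (innerSL ℝ w).smulRight v

/-- Divergence of a tensor field, `(div M)_i = ∑_j ∂_j M_{ij}`. -/
def tensorDiv {N : ℕ} (M : Eucl N → (Eucl N →L[ℝ] Eucl N)) (x : Eucl N) : Eucl N :=
  ∑ j, (fderiv ℝ M x (stdVec j)) (stdVec j)

/-- Newton's viscous stress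
`S(A) = μ (A + Aᵗ - (2/N) tr(A) I) + lam tr(A) I`. -/
def stress {N : ℕ} (μ lam : ℝ) (A : Eucl N →L[ℝ] Eucl N) : Eucl N →L[ℝ] Eucl N :=
  μ • (A + ContinuousLinearMap.adjoint A
      - ((2 / (N : ℝ)) * tr A) • ContinuousLinearMap.id ℝ (Eucl N))
    + (lam * tr A) • ContinuousLinearMap.id ℝ (Eucl N)

/-- `q ∈ C_c^∞(0,∞)`. -/
def IsTestOnPos (q : ℝ → ℝ) : Prop :=
  ContDiff ℝ ∞ q ∧ HasCompactSupport q ∧ tsupport q ⊆ Ioi 0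

/-- The pressure `p(ρ) = a ρ^γ + q(ρ)`. -/
def pressure (a γ : ℝ) (q : ℝ → ℝ) (s : ℝ) : ℝ := a * s ^ γ + q s

/-- The pressure potential `P(ρ) = a/(γ-1) ρ^γ + ρ ∫_1^ρ q(z)/z² dz`. -/
def pressurePotential (a γ : ℝ) (q : ℝ → ℝ) (s : ℝ) : ℝ :=
  a / (γ - 1) * s ^ γ + s * ∫ z in (1 : ℝ)..s, q z / z ^ 2

/-- The energy density `½ ρ |u|² + P(ρ)`. -/
def energyDensity {N : ℕ} (a γ : ℝ) (q : ℝ → ℝ) (s : ℝ) (v : Eucl N) : ℝ :=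
  1 / 2 * s * ‖v‖ ^ 2 + pressurePotential a γ q s

/-! ### Function spaces -/

/-- `f ∈ C¹([0,T] × Ω̄)`: differentiable relative to the closed set, with continuous derivative. -/
def IsC1 {N : ℕ} {F : Type*} [NormedAddCommGroup F] [NormedSpace ℝ F]
    (Ω : Set (Eucl N)) (T : ℝ) (f : ℝ → Eucl N → F) : Prop :=
  ContDiffOn ℝ 1 (fun z : ℝ × Eucl N => f z.1 z.2) (Icc 0 T ×ˢ closure Ω)

/-- `f` vanishes on `∂Ω` for all times in `[0,T]`. -/
def VanishesOnBoundary {N : ℕ} (Ω : Set (Eucl N)) (T : ℝ) (f : ℝ → Eucl N → Eucl N) : Prop :=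
  ∀ t ∈ Icc (0 : ℝ) T, ∀ x ∈ frontier Ω, f t x = 0

/-- `v ∈ W^{1,2}_0(Ω; ℝ^N)` with weak gradient `G`: the pair `(v, G)` is the limit in `L²(Ω)` of
pairs `(φ, ∇φ)` with `φ ∈ C_c^∞(Ω; ℝ^N)`. -/
def MemW012 {N : ℕ} (Ω : Set (Eucl N)) (v : Eucl N → Eucl N)
    (G : Eucl N → (Eucl N →L[ℝ] Eucl N)) : Prop :=
  MemLp v 2 (volume.restrict Ω) ∧ MemLp G 2 (volume.restrict Ω) ∧
  ∃ φ : ℕ → Eucl N → Eucl N,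
    (∀ n, ContDiff ℝ ∞ (φ n) ∧ HasCompactSupport (φ n) ∧ tsupport (φ n) ⊆ Ω) ∧
    Tendsto (fun n => eLpNorm (fun x => φ n x - v x) 2 (volume.restrict Ω)) atTop (𝓝 0) ∧
    Tendsto (fun n => eLpNorm (fun x => fderiv ℝ (φ n) x - G x) 2 (volume.restrict Ω))
      atTop (𝓝 0)

/-- The space-time cylinder `(0,T) × Ω`. -/
def cylinder {N : ℕ} (Ω : Set (Eucl N)) (T : ℝ) : Set (ℝ × Eucl N) := Ioo 0 T ×ˢ Ω

/-- `f ∈ L^∞(0,T; L^s(Ω))`. -/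
def MemLinftyLp {N : ℕ} {F : Type*} [NormedAddCommGroup F]
    (Ω : Set (Eucl N)) (T s : ℝ) (f : ℝ → Eucl N → F) : Prop :=
  AEStronglyMeasurable (fun z : ℝ × Eucl N => f z.1 z.2) (volume.restrict (cylinder Ω T)) ∧
  ∃ C : NNReal, ∀ᵐ t ∂(volume.restrict (Ioo 0 T)),
    eLpNorm (f t) (ENNReal.ofReal s) (volume.restrict Ω) ≤ C

/-- `u ∈ L²(0,T; W^{1,2}_0(Ω; ℝ^N))` with spatial weak gradient `Du`. -/
def MemL2W012 {N : ℕ} (Ω : Set (Eucl N)) (T : ℝ) (u : ℝ → Eucl N → Eucl N)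
    (Du : ℝ → Eucl N → (Eucl N →L[ℝ] Eucl N)) : Prop :=
  MemLp (fun z : ℝ × Eucl N => u z.1 z.2) 2 (volume.restrict (cylinder Ω T)) ∧
  MemLp (fun z : ℝ × Eucl N => Du z.1 z.2) 2 (volume.restrict (cylinder Ω T)) ∧
  ∀ᵐ t ∂(volume.restrict (Ioo 0 T)), MemW012 Ω (u t) (Du t)

/-! ### Weak formulation -/

/-- Weak form of the equation of continuity. -/
def WeakContinuity {N : ℕ} (Ω : Set (Eucl N)) (T : ℝ)
    (ρ : ℝ → Eucl N → ℝ) (u : ℝ → Eucl N → Eucl N) : Prop :=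
  ∀ φ : ℝ → Eucl N → ℝ, IsC1 Ω T φ → ∀ τ ∈ Icc (0 : ℝ) T,
    (∫ x in Ω, ρ τ x * φ τ x) - (∫ x in Ω, ρ 0 x * φ 0 x) =
      ∫ t in (0 : ℝ)..τ, ∫ x in Ω,
        (ρ t x * deriv (fun s => φ s x) t + ρ t x * fderiv ℝ (φ t) x (u t x))

/-- Weak form of the momentum equation. -/
def WeakMomentum {N : ℕ} (Ω : Set (Eucl N)) (T μ lam a γ : ℝ) (q : ℝ → ℝ)
    (ρ : ℝ → Eucl N → ℝ) (u : ℝ → Eucl N → Eucl N)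
    (Du : ℝ → Eucl N → (Eucl N →L[ℝ] Eucl N)) : Prop :=
  ∀ φ : ℝ → Eucl N → Eucl N, IsC1 Ω T φ → VanishesOnBoundary Ω T φ → ∀ τ ∈ Icc (0 : ℝ) T,
    (∫ x in Ω, (inner ℝ (ρ τ x • u τ x) (φ τ x) : ℝ))
        - (∫ x in Ω, (inner ℝ (ρ 0 x • u 0 x) (φ 0 x) : ℝ)) =
      (∫ t in (0 : ℝ)..τ, ∫ x in Ω,
        ((inner ℝ (ρ t x • u t x) (deriv (fun s => φ s x) t) : ℝ)
          + frob (tensor (ρ t x • u t x) (u t x)) (fderiv ℝ (φ t) x)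
          + pressure a γ q (ρ t x) * tr (fderiv ℝ (φ t) x)))
      - ∫ t in (0 : ℝ)..τ, ∫ x in Ω, frob (stress μ lam (Du t x)) (fderiv ℝ (φ t) x)

/-- Renormalized equation of continuity, for all `b ∈ C¹[0,∞)` with `b' ∈ C_c[0,∞)`. -/
def RenormalizedContinuity {N : ℕ} (Ω : Set (Eucl N)) (T : ℝ)
    (ρ : ℝ → Eucl N → ℝ) (u : ℝ → Eucl N → Eucl N)
    (Du : ℝ → Eucl N → (Eucl N →L[ℝ] Eucl N)) : Prop :=
  ∀ b : ℝ → ℝ, ContDiffOn ℝ 1 b (Ici 0) →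
    (∃ R : ℝ, ∀ s : ℝ, R ≤ s → derivWithin b (Ici 0) s = 0) →
  ∀ φ : ℝ → Eucl N → ℝ, IsC1 Ω T φ → ∀ τ ∈ Icc (0 : ℝ) T,
    (∫ x in Ω, b (ρ τ x) * φ τ x) - (∫ x in Ω, b (ρ 0 x) * φ 0 x) =
      ∫ t in (0 : ℝ)..τ, ∫ x in Ω,
        (b (ρ t x) * deriv (fun s => φ s x) t
          + b (ρ t x) * fderiv ℝ (φ t) x (u t x)
          + (b (ρ t x) - derivWithin b (Ici 0) (ρ t x) * ρ t x) * tr (Du t x) * φ t x)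

/-- Energy inequality, for almost all times; the energy is finite at the initial time and at
almost all times. -/
def EnergyInequality {N : ℕ} (Ω : Set (Eucl N)) (T μ lam a γ : ℝ) (q : ℝ → ℝ)
    (ρ : ℝ → Eucl N → ℝ) (u : ℝ → Eucl N → Eucl N)
    (Du : ℝ → Eucl N → (Eucl N →L[ℝ] Eucl N)) : Prop :=
  IntegrableOn (fun x => energyDensity a γ q (ρ 0 x) (u 0 x)) Ω ∧
  ∀ᵐ τ ∂(volume.restrict (Ioo 0 T)),
    IntegrableOn (fun x => energyDensity a γ q (ρ τ x) (u τ x)) Ω ∧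
    (∫ x in Ω, energyDensity a γ q (ρ τ x) (u τ x))
        - (∫ x in Ω, energyDensity a γ q (ρ 0 x) (u 0 x))
      + (∫ t in (0 : ℝ)..τ, ∫ x in Ω, frob (stress μ lam (Du t x)) (Du t x)) ≤ 0

/-- Dissipative weak solution `[ρ, u]` on `[0,T]`. The density `ρ(t,·)` and the momentum
`(ρu)(t,·)` are the instantaneous values that enter the integral identities at each
`t ∈ [0,T]`; `u(t,·)` lies in `W^{1,2}_0` for almost all `t` only. -/
def IsDissipativeWeakSolution {N : ℕ} (Ω : Set (Eucl N)) (T μ lam a γ : ℝ) (q : ℝ → ℝ)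
    (ρ : ℝ → Eucl N → ℝ) (u : ℝ → Eucl N → Eucl N) : Prop :=
  (∀ t ∈ Icc (0 : ℝ) T, IntegrableOn (ρ t) Ω ∧ IntegrableOn (fun x => ρ t x • u t x) Ω) ∧
  (∀ t ∈ Icc (0 : ℝ) T, ∀ᵐ x ∂(volume.restrict Ω), 0 ≤ ρ t x) ∧
  MemLinftyLp Ω T γ ρ ∧
  MemLinftyLp Ω T (2 * γ / (γ + 1)) (fun t x => ρ t x • u t x) ∧
  ∃ Du : ℝ → Eucl N → (Eucl N →L[ℝ] Eucl N),
    MemL2W012 Ω T u Du ∧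
    WeakContinuity Ω T ρ u ∧
    WeakMomentum Ω T μ lam a γ q ρ u Du ∧
    RenormalizedContinuity Ω T ρ u Du ∧
    EnergyInequality Ω T μ lam a γ q ρ u Du

/-! ### Classical solutions -/

/-- Classical solution `[r, U]` on `[0,T]`: `r, U ∈ C¹([0,T] × Ω̄)`, `r ≥ 0`, `U = 0` on `∂Ω`,
`U(t,·)` twice continuously differentiable in `Ω`, and the equations hold at every point
of `(0,T) × Ω`. -/
structure IsClassicalSolution {N : ℕ} (Ω : Set (Eucl N)) (T μ lam a γ : ℝ) (q : ℝ → ℝ)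
    (r : ℝ → Eucl N → ℝ) (U : ℝ → Eucl N → Eucl N) : Prop where
  density_C1 : IsC1 Ω T r
  velocity_C1 : IsC1 Ω T U
  density_nonneg : ∀ t ∈ Icc (0 : ℝ) T, ∀ x ∈ closure Ω, 0 ≤ r t x
  no_slip : VanishesOnBoundary Ω T U
  velocity_C2 : ∀ t ∈ Ioo (0 : ℝ) T, ContDiffOn ℝ 2 (U t) Ω
  continuity_eq : ∀ t ∈ Ioo (0 : ℝ) T, ∀ x ∈ Ω,
    deriv (fun s => r s x) t + tr (fderiv ℝ (fun y => r t y • U t y) x) = 0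
  momentum_eq : ∀ t ∈ Ioo (0 : ℝ) T, ∀ x ∈ Ω,
    deriv (fun s => r s x • U s x) t
        + tensorDiv (fun y => tensor (r t y • U t y) (U t y)) x
        + gradient (fun y => pressure a γ q (r t y)) x
      = tensorDiv (fun y => stress μ lam (fderiv ℝ (U t) y)) x

end CompressibleNS

end

/-! The proof is the relative energy method, with the relative energy built from the isentropic part
of the pressure alone. Write Π(s) = a s^γ/(γ-1), H = Π', and e = ½ρ|u-U|² + Π(ρ) - H(r)(ρ-r) - Π(r).
Since Π is strictly convex, e ≥ 0, and where r > 0 it vanishes only if ρ = r and u = U. It therefore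
suffices to prove a Gronwall inequality for the integral of e.

Expanding e produces five quantities, each with its own balance (`relEnergy_eq`): the energy
density, the part of P coming from q, the momentum tested with U, the density tested with ½|U|² -
H(r), and the pressure a r^γ. The function q need not be monotone, so its potential is kept out of
e. Up to a linear function this potential is an admissible renormalization
(`exists_pressurePotential_decomposition`), so it can be subtracted from the energy inequality
exactly, at the price of the integral of q(ρ) div u. Adding the momentum equation of [r, U] tested
with u - U gives `relative_energy_inequality`: the integral of e at time τ plus the dissipation of u
- U up to τ is at most the integral of a remainder.

Three estimates close the argument. (1) A minimum principle keeps r above a positive constant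
(`exists_lower_bound_density`). (2) The Bregman distance of Π is bounded below by a multiple of
min(|ρ-r|², |ρ-r|), uniformly in r (`exists_coercivity_relPotential`). As q is bounded and
Lipschitz, (q(ρ)-q(r))² is controlled by the same minimum, so Young's inequality bounds (q(ρ)-q(r))
div(u-U) by C e + δ |div(u-U)|²; the term |ρ-r||u-U| is treated similarly
(`exists_remainder_bound`). (3) Korn's and Poincaré's inequalities absorb the δ-terms into the
dissipation (`exists_coercivity_stress_of_memH10`).

All integrations by parts are carried out for limits of compactly supported fields. That U(t) is
such a limit follows by truncating its values, not its domain (`memH10_of_vanishing`). -/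

noncomputable section

namespace CompressibleNS

/-! ### Functions of class C¹ on the closed cylinder: derivatives and their bounds inside -/

section C1

/-- Differentiability on K provides, near each point of K, some continuous choice of derivative
relative to K, which need not be unique at boundary points. At points of O the relative
neighbourhood is a full one, so each choice agrees there with the genuine derivative. Local bounds
for the choices are then glued by compactness. -/
theorem exists_bound_fderiv_of_contDiffOn {X F : Type*} [NormedAddCommGroup X] [NormedSpace ℝ X]
    [NormedAddCommGroup F] [NormedSpace ℝ F] {K O : Set X} (hK : IsCompact K) (hO : IsOpen O)
    (hOK : O ⊆ K) {f : X → F} (hf : ContDiffOn ℝ 1 f K) :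
    ∃ C : ℝ, ∀ z ∈ O, ‖fderiv ℝ f z‖ ≤ C := by
  have key : ∃ C : ℝ, ∀ z ∈ K, z ∈ O → ‖fderiv ℝ f z‖ ≤ C := by
    refine hK.induction_on (p := fun s => ∃ C : ℝ, ∀ z ∈ s, z ∈ O → ‖fderiv ℝ f z‖ ≤ C)
      ⟨0, by simp⟩ ?_ ?_ ?_
    · rintro s t hst ⟨C, hC⟩
      exact ⟨C, fun z hz => hC z (hst hz)⟩
    · rintro s t ⟨C, hC⟩ ⟨D, hD⟩
      refine ⟨max C D, ?_⟩
      rintro z (hz | hz) hzO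
      · exact (hC z hz hzO).trans (le_max_left _ _)
      · exact (hD z hz hzO).trans (le_max_right _ _)
    · intro x hx
      have h1 : ContDiffWithinAt ℝ ((0 : ℕ∞ω) + 1) f K x := by simpa using hf x hx
      obtain ⟨v, hv, -, f', hf', hcont⟩ :=
        (contDiffWithinAt_succ_iff_hasFDerivWithinAt (by simp)).1 h1
      rw [insert_eq_of_mem hx] at hv
      have hxv : x ∈ v := mem_of_mem_nhdsWithin hx hv
      have hc : ContinuousWithinAt f' v x := hcont.continuousWithinAt
      have hb : ∀ᶠ y in 𝓝[v] x, ‖f' y‖ < ‖f' x‖ + 1 :=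
        hc.norm.eventually (gt_mem_nhds (by linarith))
      have hb' : ∀ᶠ y in 𝓝[K] x, y ∈ v → ‖f' y‖ < ‖f' x‖ + 1 := by
        rw [eventually_nhdsWithin_iff] at hb ⊢
        filter_upwards [hb] with y hy _ hyv using hy hyv
      obtain ⟨V, hV, hxV, hVv⟩ := mem_nhdsWithin.1 hv
      refine ⟨{y | y ∈ V ∧ (y ∈ v → ‖f' y‖ < ‖f' x‖ + 1)}, ?_, ‖f' x‖ + 1, ?_⟩
      · filter_upwards [hb', mem_nhdsWithin_of_mem_nhds (hV.mem_nhds hxV)] with y h1 h2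
        exact ⟨h2, h1⟩
      · rintro z ⟨hzV, hz⟩ hzO
        have hzv : v ∈ 𝓝 z :=
          mem_of_superset ((hV.inter hO).mem_nhds ⟨hzV, hzO⟩)
            (fun y hy => hVv ⟨hy.1, hOK hy.2⟩)
        have hd : HasFDerivAt f (f' z) z :=
          (hf' z (mem_of_mem_nhds hzv)).hasFDerivAt hzv
        rw [hd.fderiv]
        exact (hz (mem_of_mem_nhds hzv)).le
  obtain ⟨C, hC⟩ := key
  exact ⟨C, fun z hz => hC z (hOK hz) hz⟩

variable {N : ℕ} {F : Type*} [NormedAddCommGroup F] [NormedSpace ℝ F]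
  {Ω : Set (Eucl N)} {T : ℝ} {f : ℝ → Eucl N → F}

theorem isOpen_cylinder (hΩ : IsOpen Ω) : IsOpen (cylinder Ω T) := isOpen_Ioo.prod hΩ

theorem cylinder_subset_closed : cylinder Ω T ⊆ Icc 0 T ×ˢ closure Ω :=
  prod_mono Ioo_subset_Icc_self subset_closure

theorem isCompact_closed_cylinder (hb : Bornology.IsBounded Ω) :
    IsCompact (Icc (0 : ℝ) T ×ˢ closure Ω) :=
  isCompact_Icc.prod hb.isCompact_closure

theorem IsC1.continuousOn (hf : IsC1 Ω T f) :
    ContinuousOn (fun z : ℝ × Eucl N => f z.1 z.2) (Icc 0 T ×ˢ closure Ω) :=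
  ContDiffOn.continuousOn hf

theorem IsC1.exists_bound (hf : IsC1 Ω T f) (hb : Bornology.IsBounded Ω) :
    ∃ C : ℝ, ∀ t ∈ Icc (0 : ℝ) T, ∀ x ∈ closure Ω, ‖f t x‖ ≤ C := by
  obtain ⟨C, hC⟩ := (isCompact_closed_cylinder (T := T) hb).exists_bound_of_continuousOn
    hf.continuousOn
  exact ⟨C, fun t ht x hx => hC (t, x) ⟨ht, hx⟩⟩

theorem IsC1.continuousOn_slice (hf : IsC1 Ω T f) {t : ℝ} (ht : t ∈ Icc (0 : ℝ) T) :
    ContinuousOn (f t) (closure Ω) :=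
  hf.continuousOn.comp (f := fun x => (t, x)) (by fun_prop) (fun _ hx => ⟨ht, hx⟩)

theorem IsC1.continuousOn_time (hf : IsC1 Ω T f) {x : Eucl N} (hx : x ∈ closure Ω) :
    ContinuousOn (fun t => f t x) (Icc 0 T) :=
  hf.continuousOn.comp (f := fun t => (t, x)) (by fun_prop) (fun _ ht => ⟨ht, hx⟩)

theorem IsC1.contDiffAt (hf : IsC1 Ω T f) (hΩ : IsOpen Ω) {t : ℝ} {x : Eucl N}
    (ht : t ∈ Ioo 0 T) (hx : x ∈ Ω) :
    ContDiffAt ℝ 1 (fun z : ℝ × Eucl N => f z.1 z.2) (t, x) :=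
  ContDiffOn.contDiffAt hf (mem_of_superset ((isOpen_cylinder (T := T) hΩ).mem_nhds ⟨ht, hx⟩)
    cylinder_subset_closed)

theorem IsC1.hasFDerivAt (hf : IsC1 Ω T f) (hΩ : IsOpen Ω) {t : ℝ} {x : Eucl N}
    (ht : t ∈ Ioo 0 T) (hx : x ∈ Ω) :
    HasFDerivAt (fun z : ℝ × Eucl N => f z.1 z.2)
      (fderiv ℝ (fun z : ℝ × Eucl N => f z.1 z.2) (t, x)) (t, x) :=
  ((hf.contDiffAt hΩ ht hx).differentiableAt (by simp)).hasFDerivAt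

theorem IsC1.hasDerivAt_time (hf : IsC1 Ω T f) (hΩ : IsOpen Ω) {t : ℝ} {x : Eucl N}
    (ht : t ∈ Ioo 0 T) (hx : x ∈ Ω) :
    HasDerivAt (fun s => f s x)
      (fderiv ℝ (fun z : ℝ × Eucl N => f z.1 z.2) (t, x) (1, 0)) t := by
  have h1 : HasDerivAt (fun s : ℝ => (s, x)) ((1 : ℝ), (0 : Eucl N)) t :=
    (hasDerivAt_id t).prodMk (hasDerivAt_const t x)
  exact (hf.hasFDerivAt hΩ ht hx).comp_hasDerivAt t h1

theorem IsC1.hasFDerivAt_space (hf : IsC1 Ω T f) (hΩ : IsOpen Ω) {t : ℝ} {x : Eucl N}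
    (ht : t ∈ Ioo 0 T) (hx : x ∈ Ω) :
    HasFDerivAt (f t)
      ((fderiv ℝ (fun z : ℝ × Eucl N => f z.1 z.2) (t, x)).comp
        (ContinuousLinearMap.inr ℝ ℝ (Eucl N))) x := by
  have h1 : HasFDerivAt (fun y : Eucl N => (t, y)) (ContinuousLinearMap.inr ℝ ℝ (Eucl N)) x :=
    hasFDerivAt_prodMk_right t x
  exact (hf.hasFDerivAt hΩ ht hx).comp x h1

theorem IsC1.hasDerivAt (hf : IsC1 Ω T f) (hΩ : IsOpen Ω) {t : ℝ} {x : Eucl N}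
    (ht : t ∈ Ioo 0 T) (hx : x ∈ Ω) :
    HasDerivAt (fun s => f s x) (deriv (fun s => f s x) t) t :=
  (hf.hasDerivAt_time hΩ ht hx).differentiableAt.hasDerivAt

theorem IsC1.hasFDerivAt_slice (hf : IsC1 Ω T f) (hΩ : IsOpen Ω) {t : ℝ} {x : Eucl N}
    (ht : t ∈ Ioo 0 T) (hx : x ∈ Ω) :
    HasFDerivAt (f t) (fderiv ℝ (f t) x) x :=
  (hf.hasFDerivAt_space hΩ ht hx).differentiableAt.hasFDerivAt

theorem IsC1.contDiffOn_slice (hf : IsC1 Ω T f) {t : ℝ} (ht : t ∈ Icc (0 : ℝ) T) :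
    ContDiffOn ℝ 1 (f t) (closure Ω) :=
  ContDiffOn.comp (g := fun z : ℝ × Eucl N => f z.1 z.2) (f := fun x => (t, x)) hf
    (by fun_prop) (fun _ hx => ⟨ht, hx⟩)

theorem IsC1.continuousOn_fderiv (hf : IsC1 Ω T f) (hΩ : IsOpen Ω) :
    ContinuousOn (fderiv ℝ (fun z : ℝ × Eucl N => f z.1 z.2)) (cylinder Ω T) :=
  (ContDiffOn.mono hf cylinder_subset_closed).continuousOn_fderiv_of_isOpen
    (isOpen_cylinder hΩ) le_rfl

theorem IsC1.continuousOn_deriv_time (hf : IsC1 Ω T f) (hΩ : IsOpen Ω) :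
    ContinuousOn (fun z : ℝ × Eucl N => deriv (fun s => f s z.2) z.1) (cylinder Ω T) := by
  have h : ContinuousOn (fun z : ℝ × Eucl N =>
      fderiv ℝ (fun z : ℝ × Eucl N => f z.1 z.2) z (1, 0)) (cylinder Ω T) :=
    (hf.continuousOn_fderiv hΩ).clm_apply continuousOn_const
  refine h.congr fun z hz => ?_
  exact (hf.hasDerivAt_time hΩ hz.1 hz.2).deriv

theorem IsC1.continuousOn_fderiv_space (hf : IsC1 Ω T f) (hΩ : IsOpen Ω) :
    ContinuousOn (fun z : ℝ × Eucl N => fderiv ℝ (f z.1) z.2) (cylinder Ω T) := by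
  have h : ContinuousOn (fun z : ℝ × Eucl N =>
      (fderiv ℝ (fun z : ℝ × Eucl N => f z.1 z.2) z).comp
        (ContinuousLinearMap.inr ℝ ℝ (Eucl N))) (cylinder Ω T) :=
    (hf.continuousOn_fderiv hΩ).clm_comp continuousOn_const
  refine h.congr fun z hz => ?_
  exact (hf.hasFDerivAt_space hΩ hz.1 hz.2).fderiv

theorem IsC1.exists_bound_deriv_time (hf : IsC1 Ω T f) (hΩ : IsOpen Ω)
    (hb : Bornology.IsBounded Ω) :
    ∃ C : ℝ, ∀ t ∈ Ioo 0 T, ∀ x ∈ Ω, ‖deriv (fun s => f s x) t‖ ≤ C := by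
  obtain ⟨C, hC⟩ := exists_bound_fderiv_of_contDiffOn (isCompact_closed_cylinder (T := T) hb)
    (isOpen_cylinder hΩ) cylinder_subset_closed hf
  refine ⟨C, fun t ht x hx => ?_⟩
  rw [(hf.hasDerivAt_time hΩ ht hx).deriv]
  refine ((ContinuousLinearMap.le_opNorm _ _).trans ?_)
  have h1 : ‖((1 : ℝ), (0 : Eucl N))‖ = 1 := by simp [Prod.norm_def]
  rw [h1, mul_one]
  exact hC _ ⟨ht, hx⟩

theorem IsC1.exists_bound_fderiv_space (hf : IsC1 Ω T f) (hΩ : IsOpen Ω)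
    (hb : Bornology.IsBounded Ω) :
    ∃ C : ℝ, ∀ t ∈ Ioo 0 T, ∀ x ∈ Ω, ‖fderiv ℝ (f t) x‖ ≤ C := by
  obtain ⟨C, hC⟩ := exists_bound_fderiv_of_contDiffOn (isCompact_closed_cylinder (T := T) hb)
    (isOpen_cylinder hΩ) cylinder_subset_closed hf
  refine ⟨C, fun t ht x hx => ?_⟩
  rw [(hf.hasFDerivAt_space hΩ ht hx).fderiv]
  have hC' := hC _ (show (t, x) ∈ cylinder Ω T from ⟨ht, hx⟩)
  refine ContinuousLinearMap.opNorm_le_bound _ ((norm_nonneg _).trans hC') fun v => ?_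
  rw [ContinuousLinearMap.comp_apply]
  refine (ContinuousLinearMap.le_opNorm _ _).trans ?_
  have h1 : ‖ContinuousLinearMap.inr ℝ ℝ (Eucl N) v‖ = ‖v‖ := by simp [Prod.norm_def]
  rw [h1]
  gcongr

/-- A bounded field that is continuous on the cylinder is essentially bounded. -/
theorem memLp_top_of_continuousOn {G : Type*} [NormedAddCommGroup G]
    [SecondCountableTopologyEither (ℝ × Eucl N) G] {g : ℝ × Eucl N → G} (hΩ : IsOpen Ω)
    (hg : ContinuousOn g (cylinder Ω T)) {C : ℝ}
    (hC : ∀ t ∈ Ioo 0 T, ∀ x ∈ Ω, ‖g (t, x)‖ ≤ C) :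
    MemLp g ∞ (volume.restrict (cylinder Ω T)) := by
  have hm : MeasurableSet (cylinder Ω T) := (isOpen_cylinder hΩ).measurableSet
  exact memLp_top_of_bound (hg.aestronglyMeasurable hm) C
    ((ae_restrict_iff' hm).2 (ae_of_all _ fun z hz => hC z.1 hz.1 z.2 hz.2))

theorem IsC1.memLp_top (hf : IsC1 Ω T f) (hΩ : IsOpen Ω) (hb : Bornology.IsBounded Ω) :
    MemLp (fun z : ℝ × Eucl N => f z.1 z.2) ∞ (volume.restrict (cylinder Ω T)) := by
  obtain ⟨C, hC⟩ := hf.exists_bound hb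
  exact memLp_top_of_continuousOn hΩ (hf.continuousOn.mono cylinder_subset_closed)
    (fun t ht x hx => hC t (Ioo_subset_Icc_self ht) x (subset_closure hx))

theorem IsC1.memLp_top_deriv_time (hf : IsC1 Ω T f) (hΩ : IsOpen Ω)
    (hb : Bornology.IsBounded Ω) :
    MemLp (fun z : ℝ × Eucl N => deriv (fun s => f s z.2) z.1) ∞
      (volume.restrict (cylinder Ω T)) := by
  obtain ⟨C, hC⟩ := hf.exists_bound_deriv_time hΩ hb
  exact memLp_top_of_continuousOn hΩ (hf.continuousOn_deriv_time hΩ) hC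

theorem IsC1.memLp_top_fderiv_space (hf : IsC1 Ω T f) (hΩ : IsOpen Ω)
    (hb : Bornology.IsBounded Ω) :
    MemLp (fun z : ℝ × Eucl N => fderiv ℝ (f z.1) z.2) ∞
      (volume.restrict (cylinder Ω T)) := by
  obtain ⟨C, hC⟩ := hf.exists_bound_fderiv_space hΩ hb
  exact memLp_top_of_continuousOn hΩ (hf.continuousOn_fderiv_space hΩ) hC

end C1

/-! ### Coordinates and the trace -/

section TensorAlgebra

variable {N : ℕ}

theorem stdVec_apply (i j : Fin N) : (stdVec j : Eucl N) i = if i = j then 1 else 0 := by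
  simp [stdVec]

theorem norm_stdVec (j : Fin N) : ‖(stdVec j : Eucl N)‖ = 1 := by simp [stdVec]

theorem sum_smul_stdVec (v : Eucl N) : ∑ j, v j • (stdVec j : Eucl N) = v := by
  ext i
  simp [stdVec_apply]

theorem sum_apply_mul {F : Type*} [NormedAddCommGroup F] [NormedSpace ℝ F] (l : Eucl N →L[ℝ] F)
    (v : Eucl N) : ∑ j, v j • l (stdVec j) = l v := by
  conv_rhs => rw [← sum_smul_stdVec v]
  simp

theorem inner_eq_sum (v w : Eucl N) : (inner ℝ v w : ℝ) = ∑ i, v i * w i := by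
  simp [PiLp.inner_apply, mul_comm]

@[simp] theorem tr_add (A B : Eucl N →L[ℝ] Eucl N) : tr (A + B) = tr A + tr B := by
  simp [tr, Finset.sum_add_distrib]

@[simp] theorem tr_sub (A B : Eucl N →L[ℝ] Eucl N) : tr (A - B) = tr A - tr B := by
  simp [tr, Finset.sum_sub_distrib]

@[simp] theorem tr_smul (c : ℝ) (A : Eucl N →L[ℝ] Eucl N) : tr (c • A) = c * tr A := by
  simp [tr, Finset.mul_sum]

theorem tr_smulRight (l : Eucl N →L[ℝ] ℝ) (v : Eucl N) : tr (l.smulRight v) = l v := by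
  rw [← sum_apply_mul l v]
  simp [tr, mul_comm]

theorem abs_tr_le (A : Eucl N →L[ℝ] Eucl N) : |tr A| ≤ N * ‖A‖ := by
  unfold tr
  refine (Finset.abs_sum_le_sum_abs _ _).trans ?_
  have : ∀ j : Fin N, |(A (stdVec j)) j| ≤ ‖A‖ := fun j => by
    refine (PiLp.norm_apply_le (A (stdVec j)) j).trans ?_
    simpa [norm_stdVec] using A.le_opNorm (stdVec j)
  simpa using Finset.sum_le_sum fun j (_ : j ∈ Finset.univ) => this j

theorem tr_fderiv_smul {f : Eucl N → ℝ} {V : Eucl N → Eucl N} {x : Eucl N}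
    (hf : DifferentiableAt ℝ f x) (hV : DifferentiableAt ℝ V x) :
    tr (fderiv ℝ (fun y => f y • V y) x) = f x * tr (fderiv ℝ V x) + fderiv ℝ f x (V x) := by
  rw [fderiv_fun_smul hf hV, tr_add, tr_smul, tr_smulRight]

end TensorAlgebra

/-! ### Positivity of the strong density -/

section Positivity

variable {N : ℕ} {Ω : Set (Eucl N)} {T : ℝ} {r : ℝ → Eucl N → ℝ} {U : ℝ → Eucl N → Eucl N}

/-- Minimum principle for the equation of continuity with no-slip boundary condition. -/
theorem exists_lower_bound_density (hΩ : IsOpen Ω) (hb : Bornology.IsBounded Ω)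
    (hne : Ω.Nonempty) (hr : IsC1 Ω T r) (hU : IsC1 Ω T U)
    (hvan : VanishesOnBoundary Ω T U) (hT : 0 < T)
    (hnn : ∀ t ∈ Icc (0 : ℝ) T, ∀ x ∈ closure Ω, 0 ≤ r t x)
    (heq : ∀ t ∈ Ioo (0 : ℝ) T, ∀ x ∈ Ω, deriv (fun s => r s x) t =
      -(r t x * tr (fderiv ℝ (U t) x)) - fderiv ℝ (r t) x (U t x))
    (hpos : ∀ x ∈ closure Ω, 0 < r 0 x) :
    ∃ δ > 0, ∀ t ∈ Icc (0 : ℝ) T, ∀ x ∈ closure Ω, δ ≤ r t x := by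
  have h0T : (0 : ℝ) ∈ Icc 0 T := ⟨le_rfl, hT.le⟩
  obtain ⟨xm, hxm, hmin⟩ := hb.isCompact_closure.exists_isMinOn hne.closure
    (hr.continuousOn_slice h0T)
  obtain ⟨C, hC⟩ := hU.exists_bound_fderiv_space hΩ hb
  obtain ⟨L₀, hL₀⟩ := hr.exists_bound_fderiv_space hΩ hb
  set L := max L₀ 0 with hLdef
  have hL : ∀ t ∈ Ioo 0 T, ∀ x ∈ Ω, ‖fderiv ℝ (r t) x‖ ≤ L := fun t ht x hx =>
    (hL₀ t ht x hx).trans (le_max_left _ _)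
  have hL0 : 0 ≤ L := le_max_right _ _
  set M : ℝ := N * max C 0 with hMdef
  have hM0 : 0 ≤ M := by positivity
  have hM : ∀ t ∈ Ioo 0 T, ∀ x ∈ Ω, tr (fderiv ℝ (U t) x) ≤ M := fun t ht x hx =>
    (le_abs_self _).trans ((abs_tr_le _).trans (by
      rw [hMdef]; gcongr; exact (hC t ht x hx).trans (le_max_left _ _)))
  -- Barrier argument: the factor exp(Mt) compensates compression, because M bounds div U from
  -- above, and εt makes the time derivative strictly positive wherever the transport term is small.
  -- Taking τ < T keeps every positive minimum time inside (0, T), where the equation holds.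
  have key : ∀ ε > 0, ∀ τ ∈ Ioo 0 T, ∀ x ∈ closure Ω,
      r 0 xm ≤ r τ x * Real.exp (M * τ) + ε * τ := by
    intro ε hε τ hτ y hy
    set G : ℝ → Eucl N → ℝ := fun t x => r t x * Real.exp (M * t) + ε * t with hG
    have hGc : ContinuousOn (fun z : ℝ × Eucl N => G z.1 z.2) (Icc 0 T ×ˢ closure Ω) :=
      (hr.continuousOn.mul (by fun_prop)).add (by fun_prop)
    have hsub : Icc 0 τ ×ˢ closure Ω ⊆ Icc 0 T ×ˢ closure Ω :=
      prod_mono (Icc_subset_Icc_right hτ.2.le) Subset.rfl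
    obtain ⟨⟨t₀, x₀⟩, ⟨ht₀, hx₀⟩, hm⟩ :=
      (isCompact_Icc.prod hb.isCompact_closure).exists_isMinOn
        (⟨(0, xm), ⟨le_rfl, hτ.1.le⟩, hxm⟩ : (Icc 0 τ ×ˢ closure Ω).Nonempty) (hGc.mono hsub)
    have hm' : ∀ t ∈ Icc 0 τ, ∀ x ∈ closure Ω, G t₀ x₀ ≤ G t x := fun t ht x hx =>
      hm (show (t, x) ∈ Icc 0 τ ×ˢ closure Ω from ⟨ht, hx⟩)
    have hder : ∀ t ∈ Ioo 0 T, ∀ x ∈ Ω, ∃ d, HasDerivAt (fun s => G s x) d t ∧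
        ε - Real.exp (M * T) * (‖fderiv ℝ (r t) x‖ * ‖U t x‖) ≤ d := by
      intro t ht x hx
      have h1 := hr.hasDerivAt hΩ ht hx
      have h2 : HasDerivAt (fun s : ℝ => Real.exp (M * s)) (Real.exp (M * t) * (M * 1)) t :=
        ((hasDerivAt_id t).const_mul M).exp
      refine ⟨_, (h1.mul h2).add ((hasDerivAt_id t).const_mul ε), ?_⟩
      rw [heq t ht x hx]
      have hlin : fderiv ℝ (r t) x (U t x) ≤ ‖fderiv ℝ (r t) x‖ * ‖U t x‖ :=
        (le_abs_self _).trans ((fderiv ℝ (r t) x).le_opNorm _)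
      have hE0 := Real.exp_pos (M * t)
      have hE : Real.exp (M * t) ≤ Real.exp (M * T) := by gcongr; exact ht.2.le
      have hr0 := hnn t (Ioo_subset_Icc_self ht) x (subset_closure hx)
      have a1 : 0 ≤ Real.exp (M * t) * (r t x * (M - tr (fderiv ℝ (U t) x))) :=
        mul_nonneg hE0.le (mul_nonneg hr0 (sub_nonneg.2 (hM t ht x hx)))
      have a2 : Real.exp (M * t) * fderiv ℝ (r t) x (U t x)
          ≤ Real.exp (M * T) * (‖fderiv ℝ (r t) x‖ * ‖U t x‖) :=
        (mul_le_mul_of_nonneg_left hlin hE0.le).trans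
          (mul_le_mul_of_nonneg_right hE (by positivity))
      nlinarith [a1, a2]
    -- A minimum at a positive time is impossible. In the interior ∇r vanishes, so the time
    -- derivative is at least ε, against the sign of the left difference quotients.
    have ht₀' : t₀ = 0 := by
      by_contra hne0
      have ht₀pos : 0 < t₀ := lt_of_le_of_ne ht₀.1 (Ne.symm hne0)
      have ht₀T : t₀ ∈ Ioo 0 T := ⟨ht₀pos, ht₀.2.trans_lt hτ.2⟩
      by_cases hxΩ : x₀ ∈ Ω
      · obtain ⟨d, hd, hdε⟩ := hder t₀ ht₀T x₀ hxΩ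
        have hz : fderiv ℝ (r t₀) x₀ = 0 := by
          apply IsLocalMin.fderiv_eq_zero
          filter_upwards [hΩ.mem_nhds hxΩ] with x hx
          have := hm' t₀ ht₀ x (subset_closure hx)
          simp only [hG, add_le_add_iff_right] at this
          exact le_of_mul_le_mul_right this (Real.exp_pos _)
        rw [hz] at hdε
        simp only [norm_zero, zero_mul, mul_zero, sub_zero] at hdε
        have hs : Tendsto (slope (fun s => G s x₀) t₀) (𝓝[<] t₀) (𝓝 d) :=
          hd.tendsto_slope.mono_left (nhdsWithin_mono _ fun s hs => ne_of_lt hs)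
        have : d ≤ 0 := by
          refine le_of_tendsto hs ?_
          filter_upwards [Ioo_mem_nhdsLT ht₀pos] with s hs
          rw [slope_def_field]
          exact div_nonpos_of_nonneg_of_nonpos
            (sub_nonneg.2 (hm' s ⟨hs.1.le, hs.2.le.trans ht₀.2⟩ x₀ hx₀)) (by linarith [hs.2])
        linarith
      -- On the boundary no equation is available. Since U vanishes at x₀ for all times, uniform
      -- continuity makes the transport term small at interior points near x₀, simultaneously for
      -- all times. There G grows at rate at least ε/2 on [t₀/2, t₀], and the increment passes to
      -- the limit x → x₀.
      · have hfr : x₀ ∈ frontier Ω := by rw [hΩ.frontier_eq]; exact ⟨hx₀, hxΩ⟩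
        have huc := (isCompact_closed_cylinder (T := T) hb).uniformContinuousOn_of_continuous
          hU.continuousOn
        rw [Metric.uniformContinuousOn_iff] at huc
        -- Chosen so that exp(MT) · L · η ≤ ε/2; the summand 1 keeps the denominator positive when L
        -- = 0.
        set η := ε / (2 * (Real.exp (M * T) * L + 1)) with hη
        have hηpos : 0 < η := by positivity
        obtain ⟨δ, hδ, hδU⟩ := huc η hηpos
        have hbd : x₀ ∈ closure Ω := hx₀
        have hnb : (𝓝[Ω] x₀).NeBot := mem_closure_iff_nhdsWithin_neBot.1 hbd
        have hlim : ∀ t ∈ Icc 0 T, Tendsto (fun x => G t x) (𝓝[Ω] x₀) (𝓝 (G t x₀)) := by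
          intro t ht
          have : ContinuousOn (fun x => G t x) (closure Ω) :=
            hGc.comp (f := fun x => (t, x)) (by fun_prop) (fun _ hx => ⟨ht, hx⟩)
          exact (this x₀ hx₀).mono_left (nhdsWithin_mono _ subset_closure)
        have hhalf : t₀ / 2 ∈ Ioo 0 T := ⟨by linarith, by linarith [ht₀T.2]⟩
        have hinc : ε / 2 * (t₀ - t₀ / 2) ≤ G t₀ x₀ - G (t₀ / 2) x₀ := by
          refine ge_of_tendsto ((hlim t₀ (Ioo_subset_Icc_self ht₀T)).sub
            (hlim (t₀ / 2) (Ioo_subset_Icc_self hhalf))) ?_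
          filter_upwards [self_mem_nhdsWithin,
            mem_nhdsWithin_of_mem_nhds (Metric.ball_mem_nhds x₀ hδ)] with x hx hxb
          have hxs : Icc (t₀ / 2) t₀ ⊆ Ioo 0 T := fun s hs =>
            ⟨hhalf.1.trans_le hs.1, hs.2.trans_lt ht₀T.2⟩
          have hdx : ∀ s ∈ Icc (t₀ / 2) t₀, ∃ d, HasDerivAt (fun s => G s x) d s ∧ ε / 2 ≤ d := by
            intro s hs
            obtain ⟨d, hd, hdε⟩ := hder s (hxs hs) x hx
            refine ⟨d, hd, le_trans ?_ hdε⟩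
            have hsT := Ioo_subset_Icc_self (hxs hs)
            have hUs : ‖U s x‖ < η := by
              have := hδU (s, x) ⟨hsT, subset_closure hx⟩ (s, x₀) ⟨hsT, hx₀⟩
                (by simpa [Prod.dist_eq, hδ] using hxb)
              simpa [hvan s hsT x₀ hfr] using this
            have h1 : Real.exp (M * T) * (‖fderiv ℝ (r s) x‖ * ‖U s x‖)
                ≤ Real.exp (M * T) * (L * η) := by
              gcongr
              exact hL s (hxs hs) x hx
            have h2 : Real.exp (M * T) * (L * η) ≤ ε / 2 := by
              have hp : 0 < Real.exp (M * T) * L + 1 := by positivity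
              have : ε / 2 = (Real.exp (M * T) * L + 1) * η := by
                rw [hη]; field_simp
              rw [this]; nlinarith
            linarith
          refine (convex_Icc (t₀ / 2) t₀).mul_sub_le_image_sub_of_le_deriv
            (f := fun s => G s x) ?_ ?_ ?_ _ ⟨le_rfl, by linarith⟩ _ ⟨by linarith, le_rfl⟩
            (by linarith)
          · intro s hs
            obtain ⟨d, hd, -⟩ := hdx s hs
            exact hd.continuousAt.continuousWithinAt
          · intro s hs
            obtain ⟨d, hd, -⟩ := hdx s (interior_subset hs)
            exact hd.differentiableAt.differentiableWithinAt
          · intro s hs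
            obtain ⟨d, hd, hd'⟩ := hdx s (interior_subset hs)
            rwa [hd.deriv]
        have := hm' (t₀ / 2) ⟨hhalf.1.le, by linarith [ht₀.2]⟩ x₀ hx₀
        nlinarith
    subst ht₀'
    have h1 := hm' τ ⟨hτ.1.le, le_rfl⟩ y hy
    have h2 : r 0 xm ≤ r 0 x₀ := hmin hx₀
    simp only [hG, mul_zero, Real.exp_zero, mul_one, add_zero] at h1
    linarith
  have hint : ∀ t ∈ Ioo 0 T, ∀ x ∈ closure Ω, r 0 xm * Real.exp (-(M * T)) ≤ r t x := by
    intro t ht x hx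
    have h1 : r 0 xm ≤ r t x * Real.exp (M * t) := by
      refine le_of_forall_pos_le_add fun ε hε => ?_
      have := key (ε / t) (div_pos hε ht.1) t ht x hx
      rwa [div_mul_cancel₀ _ ht.1.ne'] at this
    have h2 : Real.exp (M * t) ≤ Real.exp (M * T) := by gcongr; exact ht.2.le
    have h3 := hnn t (Ioo_subset_Icc_self ht) x hx
    rw [Real.exp_neg, ← div_eq_mul_inv, div_le_iff₀ (Real.exp_pos _)]
    exact h1.trans (mul_le_mul_of_nonneg_left h2 h3)
  refine ⟨r 0 xm * Real.exp (-(M * T)), mul_pos (hpos xm hxm) (Real.exp_pos _), ?_⟩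
  intro t ht x hx
  -- The end times 0 and T are reached by continuity in time.
  have hcl : t ∈ closure (Ioo 0 T) := by rwa [closure_Ioo hT.ne]
  have hnb : (𝓝[Ioo 0 T] t).NeBot := mem_closure_iff_nhdsWithin_neBot.1 hcl
  refine ge_of_tendsto (((hr.continuousOn_time hx) t ht).mono_left
    (nhdsWithin_mono _ Ioo_subset_Icc_self)) ?_
  filter_upwards [self_mem_nhdsWithin] with s hs using hint s hs x hx

end Positivity

/-! ### The scalar product of tensors and the viscous stress as continuous (bi)linear maps -/

section Frob

variable {N : ℕ}

theorem frob_eq_sum_inner (A B : Eucl N →L[ℝ] Eucl N) :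
    frob A B = ∑ j, (inner ℝ (A (stdVec j)) (B (stdVec j)) : ℝ) := by
  simp only [frob, inner_eq_sum]
  exact Finset.sum_comm

theorem frob_add_left (A A' B : Eucl N →L[ℝ] Eucl N) :
    frob (A + A') B = frob A B + frob A' B := by
  simp [frob, add_mul, Finset.sum_add_distrib]

theorem frob_add_right (A B B' : Eucl N →L[ℝ] Eucl N) :
    frob A (B + B') = frob A B + frob A B' := by
  simp [frob, mul_add, Finset.sum_add_distrib]

theorem frob_sub_left (A A' B : Eucl N →L[ℝ] Eucl N) :
    frob (A - A') B = frob A B - frob A' B := by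
  simp [frob, sub_mul, Finset.sum_sub_distrib]

theorem frob_sub_right (A B B' : Eucl N →L[ℝ] Eucl N) :
    frob A (B - B') = frob A B - frob A B' := by
  simp [frob, mul_sub, Finset.sum_sub_distrib]

theorem frob_smul_left (c : ℝ) (A B : Eucl N →L[ℝ] Eucl N) :
    frob (c • A) B = c * frob A B := by
  simp [frob, Finset.mul_sum, mul_assoc]

theorem frob_smul_right (c : ℝ) (A B : Eucl N →L[ℝ] Eucl N) :
    frob A (c • B) = c * frob A B := by
  simp [frob, Finset.mul_sum, mul_left_comm]

theorem frob_id_left (B : Eucl N →L[ℝ] Eucl N) :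
    frob (ContinuousLinearMap.id ℝ (Eucl N)) B = tr B := by
  simp [frob, tr, stdVec_apply]

theorem tr_sq_le (A : Eucl N →L[ℝ] Eucl N) : tr A ^ 2 ≤ N * frob A A := by
  have h1 : tr A ^ 2 ≤ N * ∑ j, (A (stdVec j)) j ^ 2 := by
    simpa [tr] using sq_sum_le_card_mul_sum_sq (s := Finset.univ)
      (f := fun j : Fin N => (A (stdVec j)) j)
  refine h1.trans ?_
  gcongr
  refine Finset.sum_le_sum fun i _ => ?_
  rw [sq]
  exact Finset.single_le_sum (f := fun j => (A (stdVec j)) i * (A (stdVec j)) i)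
    (fun j _ => mul_self_nonneg _) (Finset.mem_univ i)

theorem frob_tensor (v w : Eucl N) (B : Eucl N →L[ℝ] Eucl N) :
    frob (tensor v w) B = (inner ℝ v (B w) : ℝ) := by
  rw [frob_eq_sum_inner, ← sum_apply_mul B w, inner_sum]
  refine Finset.sum_congr rfl fun j _ => ?_
  have : (inner ℝ w (stdVec j) : ℝ) = w j := by
    rw [inner_eq_sum]; simp [stdVec_apply]
  simp [tensor, this, inner_smul_left, inner_smul_right]

theorem adjoint_stdVec_apply (A : Eucl N →L[ℝ] Eucl N) (i j : Fin N) :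
    (ContinuousLinearMap.adjoint A (stdVec j)) i = (A (stdVec i)) j := by
  have h1 : ∀ v : Eucl N, (inner ℝ (stdVec i) v : ℝ) = v i := fun v => by
    rw [inner_eq_sum]; simp [stdVec_apply]
  have h2 : ∀ v : Eucl N, (inner ℝ v (stdVec j) : ℝ) = v j := fun v => by
    rw [inner_eq_sum]; simp [stdVec_apply]
  rw [← h1, ContinuousLinearMap.adjoint_inner_right, h2]

/-- The scalar product of tensors as a continuous bilinear form. -/
def frobL (N : ℕ) :
    (Eucl N →L[ℝ] Eucl N) →L[ℝ] (Eucl N →L[ℝ] Eucl N) →L[ℝ] ℝ :=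
  (LinearMap.mk₂ ℝ frob frob_add_left frob_smul_left frob_add_right
    frob_smul_right).toContinuousBilinearMap

theorem frobL_apply (A B : Eucl N →L[ℝ] Eucl N) : frobL N A B = frob A B := rfl

/-- The trace as a continuous linear form. -/
def trL (N : ℕ) : (Eucl N →L[ℝ] Eucl N) →L[ℝ] ℝ :=
  LinearMap.toContinuousLinearMap
    { toFun := tr, map_add' := tr_add, map_smul' := fun c A => by simp }

theorem trL_apply (A : Eucl N →L[ℝ] Eucl N) : trL N A = tr A := rfl

/-- Transposition of tensors as a continuous linear map. -/
def transposeL (N : ℕ) : (Eucl N →L[ℝ] Eucl N) →L[ℝ] (Eucl N →L[ℝ] Eucl N) :=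
  LinearMap.toContinuousLinearMap
    { toFun := fun A => ContinuousLinearMap.adjoint A
      map_add' := fun A B => map_add _ A B
      map_smul' := fun c A => by simp }

theorem transposeL_apply (A : Eucl N →L[ℝ] Eucl N) :
    transposeL N A = ContinuousLinearMap.adjoint A := rfl

theorem stress_add (μ lam : ℝ) (A B : Eucl N →L[ℝ] Eucl N) :
    stress μ lam (A + B) = stress μ lam A + stress μ lam B := by
  simp only [stress, tr_add, map_add]
  module

theorem stress_smul (μ lam c : ℝ) (A : Eucl N →L[ℝ] Eucl N) :
    stress μ lam (c • A) = c • stress μ lam A := by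
  have h : ContinuousLinearMap.adjoint (c • A) = c • ContinuousLinearMap.adjoint A :=
    (transposeL N).map_smul c A
  simp only [stress, tr_smul, h]
  module

/-- The viscous stress as a continuous linear map of the velocity gradient. -/
def stressL (N : ℕ) (μ lam : ℝ) : (Eucl N →L[ℝ] Eucl N) →L[ℝ] (Eucl N →L[ℝ] Eucl N) :=
  LinearMap.toContinuousLinearMap
    { toFun := stress μ lam, map_add' := stress_add μ lam, map_smul' := stress_smul μ lam }

theorem stressL_apply (μ lam : ℝ) (A : Eucl N →L[ℝ] Eucl N) :
    stressL N μ lam A = stress μ lam A := rfl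

theorem stress_sub (μ lam : ℝ) (A B : Eucl N →L[ℝ] Eucl N) :
    stress μ lam (A - B) = stress μ lam A - stress μ lam B := by
  simp only [← stressL_apply, map_sub]

theorem frob_stress (μ lam : ℝ) (A B : Eucl N →L[ℝ] Eucl N) :
    frob (stress μ lam A) B = μ * (frob A B + frob (ContinuousLinearMap.adjoint A) B
      - 2 / (N : ℝ) * tr A * tr B) + lam * tr A * tr B := by
  simp only [stress, frob_add_left, frob_sub_left, frob_smul_left, frob_id_left]

end Frob

/-! ### Integration by parts, Korn and Poincaré for compactly supported fields -/

section IntegrationByParts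

variable {N : ℕ} {Ω : Set (Eucl N)}

theorem integrable_fderiv_of_hasCompactSupport {f : Eucl N → ℝ} (hf : ContDiff ℝ 1 f)
    (hs : HasCompactSupport f) (v : Eucl N) : Integrable (fun x => fderiv ℝ f x v) := by
  refine Continuous.integrable_of_hasCompactSupport ?_ ?_
  · exact (hf.continuous_fderiv (by simp)).clm_apply continuous_const
  · exact hs.fderiv_apply (𝕜 := ℝ) (v := v)

theorem integral_fderiv_of_hasCompactSupport {f : Eucl N → ℝ} (hf : ContDiff ℝ 1 f)
    (hs : HasCompactSupport f) (v : Eucl N) : ∫ x, fderiv ℝ f x v = 0 := by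
  have h := integral_mul_fderiv_eq_neg_fderiv_mul_of_integrable (μ := (volume : Measure (Eucl N)))
    (f := fun _ => (1 : ℝ)) (g := f) (v := v) (by simp)
    (by simpa using integrable_fderiv_of_hasCompactSupport hf hs v)
    (by simpa using hf.continuous.integrable_of_hasCompactSupport hs)
    (by simp) (fun x _ => (hf.differentiable (by simp)) x)
  simpa using h

theorem setIntegral_fderiv_of_tsupport_subset {f : Eucl N → ℝ} (hf : ContDiff ℝ 1 f)
    (hs : HasCompactSupport f) (hsΩ : tsupport f ⊆ Ω) (v : Eucl N) :
    ∫ x in Ω, fderiv ℝ f x v = 0 := by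
  rw [setIntegral_eq_integral_of_forall_compl_eq_zero, integral_fderiv_of_hasCompactSupport hf hs]
  intro x hx
  rw [fderiv_of_notMem_tsupport ℝ (fun h => hx (hsΩ h))]
  simp

/-- Off its topological support a function is locally zero. This extends to the whole space products
of a field that is smooth only in Ω with one compactly supported there. -/
theorem contDiff_of_contDiffAt_tsupport {E F : Type*} [NormedAddCommGroup E] [NormedSpace ℝ E]
    [NormedAddCommGroup F] [NormedSpace ℝ F] {n : ℕ∞ω} {f : E → F} (h : ∀ x ∈ tsupport f, ContDiffAt ℝ n f x) : ContDiff ℝ n f := by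
  rw [contDiff_iff_contDiffAt]
  intro x
  by_cases hx : x ∈ tsupport f
  · exact h x hx
  · exact (contDiffAt_const (c := (0 : F))).congr_of_eventuallyEq
      (notMem_tsupport_iff_eventuallyEq.1 hx)

/-- Integration by parts for a tensor field against a compactly supported vector field. -/
theorem integral_tensorDiv_of_tsupport_subset (hΩ : IsOpen Ω)
    {M : Eucl N → (Eucl N →L[ℝ] Eucl N)} (hM : ContDiffOn ℝ 1 M Ω) {φ : Eucl N → Eucl N}
    (hφ : ContDiff ℝ 1 φ) (hs : HasCompactSupport φ) (hsΩ : tsupport φ ⊆ Ω) :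
    IntegrableOn (fun x => (inner ℝ (tensorDiv M x) (φ x) : ℝ) + frob (M x) (fderiv ℝ φ x)) Ω ∧
    ∫ x in Ω, ((inner ℝ (tensorDiv M x) (φ x) : ℝ) + frob (M x) (fderiv ℝ φ x)) = 0 := by
  -- The j-th component of the vector field Mᵗφ. Its divergence is the integrand, and each summand
  -- ∂_j f_j integrates to zero.
  set f : Fin N → Eucl N → ℝ := fun j x => (inner ℝ (M x (stdVec j)) (φ x) : ℝ) with hf
  have hsub : ∀ j, tsupport (f j) ⊆ tsupport φ := fun j => by
    refine closure_mono fun x hx => ?_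
    rw [Function.mem_support] at hx ⊢
    intro h
    exact hx (by simp [hf, h])
  have hMat : ∀ x ∈ Ω, ContDiffAt ℝ 1 M x := fun x hx => hM.contDiffAt (hΩ.mem_nhds hx)
  have hfc : ∀ j, ContDiff ℝ 1 (f j) := fun j => contDiff_of_contDiffAt_tsupport fun x hx =>
    ((hMat x (hsΩ (hsub j hx))).clm_apply contDiffAt_const).inner ℝ hφ.contDiffAt
  have hfs : ∀ j, HasCompactSupport (f j) := fun j =>
    hs.of_isClosed_subset (isClosed_tsupport _) (hsub j)
  have hpt : ∀ x ∈ Ω, ∑ j, fderiv ℝ (f j) x (stdVec j) =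
      (inner ℝ (tensorDiv M x) (φ x) : ℝ) + frob (M x) (fderiv ℝ φ x) := by
    intro x hx
    have hd : ∀ j, fderiv ℝ (f j) x (stdVec j) =
        (inner ℝ (M x (stdVec j)) (fderiv ℝ φ x (stdVec j)) : ℝ)
          + inner ℝ (fderiv ℝ M x (stdVec j) (stdVec j)) (φ x) := by
      intro j
      have h1 : HasFDerivAt (fun y => M y (stdVec j))
          ((fderiv ℝ M x).flip (stdVec j)) x := by
        have := ((hMat x hx).differentiableAt (by simp)).hasFDerivAt.clm_apply
          (hasFDerivAt_const (stdVec j : Eucl N) x)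
        simpa using this
      have h2 := (hφ.differentiable (by simp) x).hasFDerivAt
      rw [(h1.inner ℝ h2).fderiv]
      simp
    simp only [hd, Finset.sum_add_distrib, tensorDiv, sum_inner, frob_eq_sum_inner]
    ring
  have hint : ∀ j ∈ Finset.univ, IntegrableOn (fun x => fderiv ℝ (f j) x (stdVec j)) Ω :=
    fun j _ => (integrable_fderiv_of_hasCompactSupport (hfc j) (hfs j) _).integrableOn
  refine ⟨(integrable_finsetSum _ hint).congr
    ((ae_restrict_iff' hΩ.measurableSet).2 (ae_of_all _ hpt)), ?_⟩
  rw [← setIntegral_congr_fun hΩ.measurableSet hpt, integral_finsetSum _ hint]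
  exact Finset.sum_eq_zero fun j _ =>
    setIntegral_fderiv_of_tsupport_subset (hfc j) (hfs j) ((hsub j).trans hsΩ) _

theorem tensorDiv_smul_id {f : Eucl N → ℝ} {x : Eucl N} (hf : DifferentiableAt ℝ f x) :
    tensorDiv (fun y => f y • ContinuousLinearMap.id ℝ (Eucl N)) x =
      ∑ j, fderiv ℝ f x (stdVec j) • stdVec j := by
  unfold tensorDiv
  refine Finset.sum_congr rfl fun j _ => ?_
  rw [(hf.hasFDerivAt.smul_const (ContinuousLinearMap.id ℝ (Eucl N))).fderiv]
  simp

/-- Symmetry of second derivatives gives div((∇φ)ᵗ) = ∇ div φ = div((div φ) I). Integrating both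
divergences by parts against φ itself and subtracting leaves the claim. It is the core of Korn's
inequality for zero boundary values. -/
theorem integral_frob_transpose_sub_tr_sq {φ : Eucl N → Eucl N} (hφ : ContDiff ℝ 2 φ)
    (hs : HasCompactSupport φ) :
    Integrable (fun x => frob (ContinuousLinearMap.adjoint (fderiv ℝ φ x)) (fderiv ℝ φ x)
      - tr (fderiv ℝ φ x) ^ 2) ∧
    ∫ x, (frob (ContinuousLinearMap.adjoint (fderiv ℝ φ x)) (fderiv ℝ φ x)
      - tr (fderiv ℝ φ x) ^ 2) = 0 := by
  have hD : ContDiff ℝ 1 (fderiv ℝ φ) := hφ.fderiv_right (by norm_num)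
  have hφ1 : ContDiff ℝ 1 φ := hφ.of_le (by norm_num)
  have h1 := integral_tensorDiv_of_tsupport_subset isOpen_univ
    (M := fun x => transposeL N (fderiv ℝ φ x))
    ((transposeL N).contDiff.comp hD).contDiffOn hφ1 hs (subset_univ _)
  have h2 := integral_tensorDiv_of_tsupport_subset isOpen_univ
    (M := fun x => trL N (fderiv ℝ φ x) • ContinuousLinearMap.id ℝ (Eucl N))
    (((trL N).contDiff.comp hD).smul contDiff_const).contDiffOn hφ1 hs (subset_univ _)
  simp only [integrableOn_univ, setIntegral_univ] at h1 h2
  have hDd : ∀ x, HasFDerivAt (fderiv ℝ φ) (fderiv ℝ (fderiv ℝ φ) x) x := fun x =>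
    (hD.differentiable (by simp) x).hasFDerivAt
  have heq : ∀ x, tensorDiv (fun x => transposeL N (fderiv ℝ φ x)) x =
      tensorDiv (fun x => trL N (fderiv ℝ φ x) • ContinuousLinearMap.id ℝ (Eucl N)) x := by
    intro x
    have hsym : IsSymmSndFDerivAt ℝ φ x := hφ.contDiffAt.isSymmSndFDerivAt (by simp)
    have ht : HasFDerivAt (fun y => trL N (fderiv ℝ φ y))
        ((trL N).comp (fderiv ℝ (fderiv ℝ φ) x)) x := (trL N).hasFDerivAt.comp x (hDd x)
    rw [tensorDiv_smul_id ht.differentiableAt, ht.fderiv]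
    unfold tensorDiv
    have hT : HasFDerivAt (fun y => transposeL N (fderiv ℝ φ y))
        ((transposeL N).comp (fderiv ℝ (fderiv ℝ φ) x)) x :=
      (transposeL N).hasFDerivAt.comp x (hDd x)
    rw [hT.fderiv]
    ext i
    simp only [ContinuousLinearMap.comp_apply, transposeL_apply, trL_apply, WithLp.ofLp_sum,
      Finset.sum_apply, PiLp.smul_apply, adjoint_stdVec_apply, stdVec_apply, smul_eq_mul, mul_ite,
      mul_one, mul_zero, Finset.sum_ite_eq, Finset.mem_univ, if_true, tr]
    exact Finset.sum_congr rfl fun j _ => by rw [hsym.eq]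
  have hfun : (fun x => frob (ContinuousLinearMap.adjoint (fderiv ℝ φ x)) (fderiv ℝ φ x)
      - tr (fderiv ℝ φ x) ^ 2) = fun x =>
      ((inner ℝ (tensorDiv (fun x => transposeL N (fderiv ℝ φ x)) x) (φ x) : ℝ)
        + frob (transposeL N (fderiv ℝ φ x)) (fderiv ℝ φ x))
      - ((inner ℝ (tensorDiv (fun x => trL N (fderiv ℝ φ x) •
          ContinuousLinearMap.id ℝ (Eucl N)) x) (φ x) : ℝ)
        + frob (trL N (fderiv ℝ φ x) • ContinuousLinearMap.id ℝ (Eucl N)) (fderiv ℝ φ x)) := by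
    funext x
    rw [heq x, frob_smul_left, frob_id_left, trL_apply, transposeL_apply]
    ring
  rw [hfun]
  refine ⟨h1.1.sub h2.1, ?_⟩
  rw [integral_sub h1.1 h2.1, h1.2, h2.2, sub_zero]

theorem integrable_of_bilin_fderiv {φ : Eucl N → Eucl N} (hφ : ContDiff ℝ 1 φ)
    (hs : HasCompactSupport φ)
    (b : (Eucl N →L[ℝ] Eucl N) →L[ℝ] (Eucl N →L[ℝ] Eucl N) →L[ℝ] ℝ) :
    Integrable (fun x => b (fderiv ℝ φ x) (fderiv ℝ φ x)) := by
  have hc : Continuous (fderiv ℝ φ) := hφ.continuous_fderiv (by simp)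
  refine Continuous.integrable_of_hasCompactSupport (by fun_prop) ?_
  exact (hs.fderiv (𝕜 := ℝ)).comp_left (g := fun A => b A A) (by simp)

/-- Poincaré's inequality for compactly supported fields on a bounded set. -/
theorem poincare_of_tsupport_subset (hN : 0 < N) (hΩ : IsOpen Ω) {R : ℝ}
    (hR : ∀ x ∈ Ω, ‖x‖ ≤ R)
    {φ : Eucl N → Eucl N} (hφ : ContDiff ℝ 1 φ) (hs : HasCompactSupport φ)
    (hsΩ : tsupport φ ⊆ Ω) :
    ∫ x in Ω, ‖φ x‖ ^ 2 ≤ 4 * R ^ 2 * ∫ x in Ω, frob (fderiv ℝ φ x) (fderiv ℝ φ x) := by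
  set j : Fin N := ⟨0, hN⟩
  -- The integral of ∂_j(x_j |φ|²) = |φ|² + 2 x_j φ·∂_jφ is zero; since |x_j| ≤ R, the second term
  -- is absorbed by Young's inequality.
  set f : Eucl N → ℝ := fun x => x j * ‖φ x‖ ^ 2 with hf
  have hcoord : ContDiff ℝ 1 (fun x : Eucl N => x j) :=
    (EuclideanSpace.proj (𝕜 := ℝ) j).contDiff
  have hfc : ContDiff ℝ 1 f := hcoord.mul (hφ.norm_sq ℝ)
  have hsub : tsupport f ⊆ tsupport φ := by
    refine closure_mono fun x hx => ?_
    rw [Function.mem_support] at hx ⊢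
    intro h
    exact hx (by simp [hf, h])
  have hfs : HasCompactSupport f := hs.of_isClosed_subset (isClosed_tsupport _) hsub
  have hz := setIntegral_fderiv_of_tsupport_subset hfc hfs (hsub.trans hsΩ) (stdVec j)
  have hi0 := (integrable_fderiv_of_hasCompactSupport hfc hfs (stdVec j)).integrableOn (s := Ω)
  have hi1 : IntegrableOn (fun x => frob (fderiv ℝ φ x) (fderiv ℝ φ x)) Ω :=
    (integrable_of_bilin_fderiv hφ hs (frobL N)).integrableOn
  have hi2 : IntegrableOn (fun x => ‖φ x‖ ^ 2) Ω := by
    refine (Continuous.integrable_of_hasCompactSupport (by have := hφ.continuous; fun_prop)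
      ?_).integrableOn
    exact hs.comp_left (g := fun v : Eucl N => ‖v‖ ^ 2) (by simp)
  have hle : ∫ x in Ω, 1 / 2 * ‖φ x‖ ^ 2 ≤
      ∫ x in Ω, (fderiv ℝ f x (stdVec j) + 2 * R ^ 2 * frob (fderiv ℝ φ x) (fderiv ℝ φ x)) := by
    refine setIntegral_mono_on (hi2.const_mul _) (hi0.add (hi1.const_mul _)) hΩ.measurableSet
      fun x hx => ?_
    have h1 : HasFDerivAt (fun x : Eucl N => x j) (EuclideanSpace.proj (𝕜 := ℝ) j) x :=
      (EuclideanSpace.proj (𝕜 := ℝ) j).hasFDerivAt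
    have h2 := (hφ.differentiable (by simp) x).hasFDerivAt
    have h3 : fderiv ℝ f x (stdVec j) =
        x j * (2 * (inner ℝ (φ x) (fderiv ℝ φ x (stdVec j)) : ℝ)) + ‖φ x‖ ^ 2 := by
      have h4 := (h1.mul h2.norm_sq).fderiv
      have h5 : fderiv ℝ f x = _ := h4
      rw [h5]
      simp [stdVec_apply]
    have hin := abs_real_inner_le_norm (φ x) (fderiv ℝ φ x (stdVec j))
    have hxj : |x j| ≤ R := (PiLp.norm_apply_le x j).trans (hR x hx)
    have hAj : ‖fderiv ℝ φ x (stdVec j)‖ ^ 2 ≤ frob (fderiv ℝ φ x) (fderiv ℝ φ x) := by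
      rw [frob_eq_sum_inner]
      refine le_trans (le_of_eq (real_inner_self_eq_norm_sq _).symm) ?_
      exact Finset.single_le_sum
        (f := fun i => (inner ℝ (fderiv ℝ φ x (stdVec i)) (fderiv ℝ φ x (stdVec i)) : ℝ))
        (fun i _ => real_inner_self_nonneg) (Finset.mem_univ j)
    rw [h3]
    set p := ‖φ x‖
    set s := ‖fderiv ℝ φ x (stdVec j)‖
    set y : ℝ := inner ℝ (φ x) (fderiv ℝ φ x (stdVec j))
    have h6 : |x j * y| ≤ R * (p * s) := by
      rw [abs_mul]
      exact mul_le_mul hxj hin (abs_nonneg _) ((abs_nonneg _).trans hxj)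
    have h7 := (abs_le.1 h6).1
    have hR2 : 0 ≤ R ^ 2 := sq_nonneg _
    -- Half of (p - 2Rs)² ≥ 0 is exactly 2Rps ≤ p²/2 + 2R²s².
    nlinarith [sq_nonneg (p - 2 * R * s), mul_le_mul_of_nonneg_left hAj hR2]
  rw [integral_add hi0 (hi1.const_mul _), hz, zero_add, integral_const_mul,
    integral_const_mul] at hle
  linarith

/-- Korn's and Poincaré's inequalities for the viscous dissipation of smooth fields. -/
theorem exists_coercivity_stress (hN : 0 < N) (hΩ : IsOpen Ω) (hb : Bornology.IsBounded Ω)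
    {μ lam : ℝ} (hμ : 0 < μ) (hlam : 0 ≤ lam) (hvisc : N = 1 → 0 < lam) :
    ∃ c > 0, ∀ φ : Eucl N → Eucl N, ContDiff ℝ 2 φ → HasCompactSupport φ → tsupport φ ⊆ Ω →
      c * (∫ x in Ω, ‖φ x‖ ^ 2 + tr (fderiv ℝ φ x) ^ 2) ≤
        ∫ x in Ω, frob (stress μ lam (fderiv ℝ φ x)) (fderiv ℝ φ x) := by
  obtain ⟨R, hR⟩ := hb.exists_norm_le
  have hNr : (0 : ℝ) < N := by exact_mod_cast hN
  -- After the transpose term is replaced by (div φ)², the dissipation is the integral of μ|∇φ|² +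
  -- (μ - 2μ/N + λ)(div φ)². For N ≥ 2 the second coefficient is nonnegative and k = μ works. For N
  -- = 1 the two terms combine to λ(div φ)², which is where λ > 0 enters.
  obtain ⟨k, hk, hkA⟩ : ∃ k > 0, ∀ A : Eucl N →L[ℝ] Eucl N,
      k * frob A A ≤ μ * frob A A + (μ - 2 * μ / N + lam) * tr A ^ 2 := by
    by_cases h1 : N = 1
    · subst h1
      refine ⟨lam, hvisc rfl, fun A => ?_⟩
      have : frob A A = tr A ^ 2 := by simp [frob, tr, sq]
      rw [this]
      simp only [Nat.cast_one, div_one]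
      linarith
    · refine ⟨μ, hμ, fun A => ?_⟩
      have h2 : (2 : ℝ) ≤ N := by exact_mod_cast (by omega : 2 ≤ N)
      have h3 : 2 * μ / N ≤ μ := by
        rw [div_le_iff₀ hNr]; nlinarith
      have : 0 ≤ (μ - 2 * μ / N + lam) * tr A ^ 2 :=
        mul_nonneg (by linarith) (sq_nonneg _)
      linarith
  -- The term 4R² is Poincaré's constant and N comes from (tr A)² ≤ N |A|².
  refine ⟨k / (4 * R ^ 2 + N), by positivity, fun φ hφ hs hsΩ => ?_⟩
  have hφ1 : ContDiff ℝ 1 φ := hφ.of_le (by norm_num)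
  have hiF : IntegrableOn (fun x => frob (fderiv ℝ φ x) (fderiv ℝ φ x)) Ω :=
    (integrable_of_bilin_fderiv hφ1 hs (frobL N)).integrableOn
  have hiT : IntegrableOn (fun x => tr (fderiv ℝ φ x) ^ 2) Ω := by
    have := (integrable_of_bilin_fderiv hφ1 hs
      ((ContinuousLinearMap.mul ℝ ℝ).bilinearComp (trL N) (trL N))).integrableOn (s := Ω)
    simpa [sq, trL_apply] using this
  have hi2 : IntegrableOn (fun x => ‖φ x‖ ^ 2) Ω := by
    refine (Continuous.integrable_of_hasCompactSupport (by have := hφ.continuous; fun_prop)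
      ?_).integrableOn
    exact hs.comp_left (g := fun v : Eucl N => ‖v‖ ^ 2) (by simp)
  obtain ⟨hiK, hK⟩ := integral_frob_transpose_sub_tr_sq hφ hs
  have hKΩ : ∫ x in Ω, (frob (ContinuousLinearMap.adjoint (fderiv ℝ φ x)) (fderiv ℝ φ x)
      - tr (fderiv ℝ φ x) ^ 2) = 0 := by
    rw [setIntegral_eq_integral_of_forall_compl_eq_zero, hK]
    intro x hx
    rw [fderiv_of_notMem_tsupport ℝ (fun h => hx (hsΩ h))]
    simp [frob, tr]
  have hS : ∫ x in Ω, frob (stress μ lam (fderiv ℝ φ x)) (fderiv ℝ φ x) =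
      ∫ x in Ω, (μ * frob (fderiv ℝ φ x) (fderiv ℝ φ x)
        + (μ - 2 * μ / N + lam) * tr (fderiv ℝ φ x) ^ 2) := by
    have : ∀ x, frob (stress μ lam (fderiv ℝ φ x)) (fderiv ℝ φ x) =
        (μ * frob (fderiv ℝ φ x) (fderiv ℝ φ x)
        + (μ - 2 * μ / N + lam) * tr (fderiv ℝ φ x) ^ 2)
        + μ * (frob (ContinuousLinearMap.adjoint (fderiv ℝ φ x)) (fderiv ℝ φ x)
          - tr (fderiv ℝ φ x) ^ 2) := fun x => by
      rw [frob_stress]; ring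
    simp_rw [this]
    rw [integral_add (f := fun x => μ * frob (fderiv ℝ φ x) (fderiv ℝ φ x)
        + (μ - 2 * μ / N + lam) * tr (fderiv ℝ φ x) ^ 2)
      ((hiF.const_mul _).add (hiT.const_mul _)) (hiK.integrableOn.const_mul _),
      integral_const_mul μ fun x => frob (ContinuousLinearMap.adjoint (fderiv ℝ φ x)) (fderiv ℝ φ x)
      - tr (fderiv ℝ φ x) ^ 2, hKΩ, mul_zero, add_zero]
  have hP := poincare_of_tsupport_subset hN hΩ hR hφ1 hs hsΩ
  have hTF : ∫ x in Ω, tr (fderiv ℝ φ x) ^ 2 ≤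
      N * ∫ x in Ω, frob (fderiv ℝ φ x) (fderiv ℝ φ x) := by
    rw [← integral_const_mul]
    exact setIntegral_mono_on hiT (hiF.const_mul _) hΩ.measurableSet fun x _ => tr_sq_le _
  have hkF : k * ∫ x in Ω, frob (fderiv ℝ φ x) (fderiv ℝ φ x) ≤
      ∫ x in Ω, frob (stress μ lam (fderiv ℝ φ x)) (fderiv ℝ φ x) := by
    rw [hS, ← integral_const_mul]
    exact setIntegral_mono_on (hiF.const_mul _) ((hiF.const_mul _).add (hiT.const_mul _))
      hΩ.measurableSet fun x _ => hkA _
  rw [integral_add hi2 hiT]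
  refine le_trans ?_ hkF
  rw [div_mul_eq_mul_div, div_le_iff₀ (by positivity), mul_assoc]
  refine mul_le_mul_of_nonneg_left ?_ hk.le
  linarith

end IntegrationByParts

/-! ### Fields with zero trace as limits of compactly supported fields -/

section Sobolev

variable {N : ℕ} {Ω : Set (Eucl N)}

/-- The pair `(v, G)` is an `L²(Ω)` limit of pairs `(φ, ∇φ)` with `φ ∈ C²_c(Ω)`. -/
def MemH10 (Ω : Set (Eucl N)) (v : Eucl N → Eucl N)
    (G : Eucl N → (Eucl N →L[ℝ] Eucl N)) : Prop :=
  MemLp v 2 (volume.restrict Ω) ∧ MemLp G 2 (volume.restrict Ω) ∧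
  ∃ φ : ℕ → Eucl N → Eucl N,
    (∀ n, ContDiff ℝ 2 (φ n) ∧ HasCompactSupport (φ n) ∧ tsupport (φ n) ⊆ Ω) ∧
    Tendsto (fun n => eLpNorm (fun x => φ n x - v x) 2 (volume.restrict Ω)) atTop (𝓝 0) ∧
    Tendsto (fun n => eLpNorm (fun x => fderiv ℝ (φ n) x - G x) 2 (volume.restrict Ω))
      atTop (𝓝 0)

theorem MemW012.memH10 {v : Eucl N → Eucl N} {G : Eucl N → (Eucl N →L[ℝ] Eucl N)}
    (h : MemW012 Ω v G) : MemH10 Ω v G := by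
  obtain ⟨hv, hG, φ, hφ, h1, h2⟩ := h
  exact ⟨hv, hG, φ, fun n => ⟨contDiff_infty.1 (hφ n).1 2, (hφ n).2⟩, h1, h2⟩

theorem memLp_two_of_hasCompactSupport {φ : Eucl N → Eucl N} (hφ : ContDiff ℝ 2 φ)
    (hs : HasCompactSupport φ) :
    MemLp φ 2 (volume.restrict Ω) ∧ MemLp (fderiv ℝ φ) 2 (volume.restrict Ω) :=
  ⟨(hφ.continuous.memLp_of_hasCompactSupport hs).restrict Ω,
    ((hφ.continuous_fderiv (by simp)).memLp_of_hasCompactSupport (hs.fderiv (𝕜 := ℝ))).restrict Ω⟩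

theorem tendsto_eLpNorm_sub_self {α F : Type*} [MeasurableSpace α] {ν : Measure α}
    [NormedAddCommGroup F] (f : α → F) :
    Tendsto (fun _ : ℕ => eLpNorm (fun x => f x - f x) 2 ν) atTop (𝓝 0) := by
  simp

theorem tendsto_eLpNorm_sub_zero {α F : Type*} [MeasurableSpace α] {ν : Measure α}
    [NormedAddCommGroup F] {f g : ℕ → α → F} {f' g' : α → F}
    (hfm : ∀ n, AEStronglyMeasurable (fun x => f n x - f' x) ν)
    (hgm : ∀ n, AEStronglyMeasurable (fun x => g n x - g' x) ν)
    (hf : Tendsto (fun n => eLpNorm (fun x => f n x - f' x) 2 ν) atTop (𝓝 0))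
    (hg : Tendsto (fun n => eLpNorm (fun x => g n x - g' x) 2 ν) atTop (𝓝 0)) :
    Tendsto (fun n => eLpNorm (fun x => (f n x - g n x) - (f' x - g' x)) 2 ν) atTop (𝓝 0) := by
  refine tendsto_of_tendsto_of_tendsto_of_le_of_le tendsto_const_nhds
    (by simpa using hf.add hg) (fun _ => zero_le) fun n => ?_
  have : (fun x => (f n x - g n x) - (f' x - g' x)) =
      (fun x => f n x - f' x) - (fun x => g n x - g' x) := by
    funext x; simp only [Pi.sub_apply]; abel
  dsimp only
  rw [this]
  exact eLpNorm_sub_le (hfm n) (hgm n) (by norm_num)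

theorem MemH10.sub {v w : Eucl N → Eucl N} {G K : Eucl N → (Eucl N →L[ℝ] Eucl N)}
    (h : MemH10 Ω v G) (h' : MemH10 Ω w K) :
    MemH10 Ω (fun x => v x - w x) (fun x => G x - K x) := by
  obtain ⟨hv, hG, φ, hφ, h1, h2⟩ := h
  obtain ⟨hw, hK, ψ, hψ, h3, h4⟩ := h'
  have mφ := fun n => memLp_two_of_hasCompactSupport (Ω := Ω) (hφ n).1 (hφ n).2.1
  have mψ := fun n => memLp_two_of_hasCompactSupport (Ω := Ω) (hψ n).1 (hψ n).2.1
  refine ⟨hv.sub hw, hG.sub hK, fun n x => φ n x - ψ n x, fun n => ⟨?_, ?_, ?_⟩, ?_, ?_⟩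
  · exact (hφ n).1.sub (hψ n).1
  · exact (hφ n).2.1.sub (hψ n).2.1
  · exact (tsupport_sub (φ n) (ψ n)).trans (union_subset (hφ n).2.2 (hψ n).2.2)
  · exact tendsto_eLpNorm_sub_zero (fun n => ((mφ n).1.sub hv).1) (fun n => ((mψ n).1.sub hw).1)
      h1 h3
  · have := tendsto_eLpNorm_sub_zero (fun n => ((mφ n).2.sub hG).1)
      (fun n => ((mψ n).2.sub hK).1) h2 h4
    refine this.congr fun n => ?_
    congr 1
    funext x
    rw [fderiv_fun_sub ((hφ n).1.differentiable (by simp) x)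
      ((hψ n).1.differentiable (by simp) x)]

/-- The pairing induced by b on L² × L² is jointly continuous. Every identity or inequality
quadratic in (v, G) thus passes from compactly supported fields to their limits. -/
theorem tendsto_integral_bilin {α V W : Type*} [MeasurableSpace α] {ν : Measure α}
    [NormedAddCommGroup V] [NormedSpace ℝ V] [NormedAddCommGroup W] [NormedSpace ℝ W]
    (b : V →L[ℝ] W →L[ℝ] ℝ) {f : ℕ → α → V} {g : ℕ → α → W} {f' : α → V} {g' : α → W}
    (hf : ∀ n, MemLp (f n) 2 ν) (hg : ∀ n, MemLp (g n) 2 ν) (hf' : MemLp f' 2 ν)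
    (hg' : MemLp g' 2 ν)
    (h1 : Tendsto (fun n => eLpNorm (fun x => f n x - f' x) 2 ν) atTop (𝓝 0))
    (h2 : Tendsto (fun n => eLpNorm (fun x => g n x - g' x) 2 ν) atTop (𝓝 0)) :
    Tendsto (fun n => ∫ x, b (f n x) (g n x) ∂ν) atTop (𝓝 (∫ x, b (f' x) (g' x) ∂ν)) := by
  have t1 := (Lp.tendsto_Lp_iff_tendsto_eLpNorm'' f hf f' hf').2 h1
  have t2 := (Lp.tendsto_Lp_iff_tendsto_eLpNorm'' g hg g' hg').2 h2
  have hpair : ∀ {k : α → V} {l : α → W} (hk : MemLp k 2 ν) (hl : MemLp l 2 ν),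
      b.lpPairing ν 2 2 (hk.toLp k) (hl.toLp l) = ∫ x, b (k x) (l x) ∂ν := by
    intro k l hk hl
    rw [ContinuousLinearMap.lpPairing_eq_integral]
    refine integral_congr_ae ?_
    filter_upwards [hk.coeFn_toLp, hl.coeFn_toLp] with x hx hy
    rw [hx, hy]
  have t3 := ((b.lpPairing ν 2 2).continuous₂.tendsto (hf'.toLp f', hg'.toLp g')).comp
    (t1.prodMk_nhds t2)
  rw [Function.uncurry_apply_pair, hpair hf' hg'] at t3
  refine t3.congr fun n => ?_
  simp only [Function.comp_apply, Function.uncurry_apply_pair, hpair (hf n) (hg n)]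

theorem isFiniteMeasure_restrict_of_isBounded (hb : Bornology.IsBounded Ω) :
    IsFiniteMeasure (volume.restrict Ω) :=
  ⟨by simpa using hb.measure_lt_top⟩

/-- The bounds on M and div M place both in L²(Ω), so the identity for compactly supported fields
passes to the limit. No regularity of M up to the boundary is needed beyond these bounds. -/
theorem MemH10.integral_tensorDiv (hΩ : IsOpen Ω) (hb : Bornology.IsBounded Ω)
    {M : Eucl N → (Eucl N →L[ℝ] Eucl N)} (hM : ContDiffOn ℝ 1 M Ω) {C : ℝ}
    (hC : ∀ x ∈ Ω, ‖M x‖ ≤ C) {C' : ℝ} (hC' : ∀ x ∈ Ω, ‖tensorDiv M x‖ ≤ C')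
    {v : Eucl N → Eucl N} {G : Eucl N → (Eucl N →L[ℝ] Eucl N)} (h : MemH10 Ω v G) :
    ∫ x in Ω, ((inner ℝ (tensorDiv M x) (v x) : ℝ) + frob (M x) (G x)) = 0 := by
  have := isFiniteMeasure_restrict_of_isBounded hb
  obtain ⟨hv, hG, φ, hφ, h1, h2⟩ := h
  have mφ := fun n => memLp_two_of_hasCompactSupport (Ω := Ω) (hφ n).1 (hφ n).2.1
  have hDc : ContinuousOn (tensorDiv M) Ω := by
    have := hM.continuousOn_fderiv_of_isOpen hΩ le_rfl
    exact continuousOn_finsetSum _ fun j _ =>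
      (this.clm_apply continuousOn_const).clm_apply continuousOn_const
  have mM : MemLp M 2 (volume.restrict Ω) :=
    (memLp_top_of_bound (hM.continuousOn.aestronglyMeasurable hΩ.measurableSet) C
      ((ae_restrict_iff' hΩ.measurableSet).2 (ae_of_all _ hC))).mono_exponent le_top
  have mD : MemLp (tensorDiv M) 2 (volume.restrict Ω) :=
    (memLp_top_of_bound (hDc.aestronglyMeasurable hΩ.measurableSet) C'
      ((ae_restrict_iff' hΩ.measurableSet).2 (ae_of_all _ hC'))).mono_exponent le_top
  have zM := tendsto_eLpNorm_sub_self (ν := volume.restrict Ω) M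
  have zD := tendsto_eLpNorm_sub_self (ν := volume.restrict Ω) (tensorDiv M)
  have t1 := tendsto_integral_bilin (innerSL ℝ) (fun _ => mD) (fun n => (mφ n).1) mD hv zD h1
  have t2 := tendsto_integral_bilin (frobL N) (fun _ => mM) (fun n => (mφ n).2) mM hG zM h2
  have i1 : ∀ {w : Eucl N → Eucl N}, MemLp w 2 (volume.restrict Ω) →
      Integrable (fun x => innerSL ℝ (tensorDiv M x) (w x)) (volume.restrict Ω) := fun hw =>
    memLp_one_iff_integrable.1 ((innerSL ℝ).memLp_of_bilin 1 mD hw)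
  have i2 : ∀ {K : Eucl N → (Eucl N →L[ℝ] Eucl N)}, MemLp K 2 (volume.restrict Ω) →
      Integrable (fun x => frobL N (M x) (K x)) (volume.restrict Ω) := fun hw =>
    memLp_one_iff_integrable.1 ((frobL N).memLp_of_bilin 1 mM hw)
  have t3 := t1.add t2
  rw [← integral_add (i1 hv) (i2 hG)] at t3
  refine tendsto_nhds_unique t3 (tendsto_const_nhds.congr fun n => ?_)
  rw [← integral_add (i1 (mφ n).1) (i2 (mφ n).2)]
  exact (integral_tensorDiv_of_tsupport_subset hΩ hM ((hφ n).1.of_le (by norm_num)) (hφ n).2.1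
    (hφ n).2.2).2.symm

/-- The case M = f I, whose divergence is ∇f. -/
theorem MemH10.integral_div (hΩ : IsOpen Ω) (hb : Bornology.IsBounded Ω)
    {f : Eucl N → ℝ} (hf : ContDiffOn ℝ 1 f Ω) {C : ℝ}
    (hC : ∀ x ∈ Ω, ‖f x‖ ≤ C) {C' : ℝ} (hC' : ∀ x ∈ Ω, ‖fderiv ℝ f x‖ ≤ C')
    {v : Eucl N → Eucl N} {G : Eucl N → (Eucl N →L[ℝ] Eucl N)} (h : MemH10 Ω v G) :
    ∫ x in Ω, (fderiv ℝ f x (v x) + f x * tr (G x)) = 0 := by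
  have hd : ∀ x ∈ Ω, tensorDiv (fun y => f y • ContinuousLinearMap.id ℝ (Eucl N)) x =
      ∑ j, fderiv ℝ f x (stdVec j) • stdVec j := fun x hx =>
    tensorDiv_smul_id ((hf.contDiffAt (hΩ.mem_nhds hx)).differentiableAt (by simp))
  have h1 := h.integral_tensorDiv hΩ hb
    (M := fun y => f y • ContinuousLinearMap.id ℝ (Eucl N))
    (hf.smul contDiffOn_const) (C := C * ‖ContinuousLinearMap.id ℝ (Eucl N)‖)
    (fun x hx => by
      rw [norm_smul]; exact mul_le_mul_of_nonneg_right (hC x hx) (norm_nonneg _))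
    (C' := N * C') (fun x hx => by
      rw [hd x hx]
      refine (norm_sum_le _ _).trans ?_
      have : ∀ j ∈ Finset.univ, ‖fderiv ℝ f x (stdVec j) • (stdVec j : Eucl N)‖ ≤ C' := by
        intro j _
        rw [norm_smul, norm_stdVec, mul_one]
        refine ((fderiv ℝ f x).le_opNorm _).trans ?_
        rw [norm_stdVec, mul_one]
        exact hC' x hx
      simpa using Finset.sum_le_sum this)
  rw [← h1]
  refine setIntegral_congr_fun hΩ.measurableSet fun x hx => ?_
  simp only [frob_smul_left, frob_id_left, add_left_inj]
  rw [hd x hx, sum_inner, ← sum_apply_mul (fderiv ℝ f x) (v x)]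
  refine Finset.sum_congr rfl fun j _ => ?_
  rw [inner_smul_left, real_inner_comm, inner_eq_sum]
  simp [stdVec_apply, mul_comm]

/-- Korn's and Poincaré's inequalities for the viscous dissipation. -/
theorem exists_coercivity_stress_of_memH10 (hN : 0 < N) (hΩ : IsOpen Ω)
    (hb : Bornology.IsBounded Ω)
    {μ lam : ℝ} (hμ : 0 < μ) (hlam : 0 ≤ lam) (hvisc : N = 1 → 0 < lam) :
    ∃ c > 0, ∀ (v : Eucl N → Eucl N) (G : Eucl N → (Eucl N →L[ℝ] Eucl N)), MemH10 Ω v G →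
      c * (∫ x in Ω, (‖v x‖ ^ 2 + tr (G x) ^ 2)) ≤ ∫ x in Ω, frob (stress μ lam (G x)) (G x) := by
  obtain ⟨c, hc, hcoer⟩ := exists_coercivity_stress hN hΩ hb hμ hlam hvisc
  refine ⟨c, hc, fun v G ⟨hv, hG, φ, hφ, h1, h2⟩ => ?_⟩
  have mφ := fun n => memLp_two_of_hasCompactSupport (Ω := Ω) (hφ n).1 (hφ n).2.1
  set bT : (Eucl N →L[ℝ] Eucl N) →L[ℝ] (Eucl N →L[ℝ] Eucl N) →L[ℝ] ℝ :=
    (ContinuousLinearMap.mul ℝ ℝ).bilinearComp (trL N) (trL N)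
  set bS : (Eucl N →L[ℝ] Eucl N) →L[ℝ] (Eucl N →L[ℝ] Eucl N) →L[ℝ] ℝ :=
    (frobL N).comp (stressL N μ lam)
  have t1 := tendsto_integral_bilin (innerSL ℝ) (fun n => (mφ n).1) (fun n => (mφ n).1) hv hv
    h1 h1
  have t2 := tendsto_integral_bilin bT (fun n => (mφ n).2) (fun n => (mφ n).2) hG hG h2 h2
  have t3 := tendsto_integral_bilin bS (fun n => (mφ n).2) (fun n => (mφ n).2) hG hG h2 h2
  have i1 : ∀ {w : Eucl N → Eucl N}, MemLp w 2 (volume.restrict Ω) →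
      Integrable (fun x => innerSL ℝ (w x) (w x)) (volume.restrict Ω) := fun hw =>
    memLp_one_iff_integrable.1 ((innerSL ℝ).memLp_of_bilin 1 hw hw)
  have i2 : ∀ {K : Eucl N → (Eucl N →L[ℝ] Eucl N)}, MemLp K 2 (volume.restrict Ω) →
      Integrable (fun x => bT (K x) (K x)) (volume.restrict Ω) := fun hw =>
    memLp_one_iff_integrable.1 (bT.memLp_of_bilin 1 hw hw)
  have t4 := (t1.add t2).const_mul c
  rw [← integral_add (i1 hv) (i2 hG)] at t4
  have e : ∀ (w : Eucl N → Eucl N) (K : Eucl N → (Eucl N →L[ℝ] Eucl N)),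
      (∫ x in Ω, (innerSL ℝ (w x) (w x) + bT (K x) (K x))) =
        ∫ x in Ω, (‖w x‖ ^ 2 + tr (K x) ^ 2) := fun w K =>
    integral_congr_ae (ae_of_all _ fun x => by simp [bT, trL_apply, sq])
  rw [e] at t4
  refine le_of_tendsto_of_tendsto' t4 t3 fun n => ?_
  rw [← integral_add (i1 (mφ n).1) (i2 (mφ n).2), e (φ n) (fderiv ℝ (φ n))]
  exact hcoer (φ n) (hφ n).1 (hφ n).2.1 (hφ n).2.2

theorem tendsto_eLpNorm_two_of_bounded {α F : Type*} [MeasurableSpace α] {ν : Measure α}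
    [IsFiniteMeasure ν] [NormedAddCommGroup F] {f : ℕ → α → F} {C : ℝ}
    (hm : ∀ n, AEStronglyMeasurable (f n) ν) (hC : ∀ n, ∀ᵐ x ∂ν, ‖f n x‖ ≤ C)
    (hlim : ∀ᵐ x ∂ν, Tendsto (fun n => f n x) atTop (𝓝 0)) :
    Tendsto (fun n => eLpNorm (f n) 2 ν) atTop (𝓝 0) := by
  have h1 : Tendsto (fun n => ∫⁻ x, ‖f n x‖ₑ ^ (2 : ℝ) ∂ν) atTop (𝓝 (∫⁻ _, 0 ∂ν)) := by
    refine tendsto_lintegral_of_dominated_convergence' (fun _ => ENNReal.ofReal C ^ (2 : ℝ))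
      (fun n => ((hm n).enorm.pow_const _)) (fun n => ?_) ?_ ?_
    · filter_upwards [hC n] with x hx
      gcongr
      rw [← ofReal_norm]
      exact ENNReal.ofReal_le_ofReal hx
    · rw [lintegral_const]
      exact ENNReal.mul_ne_top (ENNReal.rpow_ne_top_of_nonneg (by norm_num)
        ENNReal.ofReal_ne_top) (measure_ne_top _ _)
    · filter_upwards [hlim] with x hx
      have h2 : Tendsto (fun n => ‖f n x‖ₑ) atTop (𝓝 0) := by
        simpa using hx.enorm
      have h4 := ((ENNReal.continuous_rpow_const (y := 2)).tendsto 0).comp h2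
      rw [ENNReal.zero_rpow_of_pos (by norm_num)] at h4
      exact h4
  have h3 := ((ENNReal.continuous_rpow_const (y := 1 / 2)).tendsto _).comp h1
  simp only [lintegral_zero] at h3
  rw [ENNReal.zero_rpow_of_pos (by norm_num)] at h3
  refine h3.congr fun n => ?_
  rw [eLpNorm_eq_lintegral_rpow_enorm_toReal (by norm_num) (by norm_num)]
  simp

/-- On its zero set V is approximated by the zero map with constant 0. At almost every point of that
set, a derivative of V cannot differ from the approximating map by more than the constant. -/
theorem ae_fderiv_eq_zero_of_eq_zero (hΩ : IsOpen Ω) {V : Eucl N → Eucl N}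
    (hV : DifferentiableOn ℝ V Ω) :
    ∀ᵐ x ∂(volume.restrict Ω), V x = 0 → fderiv ℝ V x = 0 := by
  set s := Ω ∩ V ⁻¹' {0} with hs
  have hsm : MeasurableSet s := by
    have : s = Ω \ (Ω ∩ V ⁻¹' {0}ᶜ) := by
      ext x; simp only [hs, mem_inter_iff, Set.mem_sdiff, mem_preimage, mem_compl_iff]; tauto
    rw [this]
    exact hΩ.measurableSet.diff
      (hV.continuousOn.isOpen_inter_preimage hΩ isOpen_compl_singleton).measurableSet
  have hA : ApproximatesLinearOn V (0 : Eucl N →L[ℝ] Eucl N) s 0 := by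
    intro x hx y hy
    have h1 : V x = 0 := hx.2
    have h2 : V y = 0 := hy.2
    simp [h1, h2]
  have h := hA.norm_fderiv_sub_le volume hsm (fderiv ℝ V) fun x hx =>
    ((hV x hx.1).differentiableAt (hΩ.mem_nhds hx.1)).hasFDerivAt.hasFDerivWithinAt
  rw [ae_restrict_iff' hsm] at h
  rw [ae_restrict_iff' hΩ.measurableSet]
  filter_upwards [h] with x hx hxΩ hx0
  simpa using hx ⟨hxΩ, hx0⟩

/-- A smooth field that agrees with the identity far away and vanishes near the origin. -/
def truncField (N : ℕ) (v : Eucl N) : Eucl N := Real.smoothTransition (‖v‖ ^ 2 - 1) • v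

theorem contDiff_truncField : ContDiff ℝ ∞ (truncField N) :=
  (Real.smoothTransition.contDiff.comp
    ((contDiff_id.norm_sq ℝ).sub contDiff_const)).smul contDiff_id

theorem truncField_of_le {v : Eucl N} (h : ‖v‖ ^ 2 ≤ 1) : truncField N v = 0 := by
  rw [truncField, Real.smoothTransition.zero_of_nonpos (by linarith), zero_smul]

theorem truncField_of_ge {v : Eucl N} (h : 2 ≤ ‖v‖ ^ 2) : truncField N v = v := by
  rw [truncField, Real.smoothTransition.one_of_one_le (by linarith), one_smul]

/-- The difference between `truncField` and the identity is smooth with compact support, hence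
bounded together with its derivative. -/
theorem exists_bound_truncField :
    ∃ K : ℝ, (∀ v, ‖truncField N v - v‖ ≤ K) ∧ ∀ v, ‖fderiv ℝ (truncField N) v‖ ≤ K := by
  have hc : ContDiff ℝ ∞ (fun v => truncField N v - v) := contDiff_truncField.sub contDiff_id
  have hs : HasCompactSupport (fun v => truncField N v - v) := by
    refine HasCompactSupport.intro (isCompact_closedBall (0 : Eucl N) 2) fun v hv => ?_
    rw [mem_closedBall_zero_iff, not_le] at hv
    rw [truncField_of_ge (by nlinarith), sub_self]
  obtain ⟨K₁, hK₁⟩ := hc.continuous.bounded_above_of_compact_support hs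
  obtain ⟨K₂, hK₂⟩ := (hc.continuous_fderiv (by simp)).bounded_above_of_compact_support
    (hs.fderiv (𝕜 := ℝ))
  refine ⟨max K₁ (K₂ + 1), fun v => (hK₁ v).trans (le_max_left _ _), fun v => ?_⟩
  refine le_trans ?_ (le_max_right _ _)
  have h1 : fderiv ℝ (fun v => truncField N v - v) v =
      fderiv ℝ (truncField N) v - ContinuousLinearMap.id ℝ (Eucl N) := by
    exact (((contDiff_truncField.differentiable (by simp) v).hasFDerivAt).sub
      (hasFDerivAt_id v)).fderiv
  have h2 := hK₂ v
  rw [h1] at h2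
  have h3 := norm_le_norm_sub_add (fderiv ℝ (truncField N) v) (ContinuousLinearMap.id ℝ (Eucl N))
  have h4 : ‖ContinuousLinearMap.id ℝ (Eucl N)‖ ≤ 1 := ContinuousLinearMap.norm_id_le
  linarith

/-- A field of class `C²(Ω) ∩ C(Ω̄)` with bounded gradient that vanishes on the boundary is a
limit of compactly supported fields. -/
theorem memH10_of_vanishing (hΩ : IsOpen Ω) (hb : Bornology.IsBounded Ω) {V : Eucl N → Eucl N}
    (hV : ContDiffOn ℝ 2 V Ω) (hVc : ContinuousOn V (closure Ω))
    (hV0 : ∀ x ∈ frontier Ω, V x = 0) {C : ℝ} (hC : ∀ x ∈ Ω, ‖fderiv ℝ V x‖ ≤ C) :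
    MemH10 Ω V (fderiv ℝ V) := by
  have := isFiniteMeasure_restrict_of_isBounded hb
  have hVat : ∀ x ∈ Ω, ContDiffAt ℝ 2 V x := fun x hx => hV.contDiffAt (hΩ.mem_nhds hx)
  have hVd : ∀ x ∈ Ω, HasFDerivAt V (fderiv ℝ V x) x := fun x hx =>
    ((hVat x hx).differentiableAt (by simp)).hasFDerivAt
  obtain ⟨CV, hCV⟩ := hb.isCompact_closure.exists_bound_of_continuousOn hVc
  obtain ⟨K, hK, hK'⟩ := exists_bound_truncField (N := N)
  have hK0 : 0 ≤ K := (norm_nonneg _).trans (hK 0)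
  have mV : AEStronglyMeasurable V (volume.restrict Ω) :=
    hV.continuousOn.aestronglyMeasurable hΩ.measurableSet
  have mG : AEStronglyMeasurable (fderiv ℝ V) (volume.restrict Ω) :=
    (hV.continuousOn_fderiv_of_isOpen hΩ (by norm_num)).aestronglyMeasurable hΩ.measurableSet
  set κ : ℕ → ℝ := fun n => n + 1 with hκ
  have hκpos : ∀ n, 0 < κ n := fun n => by positivity
  have hκ1 : ∀ n, 1 ≤ κ n := fun n => by simp [hκ]
  have hκtop : Tendsto κ atTop atTop :=
    tendsto_atTop_add_const_right _ _ tendsto_natCast_atTop_atTop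
  -- Truncation of the values of V at scale 1/κ: it vanishes where |V| ≤ 1/κ, hence near the
  -- boundary, and differs from V by at most K/κ. The factors κ cancel in the chain rule, so its
  -- gradient stays bounded by K·C.
  set ψ : ℕ → Eucl N → Eucl N := fun n x => (κ n)⁻¹ • truncField N (κ n • V x) with hψ
  set φ : ℕ → Eucl N → Eucl N := fun n => Ω.indicator (ψ n) with hφ
  have heq : ∀ n, ∀ x ∈ Ω, φ n =ᶠ[𝓝 x] ψ n := fun n x hx =>
    eventually_of_mem (hΩ.mem_nhds hx) fun y hy => indicator_of_mem hy _
  have hψd : ∀ n, ∀ x ∈ Ω, HasFDerivAt (ψ n)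
      ((fderiv ℝ (truncField N) (κ n • V x)).comp (fderiv ℝ V x)) x := by
    intro n x hx
    have h1 : HasFDerivAt (truncField N) (fderiv ℝ (truncField N) (κ n • V x)) (κ n • V x) :=
      (contDiff_truncField.differentiable (by simp) _).hasFDerivAt
    have h2 := (h1.comp x ((hVd x hx).const_smul (κ n))).const_smul (κ n)⁻¹
    refine h2.congr_fderiv ?_
    rw [ContinuousLinearMap.comp_smul, smul_smul, inv_mul_cancel₀ (hκpos n).ne', one_smul]
  have hφd : ∀ n, ∀ x ∈ Ω, fderiv ℝ (φ n) x =
      (fderiv ℝ (truncField N) (κ n • V x)).comp (fderiv ℝ V x) := fun n x hx => by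
    rw [(heq n x hx).fderiv_eq, (hψd n x hx).fderiv]
  set S : ℕ → Set (Eucl N) := fun n => closure Ω ∩ V ⁻¹' {v | 1 ≤ ‖κ n • v‖ ^ 2} with hS
  have hScl : ∀ n, IsClosed (S n) := fun n =>
    hVc.preimage_isClosed_of_isClosed isClosed_closure
      (isClosed_le continuous_const (by fun_prop))
  have hSΩ : ∀ n, S n ⊆ Ω := by
    rintro n x ⟨hx, hx1⟩
    by_contra hxΩ
    have : V x = 0 := hV0 x (by rw [hΩ.frontier_eq]; exact ⟨hx, hxΩ⟩)
    simp only [mem_preimage, mem_ofPred_eq, this, smul_zero, norm_zero] at hx1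
    norm_num at hx1
  have hts : ∀ n, tsupport (φ n) ⊆ S n := by
    intro n
    refine closure_minimal (fun x hx => ?_) (hScl n)
    have hxΩ : x ∈ Ω := by
      by_contra h
      exact hx (indicator_of_notMem h _)
    refine ⟨subset_closure hxΩ, ?_⟩
    by_contra h
    simp only [mem_preimage, mem_ofPred_eq, not_le] at h
    refine hx ?_
    simp only [hφ, indicator_of_mem hxΩ, hψ, truncField_of_le h.le, smul_zero]
  have hφc : ∀ n, ContDiff ℝ 2 (φ n) := fun n => contDiff_of_contDiffAt_tsupport fun x hx => by
    have hxΩ := hSΩ n (hts n hx)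
    refine ContDiffAt.congr_of_eventuallyEq ?_ (heq n x hxΩ)
    have h2 : ContDiff ℝ 2 (truncField N) := contDiff_infty.1 contDiff_truncField 2
    have h3 : ContDiffAt ℝ 2 (fun y => κ n • V y) x := (hVat x hxΩ).const_smul (κ n)
    exact (h2.contDiffAt.comp x h3).const_smul (κ n)⁻¹
  have hφs : ∀ n, HasCompactSupport (φ n) := fun n =>
    HasCompactSupport.of_support_subset_isCompact
      (hb.isCompact_closure.of_isClosed_subset (hScl n) inter_subset_left)
      ((subset_tsupport _).trans (hts n))
  have mφ := fun n => memLp_two_of_hasCompactSupport (Ω := Ω) (hφc n) (hφs n)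
  refine ⟨?_, ?_, φ, fun n => ⟨hφc n, hφs n, (hts n).trans (hSΩ n)⟩, ?_, ?_⟩
  · exact (memLp_top_of_bound mV CV ((ae_restrict_iff' hΩ.measurableSet).2
      (ae_of_all _ fun x hx => hCV x (subset_closure hx)))).mono_exponent le_top
  · exact (memLp_top_of_bound mG C ((ae_restrict_iff' hΩ.measurableSet).2
      (ae_of_all _ hC))).mono_exponent le_top
  · have hbd : ∀ n, ∀ x ∈ Ω, ‖φ n x - V x‖ ≤ (κ n)⁻¹ * K := by
      intro n x hx
      have : φ n x - V x = (κ n)⁻¹ • (truncField N (κ n • V x) - κ n • V x) := by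
        simp only [hφ, indicator_of_mem hx, hψ, smul_sub, smul_smul,
          inv_mul_cancel₀ (hκpos n).ne', one_smul]
      rw [this, norm_smul, norm_inv, Real.norm_of_nonneg (hκpos n).le]
      exact mul_le_mul_of_nonneg_left (hK _) (inv_nonneg.2 (hκpos n).le)
    refine tendsto_eLpNorm_two_of_bounded (C := K) (fun n => (mφ n).1.1.sub mV)
      (fun n => (ae_restrict_iff' hΩ.measurableSet).2 (ae_of_all _ fun x hx => ?_))
      ((ae_restrict_iff' hΩ.measurableSet).2 (ae_of_all _ fun x hx => ?_))
    · exact (hbd n x hx).trans (mul_le_of_le_one_left hK0 (inv_le_one_of_one_le₀ (hκ1 n)))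
    · refine squeeze_zero_norm (fun n => hbd n x hx) ?_
      simpa using hκtop.inv_tendsto_atTop.mul_const K
  · refine tendsto_eLpNorm_two_of_bounded (C := K * C + C) (fun n => (mφ n).2.1.sub mG)
      (fun n => (ae_restrict_iff' hΩ.measurableSet).2 (ae_of_all _ fun x hx => ?_)) ?_
    · refine (norm_sub_le _ _).trans (add_le_add ?_ (hC x hx))
      rw [hφd n x hx]
      refine (ContinuousLinearMap.opNorm_comp_le _ _).trans ?_
      exact mul_le_mul (hK' _) (hC x hx) (norm_nonneg _) hK0
    -- Pointwise convergence of the gradients: where V ≠ 0 the truncation is eventually the identity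
    -- near κV, and where V = 0 the gradient of V vanishes almost everywhere, so both gradients are
    -- zero.
    · have hz := ae_fderiv_eq_zero_of_eq_zero hΩ
        (hV.differentiableOn (by simp) : DifferentiableOn ℝ V Ω)
      filter_upwards [hz, ae_restrict_mem hΩ.measurableSet] with x hx0 hx
      by_cases hVx : V x = 0
      · refine tendsto_const_nhds.congr fun n => ?_
        rw [hφd n x hx, hx0 hVx]
        simp
      · have hn : 0 < ‖V x‖ := norm_pos_iff.2 hVx
        have : ∀ᶠ n in atTop, 2 < κ n * ‖V x‖ :=
          (hκtop.atTop_mul_const hn).eventually_gt_atTop 2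
        refine tendsto_const_nhds.congr' ?_
        filter_upwards [this] with n hn2
        have hfd : fderiv ℝ (truncField N) (κ n • V x) = ContinuousLinearMap.id ℝ (Eucl N) := by
          have hev : truncField N =ᶠ[𝓝 (κ n • V x)] id := by
            have ho : IsOpen {v : Eucl N | 2 < ‖v‖} := isOpen_lt continuous_const continuous_norm
            refine eventually_of_mem (ho.mem_nhds ?_) fun v (hv : 2 < ‖v‖) =>
              truncField_of_ge (by nlinarith)
            simpa [norm_smul, abs_of_pos (hκpos n)] using hn2
          rw [hev.fderiv_eq, fderiv_id]
        rw [hφd n x hx, hfd, ContinuousLinearMap.id_comp, sub_self]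

end Sobolev

/-! ### Bregman distance of the isentropic potential and the remainder estimate -/

section RelativePotential

/-- The isentropic part `a/(γ-1) s^γ` of the pressure potential. -/
def potential (a γ s : ℝ) : ℝ := a / (γ - 1) * s ^ γ

/-- The derivative of `potential`. -/
def enthalpy (a γ s : ℝ) : ℝ := a * γ / (γ - 1) * s ^ (γ - 1)

/-- The derivative of `enthalpy`. -/
def enthalpyDeriv (a γ s : ℝ) : ℝ := a * γ * s ^ (γ - 2)

/-- The Bregman distance of the isentropic potential. -/
def relPotential (a γ s r : ℝ) : ℝ :=
  potential a γ s - enthalpy a γ r * (s - r) - potential a γ r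

variable {a γ : ℝ}

theorem hasDerivAt_enthalpy (hγ : 1 < γ) {s : ℝ} (hs : 0 < s) :
    HasDerivAt (enthalpy a γ) (enthalpyDeriv a γ s) s := by
  have h := (Real.hasDerivAt_rpow_const (x := s) (p := γ - 1) (Or.inl hs.ne')).const_mul
    (a * γ / (γ - 1))
  refine h.congr_deriv ?_
  have : γ - 1 ≠ 0 := by linarith
  rw [enthalpyDeriv, show γ - 1 - 1 = γ - 2 by ring]
  field_simp

theorem hasDerivAt_rpow_pressure {s : ℝ} (hs : 0 < s) :
    HasDerivAt (fun s => a * s ^ γ) (s * enthalpyDeriv a γ s) s := by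
  refine ((Real.hasDerivAt_rpow_const (x := s) (p := γ) (Or.inl hs.ne')).const_mul a).congr_deriv ?_
  have : s ^ (γ - 1) = s * s ^ (γ - 2) := by
    rw [show γ - 1 = 1 + (γ - 2) by ring, Real.rpow_add hs, Real.rpow_one]
  rw [this, enthalpyDeriv]
  ring

theorem mul_enthalpy_sub_potential (hγ : 1 < γ) {s : ℝ} (hs : 0 < s) :
    s * enthalpy a γ s - potential a γ s = a * s ^ γ := by
  have h1 : s ^ γ = s * s ^ (γ - 1) := by
    rw [show γ = 1 + (γ - 1) by ring, Real.rpow_add hs, Real.rpow_one]; ring_nf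
  have : γ - 1 ≠ 0 := by linarith
  rw [enthalpy, potential, h1]
  field_simp

theorem sub_one_mul_potential (hγ : 1 < γ) (s : ℝ) : (γ - 1) * potential a γ s = a * s ^ γ := by
  have : γ - 1 ≠ 0 := by linarith
  rw [potential]
  field_simp

theorem sub_one_mul_enthalpy (hγ : 1 < γ) {s : ℝ} (hs : 0 < s) :
    (γ - 1) * enthalpy a γ s = s * enthalpyDeriv a γ s := by
  have : γ - 1 ≠ 0 := by linarith
  have h1 : s ^ (γ - 1) = s * s ^ (γ - 2) := by
    rw [show γ - 1 = 1 + (γ - 2) by ring, Real.rpow_add hs, Real.rpow_one]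
  rw [enthalpy, enthalpyDeriv, h1]
  field_simp

/-- Convexity of the power, in the form of Bernoulli's inequality applied to s/r. -/
theorem relPotential_nonneg (ha : 0 < a) (hγ : 1 < γ) {s r : ℝ} (hs : 0 ≤ s) (hr : 0 < r) :
    0 ≤ relPotential a γ s r := by
  have hb := one_add_mul_self_le_rpow_one_add (s := s / r - 1) (p := γ)
    (by have := div_nonneg hs hr.le; linarith) hγ.le
  rw [add_sub_cancel, Real.div_rpow hs hr.le, le_div_iff₀ (Real.rpow_pos_of_pos hr γ)] at hb
  have h1 : r ^ γ = r * r ^ (γ - 1) := by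
    rw [show γ = 1 + (γ - 1) by ring, Real.rpow_add hr, Real.rpow_one]; ring_nf
  have h2 : (1 + γ * (s / r - 1)) * r ^ γ = r ^ γ + γ * r ^ (γ - 1) * (s - r) := by
    rw [h1]; field_simp
  rw [h2] at hb
  have h3 : relPotential a γ s r =
      a / (γ - 1) * (s ^ γ - (r ^ γ + γ * r ^ (γ - 1) * (s - r))) := by
    rw [relPotential, potential, enthalpy, potential]; ring
  rw [h3]
  exact mul_nonneg (div_nonneg ha.le (by linarith)) (by linarith)

theorem enthalpy_mono (ha : 0 < a) (hγ : 1 < γ) {x y : ℝ} (hx : 0 ≤ x) (hxy : x ≤ y) :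
    enthalpy a γ x ≤ enthalpy a γ y := by
  unfold enthalpy
  have : 0 ≤ a * γ / (γ - 1) := div_nonneg (by nlinarith) (by linarith)
  gcongr

/-- The derivative of the enthalpy is continuous and positive on the compact interval; its minimum
there is the constant. -/
theorem exists_enthalpy_increment (ha : 0 < a) (hγ : 1 < γ) {r₀ R₀ : ℝ} (h0 : 0 < r₀)
    (hrR : r₀ ≤ R₀) :
    ∃ c > 0, ∀ x ∈ Icc r₀ R₀, ∀ y ∈ Icc r₀ R₀, x ≤ y →
      c * (y - x) ≤ enthalpy a γ y - enthalpy a γ x := by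
  have hcont : ContinuousOn (enthalpyDeriv a γ) (Icc r₀ R₀) := by
    refine continuousOn_const.mul (continuousOn_id.rpow_const fun x hx => Or.inl ?_)
    exact (h0.trans_le hx.1).ne'
  obtain ⟨z, hz, hmin⟩ := isCompact_Icc.exists_isMinOn ⟨r₀, le_rfl, hrR⟩ hcont
  refine ⟨enthalpyDeriv a γ z, ?_, ?_⟩
  · have := Real.rpow_pos_of_pos (h0.trans_le hz.1) (γ - 2)
    unfold enthalpyDeriv
    have : 0 < a * γ := by nlinarith
    positivity
  · have hd : ∀ x ∈ Icc r₀ R₀, HasDerivAt (enthalpy a γ) (enthalpyDeriv a γ x) x := fun x hx =>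
      hasDerivAt_enthalpy hγ (h0.trans_le hx.1)
    refine (convex_Icc r₀ R₀).mul_sub_le_image_sub_of_le_deriv
      (fun x hx => (hd x hx).continuousAt.continuousWithinAt)
      (fun x hx => (hd x (interior_subset hx)).differentiableAt.differentiableWithinAt)
      fun x hx => ?_
    rw [(hd x (interior_subset hx)).deriv]
    exact hmin (interior_subset hx)

/-- Coercivity of the relative potential, uniform on compact subsets of `(0, ∞)`. -/
theorem exists_coercivity_relPotential (ha : 0 < a) (hγ : 1 < γ) {r₀ R₀ : ℝ} (h0 : 0 < r₀)
    (hrR : r₀ ≤ R₀) :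
    ∃ c > 0, ∀ r ∈ Icc r₀ R₀, ∀ s, 0 ≤ s →
      c * min ((s - r) ^ 2) |s - r| ≤ relPotential a γ s r := by
  -- The interval is widened by r₀/2 on both sides: for r in the original one, r ± t with t ≤ r₀/2
  -- remains in it, away from 0.
  obtain ⟨c, hc, hinc⟩ := exists_enthalpy_increment ha hγ (r₀ := r₀ / 2) (R₀ := R₀ + r₀ / 2)
    (by linarith) (by linarith)
  refine ⟨1 / 2 * c * min (1 / 2) (r₀ / 2), by positivity, fun r hr s hs => ?_⟩
  have hrp : 0 < r := h0.trans_le hr.1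
  -- The three-point identity for Bregman distances at the midpoint m leaves two nonnegative
  -- distances and the product (H(m) - H(r))(s - m). This avoids second derivatives at s, which may
  -- be 0 or arbitrarily large.
  set m := (s + r) / 2 with hm
  have hmp : 0 < m := by simp only [hm]; linarith
  have hid : relPotential a γ s r = relPotential a γ s m + relPotential a γ m r
      + (enthalpy a γ m - enthalpy a γ r) * (s - m) := by
    simp only [relPotential]; ring
  have h1 := relPotential_nonneg ha hγ hs hmp
  have h2 := relPotential_nonneg ha hγ hmp.le hrp
  have hsm : s - m = (s - r) / 2 := by simp only [hm]; ring
  have hrJ : r ∈ Icc (r₀ / 2) (R₀ + r₀ / 2) := ⟨by linarith [hr.1], by linarith [hr.2]⟩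
  have harith : ∀ t : ℝ, 0 ≤ t → min (1 / 2) (r₀ / 2) * min (t ^ 2) t ≤ min (t / 2) (r₀ / 2) * t := by
    intro t ht
    rcases le_total (t / 2) (r₀ / 2) with h | h
    · rw [min_eq_left h]
      calc min (1 / 2) (r₀ / 2) * min (t ^ 2) t ≤ 1 / 2 * t ^ 2 :=
            mul_le_mul (min_le_left _ _) (min_le_left _ _) (by positivity) (by norm_num)
        _ = t / 2 * t := by ring
    · rw [min_eq_right h]
      exact mul_le_mul (min_le_right _ _) (min_le_right _ _) (by positivity) (by linarith)
  have key : c * min (|s - r| / 2) (r₀ / 2) * |s - r| ≤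
      (enthalpy a γ m - enthalpy a γ r) * (s - r) := by
    rcases le_total r s with h | h
    · rw [abs_of_nonneg (sub_nonneg.2 h)]
      refine mul_le_mul_of_nonneg_right ?_ (sub_nonneg.2 h)
      -- The step from r towards m, cut off so that the quantitative increment applies; monotonicity
      -- of the enthalpy covers the rest of the way.
      set t := min ((s - r) / 2) (r₀ / 2) with ht
      have ht0 : 0 ≤ t := le_min (by linarith) (by linarith)
      have ht1 : t ≤ (s - r) / 2 := min_le_left _ _
      have ht2 : t ≤ r₀ / 2 := min_le_right _ _
      have h3 := hinc r hrJ (r + t) ⟨by linarith [hr.1], by linarith [hr.2]⟩ (by linarith)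
      have h4 := enthalpy_mono ha hγ (x := r + t) (y := m) (by linarith)
        (by simp only [hm]; linarith)
      rw [add_sub_cancel_left] at h3
      linarith
    · rw [abs_of_nonpos (sub_nonpos.2 h)]
      set t := min (-(s - r) / 2) (r₀ / 2) with ht
      have ht0 : 0 ≤ t := le_min (by linarith) (by linarith)
      have ht1 : t ≤ -(s - r) / 2 := min_le_left _ _
      have ht2 : t ≤ r₀ / 2 := min_le_right _ _
      have h3 := hinc (r - t) ⟨by linarith [hr.1], by linarith [hr.2]⟩ r hrJ (by linarith)
      have h4 := enthalpy_mono ha hγ (x := m) (y := r - t) hmp.le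
        (by simp only [hm]; linarith)
      rw [sub_sub_cancel] at h3
      nlinarith
  rw [hid, hsm]
  have h5 := mul_le_mul_of_nonneg_left (harith |s - r| (abs_nonneg _)) hc.le
  rw [sq_abs] at h5
  nlinarith

/-- Pointwise estimate of the remainder of the relative energy inequality. -/
theorem exists_remainder_bound (ha : 0 < a) (hγ : 1 < γ) {q : ℝ → ℝ} (hq : IsTestOnPos q)
    {r₀ R₀ : ℝ} (h0 : 0 < r₀) (hrR : r₀ ≤ R₀) {KB KF Kt δ : ℝ} (hKB : 0 ≤ KB) (hKF : 0 ≤ KF)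
    (hKt : 0 ≤ Kt) (hδ : 0 < δ) :
    ∃ C ≥ 0, ∀ r ∈ Icc r₀ R₀, ∀ s, 0 ≤ s → ∀ W, 0 ≤ W → ∀ D : ℝ,
      KB * (s * W ^ 2) + KF * (|s - r| * W) + Kt * ((γ - 1) * relPotential a γ s r)
        + |q s - q r| * |D| ≤
      C * (1 / 2 * s * W ^ 2 + relPotential a γ s r) + δ * (W ^ 2 + D ^ 2) := by
  obtain ⟨c, hc, hcoer⟩ := exists_coercivity_relPotential ha hγ h0 hrR
  obtain ⟨L, hL⟩ := hq.1.lipschitzWith_of_hasCompactSupport hq.2.1 (by simp)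
  obtain ⟨Q, hQ⟩ := hq.1.continuous.bounded_above_of_compact_support hq.2.1
  have hQ0 : 0 ≤ Q := (norm_nonneg _).trans (hQ 0)
  -- The summand L² serves when the minimum is (s-r)². The summand 2QL serves when it is |s-r|, by
  -- bounding one factor of the square by 2Q and the other by L|s-r|.
  set Kq : ℝ := L ^ 2 + 2 * Q * L with hKq
  have hqb : ∀ s r, (q s - q r) ^ 2 ≤ Kq * min ((s - r) ^ 2) |s - r| := by
    intro s r
    have h1 : |q s - q r| ≤ L * |s - r| := by
      have := hL.dist_le_mul s r
      rwa [Real.dist_eq, Real.dist_eq] at this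
    have h2 : |q s - q r| ≤ 2 * Q := by
      have e1 := hQ s
      have e2 := hQ r
      have := norm_sub_le (q s) (q r)
      rw [Real.norm_eq_abs] at this
      linarith
    have hL0 : (0 : ℝ) ≤ L := L.2
    have e0 := abs_nonneg (q s - q r)
    have e1 := abs_nonneg (s - r)
    have e3 : 0 ≤ 2 * Q * L := by positivity
    rw [← sq_abs (q s - q r), ← sq_abs (s - r)]
    rcases min_choice (|s - r| ^ 2) |s - r| with h | h <;> rw [h]
    · calc |q s - q r| ^ 2 ≤ (L * |s - r|) ^ 2 := by gcongr
        _ ≤ Kq * |s - r| ^ 2 := by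
          rw [mul_pow]; gcongr; simp only [hKq]; linarith
    · calc |q s - q r| ^ 2 = |q s - q r| * |q s - q r| := sq _
        _ ≤ 2 * Q * (L * |s - r|) := mul_le_mul h2 h1 e0 (by positivity)
        _ ≤ Kq * |s - r| := by
          rw [← mul_assoc]; gcongr; simp only [hKq]; nlinarith [sq_nonneg (L : ℝ)]
  have hKq0 : 0 ≤ Kq := by simp only [hKq]; positivity
  have hR₀ : 0 ≤ R₀ := h0.le.trans hrR
  set C₁ : ℝ := KF ^ 2 * (1 + R₀) / (4 * δ) + KF with hC₁
  have hC₁0 : 0 ≤ C₁ := by positivity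
  -- If |s-r| ≤ 1, Young's inequality suffices. If |s-r| ≥ 1 and s ≤ r, then |s-r| ≤ R₀, so (s-r)² ≤
  -- R₀|s-r| and Young's inequality applies again. If |s-r| ≥ 1 and s ≥ r, then |s-r| ≤ s, and |s-r|
  -- W ≤ s W² + |s-r| spends kinetic energy instead of dissipation.
  have hF : ∀ r ∈ Icc r₀ R₀, ∀ s, 0 ≤ s → ∀ W, 0 ≤ W →
      KF * (|s - r| * W) ≤ δ * W ^ 2 + KF * (s * W ^ 2) + C₁ * min ((s - r) ^ 2) |s - r| := by
    intro r hr s hs W hW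
    have hrp : 0 < r := h0.trans_le hr.1
    have hz := abs_nonneg (s - r)
    rw [← sq_abs (s - r)]
    have hyoung : ∀ m : ℝ, |s - r| ^ 2 ≤ (1 + R₀) * m →
        KF * (|s - r| * W) ≤ δ * W ^ 2 + KF ^ 2 * (1 + R₀) / (4 * δ) * m := by
      intro m hm
      have h1 : KF ^ 2 * |s - r| ^ 2 / (4 * δ) ≤ KF ^ 2 * (1 + R₀) / (4 * δ) * m := by
        rw [div_mul_eq_mul_div, mul_assoc]; gcongr
      refine le_trans ?_ (add_le_add_right h1 _)
      rw [← sub_nonneg]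
      have : δ * W ^ 2 + KF ^ 2 * |s - r| ^ 2 / (4 * δ) - KF * (|s - r| * W) =
          (2 * δ * W - KF * |s - r|) ^ 2 / (4 * δ) := by field_simp; ring
      rw [this]; positivity
    have hsW : 0 ≤ KF * (s * W ^ 2) := by positivity
    rcases le_total |s - r| 1 with h | h
    · have hmin : min (|s - r| ^ 2) |s - r| = |s - r| ^ 2 := min_eq_left (by nlinarith)
      rw [hmin]
      have := hyoung (|s - r| ^ 2) (by nlinarith [sq_nonneg |s - r|])
      have e : 0 ≤ KF * |s - r| ^ 2 := by positivity
      simp only [hC₁, add_mul]; linarith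
    · have hmin : min (|s - r| ^ 2) |s - r| = |s - r| := min_eq_right (by nlinarith)
      rw [hmin]
      have e : 0 ≤ KF * |s - r| := by positivity
      rcases le_total s r with hsr | hsr
      · have h2 : |s - r| ≤ R₀ := by
          rw [abs_of_nonpos (by linarith)]; linarith [hr.2]
        have := hyoung |s - r| (by nlinarith)
        simp only [hC₁, add_mul]; linarith
      · have h2 : |s - r| ≤ s := by rw [abs_of_nonneg (by linarith)]; linarith
        have h3 : |s - r| * W ≤ s * W ^ 2 + |s - r| := by
          have : |s - r| * W ^ 2 ≤ s * W ^ 2 := by gcongr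
          nlinarith [mul_nonneg hz (sq_nonneg (W - 1)), mul_nonneg hz (sq_nonneg (W + 1)),
            mul_nonneg hz (sq_nonneg W)]
        have h4 := mul_le_mul_of_nonneg_left h3 hKF
        have e2 : 0 ≤ KF ^ 2 * (1 + R₀) / (4 * δ) * |s - r| := by positivity
        have e3 : 0 ≤ δ * W ^ 2 := by positivity
        simp only [hC₁, add_mul]; linarith
  have hγ1 : 0 < γ - 1 := by linarith
  -- The factor 2 undoes the ½ of the kinetic energy, and KF is included because of the term s W²
  -- produced by `hF`. Division by c converts the minimum into the relative potential.
  refine ⟨2 * (KB + KF) + (C₁ + Kq / (4 * δ)) / c + Kt * (γ - 1), by positivity, ?_⟩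
  intro r hr s hs W hW D
  have h1 := hF r hr s hs W hW
  have h2 : |q s - q r| * |D| ≤ δ * D ^ 2 + Kq / (4 * δ) * min ((s - r) ^ 2) |s - r| := by
    have e1 : (q s - q r) ^ 2 / (4 * δ) ≤ Kq / (4 * δ) * min ((s - r) ^ 2) |s - r| := by
      rw [div_mul_eq_mul_div]
      gcongr
      exact hqb s r
    refine le_trans ?_ (add_le_add_right e1 _)
    rw [← sub_nonneg, ← sq_abs (q s - q r), ← sq_abs D]
    have : δ * |D| ^ 2 + |q s - q r| ^ 2 / (4 * δ) - |q s - q r| * |D| =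
        (2 * δ * |D| - |q s - q r|) ^ 2 / (4 * δ) := by field_simp; ring
    rw [this]; positivity
  have h3 : min ((s - r) ^ 2) |s - r| ≤ relPotential a γ s r / c := by
    rw [le_div_iff₀ hc, mul_comm]; exact hcoer r hr s hs
  have h4 : (C₁ + Kq / (4 * δ)) * min ((s - r) ^ 2) |s - r| ≤
      (C₁ + Kq / (4 * δ)) / c * relPotential a γ s r := by
    rw [div_mul_eq_mul_div, ← mul_div_assoc']
    exact mul_le_mul_of_nonneg_left h3 (by positivity)
  have hP := relPotential_nonneg ha hγ hs (h0.trans_le hr.1)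
  have hsW : 0 ≤ s * W ^ 2 := by positivity
  have e1 : 0 ≤ (KB + KF) * relPotential a γ s r := by positivity
  have e2 : 0 ≤ ((C₁ + Kq / (4 * δ)) / c + Kt * (γ - 1)) * (s * W ^ 2) := by positivity
  nlinarith

end RelativePotential

/-! ### The non-isentropic part of the pressure potential -/

section PressurePotential

/-- The pressure potential is, up to the isentropic part and a linear function, an admissible
renormalization. -/
theorem exists_pressurePotential_decomposition (a γ : ℝ) {q : ℝ → ℝ} (hq : IsTestOnPos q) :
    ∃ (c : ℝ) (b : ℝ → ℝ), ContDiff ℝ 1 b ∧ (∃ R : ℝ, ∀ s, R ≤ s → deriv b s = 0) ∧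
      (∃ K : ℝ, ∀ s, 0 ≤ s → |b s| ≤ K) ∧
      (∀ s, pressurePotential a γ q s = potential a γ s + (c * s + b s)) ∧
      ∀ s, b s - deriv b s * s = -q s := by
  obtain ⟨hqs, hqc, hq0⟩ := hq
  have hk : ContDiff ℝ 1 (fun z => q z / z ^ 2) := by
    refine contDiff_of_contDiffAt_tsupport fun x hx => ?_
    have hsub : tsupport (fun z => q z / z ^ 2) ⊆ tsupport q := by
      refine closure_mono fun z hz => ?_
      rw [Function.mem_support] at hz ⊢
      intro h
      exact hz (by simp [h])
    have hx0 : (0 : ℝ) < x := hq0 (hsub hx)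
    exact (contDiff_infty.1 hqs 1).contDiffAt.div (contDiffAt_id.pow 2) (by positivity)
  obtain ⟨R₁, hR₁⟩ := hqc.isCompact.isBounded.exists_norm_le
  set R := max (R₁ + 1) 1 with hR
  have hqR : ∀ z, R ≤ z → q z = 0 := by
    intro z hz
    by_contra h
    have h1 := hR₁ z (subset_tsupport q h)
    have h2 := le_max_left (R₁ + 1) 1
    have h3 := le_abs_self z
    rw [Real.norm_eq_abs] at h1
    linarith
  have hR0 : 0 < R := lt_of_lt_of_le one_pos (le_max_right _ _)
  set k : ℝ → ℝ := fun z => q z / z ^ 2 with hkdef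
  -- Integrating from R, beyond the support of q, instead of from 1 makes s·K(s) vanish for s ≥ R.
  -- What is lost is s times the integral over [1, R], the linear part.
  set K : ℝ → ℝ := fun s => ∫ z in R..s, k z with hK
  have hKd : ∀ s, HasDerivAt K (k s) s := fun s =>
    intervalIntegral.integral_hasDerivAt_right (hk.continuous.intervalIntegrable _ _)
      (hk.continuous.stronglyMeasurableAtFilter _ _) hk.continuous.continuousAt
  have hbd : ∀ s, HasDerivAt (fun s => s * K s) (1 * K s + s * k s) s := fun s =>
    (hasDerivAt_id s).mul (hKd s)
  have hKR : ∀ s, R ≤ s → K s = 0 := by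
    intro s hs
    rw [hK]
    dsimp only
    rw [intervalIntegral.integral_congr (g := fun _ => 0)]
    · simp
    · intro z hz
      rw [uIcc_of_le hs] at hz
      simp [hkdef, hqR z hz.1]
  have hKc : ContDiff ℝ 1 K := by
    rw [contDiff_one_iff_deriv]
    refine ⟨fun s => (hKd s).differentiableAt, ?_⟩
    have : deriv K = k := funext fun s => (hKd s).deriv
    rw [this]
    exact hk.continuous
  have hbc : ContDiff ℝ 1 (fun s => s * K s) := contDiff_id.mul hKc
  obtain ⟨B, hB⟩ := (isCompact_Icc (a := (0 : ℝ)) (b := R)).exists_bound_of_continuousOn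
    hbc.continuous.continuousOn
  refine ⟨∫ z in (1 : ℝ)..R, k z, fun s => s * K s, hbc, ⟨R, fun s hs => ?_⟩, ⟨B, fun s hs => ?_⟩,
    fun s => ?_, fun s => ?_⟩
  · rw [(hbd s).deriv, hKR s hs]
    simp [hkdef, hqR s hs]
  · rcases le_total s R with h | h
    · exact hB s ⟨hs, h⟩
    · dsimp only
      rw [hKR s h, mul_zero, abs_zero]
      exact (norm_nonneg _).trans (hB 0 ⟨le_rfl, hR0.le⟩)
  · rw [pressurePotential, potential, hK, ← intervalIntegral.integral_add_adjacent_intervals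
      (hk.continuous.intervalIntegrable 1 R) (hk.continuous.intervalIntegrable R s)]
    ring
  · rw [(hbd s).deriv]
    by_cases hs : s = 0
    · have : q 0 = 0 := by
        by_contra h
        exact lt_irrefl (0 : ℝ) (hq0 (subset_tsupport q h))
      simp [hs, this]
    · simp only [hkdef]
      field_simp
      ring

end PressurePotential

/-! ### Fubini on the space-time cylinder -/

section CylinderIntegrals

variable {N : ℕ} {Ω : Set (Eucl N)} {T : ℝ}

theorem restrict_cylinder : (volume : Measure (ℝ × Eucl N)).restrict (cylinder Ω T) =
    (volume.restrict (Ioo 0 T)).prod (volume.restrict Ω) := by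
  rw [cylinder, Measure.volume_eq_prod, Measure.prod_restrict]

theorem cylinder_mono {τ : ℝ} (hτ : τ ≤ T) : cylinder Ω τ ⊆ cylinder Ω T :=
  prod_mono (Ioo_subset_Ioo_right hτ) Subset.rfl

theorem intervalIntegral_eq_integral_cylinder {f : ℝ → Eucl N → ℝ} {τ : ℝ} (h0 : 0 ≤ τ)
    (hτ : τ ≤ T)
    (hf : Integrable (fun z : ℝ × Eucl N => f z.1 z.2) (volume.restrict (cylinder Ω T))) :
    ∫ t in (0 : ℝ)..τ, ∫ x in Ω, f t x = ∫ z in cylinder Ω τ, f z.1 z.2 := by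
  have hf' : IntegrableOn (fun z : ℝ × Eucl N => f z.1 z.2) (cylinder Ω τ) :=
    IntegrableOn.mono_set hf (cylinder_mono hτ)
  rw [intervalIntegral.integral_of_le h0, integral_Ioc_eq_integral_Ioo]
  exact (setIntegral_prod (fun z : ℝ × Eucl N => f z.1 z.2) hf').symm

theorem integrable_cylinder_of_slices {f : ℝ → Eucl N → ℝ} {C : ℝ}
    (hm : AEStronglyMeasurable (fun z : ℝ × Eucl N => f z.1 z.2)
      (volume.restrict (cylinder Ω T)))
    (h : ∀ᵐ t ∂(volume.restrict (Ioo 0 T)), IntegrableOn (f t) Ω ∧ ∫ x in Ω, ‖f t x‖ ≤ C) :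
    Integrable (fun z : ℝ × Eucl N => f z.1 z.2) (volume.restrict (cylinder Ω T)) := by
  rw [restrict_cylinder] at hm ⊢
  rw [integrable_prod_iff hm]
  refine ⟨h.mono fun t ht => ht.1, ?_⟩
  refine Integrable.mono' (g := fun _ => C) (integrable_const _) hm.norm.integral_prod_right' ?_
  filter_upwards [h] with t ht
  rw [Real.norm_of_nonneg (integral_nonneg fun _ => norm_nonneg _)]
  exact ht.2

/-- Fibrewise statements pass to the product measure for measurable sets, so the argument goes
through a strongly measurable representative. -/
theorem ae_cylinder_nonneg {f : ℝ → Eucl N → ℝ}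
    (hm : AEStronglyMeasurable (fun z : ℝ × Eucl N => f z.1 z.2)
      (volume.restrict (cylinder Ω T)))
    (h : ∀ᵐ t ∂(volume.restrict (Ioo 0 T)), ∀ᵐ x ∂(volume.restrict Ω), 0 ≤ f t x) :
    ∀ᵐ z ∂(volume.restrict (cylinder Ω T)), 0 ≤ f z.1 z.2 := by
  obtain ⟨g, hg, hfg⟩ := hm
  have hms : MeasurableSet {z : ℝ × Eucl N | 0 ≤ g z} :=
    measurableSet_le measurable_const hg.measurable
  have h1 : ∀ᵐ z ∂(volume.restrict (cylinder Ω T)), 0 ≤ g z := by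
    rw [restrict_cylinder] at hfg ⊢
    rw [Measure.ae_prod_iff_ae_ae hms]
    filter_upwards [h, Measure.ae_ae_of_ae_prod hfg] with t h1 h2
    filter_upwards [h1, h2] with x h3 h4
    rw [← h4]
    exact h3
  filter_upwards [h1, hfg] with z h2 h3
  rw [h3]
  exact h2

theorem isFiniteMeasure_restrict_cylinder (hb : Bornology.IsBounded Ω) :
    IsFiniteMeasure ((volume : Measure (ℝ × Eucl N)).restrict (cylinder Ω T)) := by
  have := isFiniteMeasure_restrict_of_isBounded hb
  rw [restrict_cylinder]
  infer_instance

theorem integral_cylinder_eq_zero {f : ℝ → Eucl N → ℝ} {τ : ℝ} (h0 : 0 ≤ τ)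
    (hτ : τ ≤ T)
    (hf : Integrable (fun z : ℝ × Eucl N => f z.1 z.2) (volume.restrict (cylinder Ω T)))
    (h : ∀ᵐ t ∂(volume.restrict (Ioo 0 T)), ∫ x in Ω, f t x = 0) :
    ∫ z in cylinder Ω τ, f z.1 z.2 = 0 := by
  rw [← intervalIntegral_eq_integral_cylinder h0 hτ hf, intervalIntegral.integral_of_le h0,
    integral_Ioc_eq_integral_Ioo]
  exact integral_eq_zero_of_ae (ae_mono (Measure.restrict_mono
    (Ioo_subset_Ioo_right hτ) le_rfl) h)

end CylinderIntegrals

/-! ### Integrability of the weak solution and the balance of its q-potential -/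

section WeakSolutionIntegrability

variable {N : ℕ} {Ω : Set (Eucl N)} {T μ lam a γ : ℝ} {q : ℝ → ℝ}
  {ρ : ℝ → Eucl N → ℝ} {u : ℝ → Eucl N → Eucl N} {Du : ℝ → Eucl N → (Eucl N →L[ℝ] Eucl N)}

theorem exists_bound_slice_rpow {s : ℝ} (hs : 1 < s) (h : MemLinftyLp Ω T s ρ) :
    ∃ C : ℝ, ∀ᵐ t ∂(volume.restrict (Ioo 0 T)),
      IntegrableOn (fun x => |ρ t x| ^ s) Ω ∧ ∫ x in Ω, |ρ t x| ^ s ≤ C := by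
  obtain ⟨hm, C, hC⟩ := h
  rw [restrict_cylinder] at hm
  refine ⟨(C : ℝ) ^ s, ?_⟩
  filter_upwards [hC, hm.prodMk_left] with t ht hmt
  have hs0 : 0 < s := by linarith
  have hp0 : ENNReal.ofReal s ≠ 0 := by simpa using hs0
  have hL : MemLp (ρ t) (ENNReal.ofReal s) (volume.restrict Ω) :=
    ⟨hmt, ht.trans_lt ENNReal.coe_lt_top⟩
  have h1 := hL.integrable_norm_rpow hp0 ENNReal.ofReal_ne_top
  rw [ENNReal.toReal_ofReal hs0.le] at h1
  refine ⟨h1, ?_⟩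
  rw [hL.eLpNorm_eq_integral_rpow_norm hp0 ENNReal.ofReal_ne_top,
    ENNReal.toReal_ofReal hs0.le] at ht
  have hI : 0 ≤ ∫ x in Ω, ‖ρ t x‖ ^ s := integral_nonneg fun x => by positivity
  have h2 : (∫ x in Ω, ‖ρ t x‖ ^ s) ^ s⁻¹ ≤ C := by
    rw [ENNReal.ofReal_le_iff_le_toReal ENNReal.coe_ne_top] at ht
    simpa using ht
  have h3 := Real.rpow_le_rpow (by positivity) h2 hs0.le
  rwa [← Real.rpow_mul hI, inv_mul_cancel₀ hs0.ne', Real.rpow_one] at h3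

theorem le_one_add_rpow {s p : ℝ} (hs : 0 ≤ s) (hp : 1 ≤ p) : s ≤ 1 + s ^ p := by
  rcases le_total s 1 with h | h
  · have := Real.rpow_nonneg hs p
    linarith
  · have := Real.rpow_le_rpow_of_exponent_le h hp
    rw [Real.rpow_one] at this
    linarith

theorem integrable_rpow_density (hγ : 1 < γ) (h : MemLinftyLp Ω T γ ρ) :
    Integrable (fun z : ℝ × Eucl N => |ρ z.1 z.2| ^ γ) (volume.restrict (cylinder Ω T)) := by
  obtain ⟨C, hC⟩ := exists_bound_slice_rpow hγ h
  refine integrable_cylinder_of_slices (f := fun t x => |ρ t x| ^ γ) (C := C) ?_ ?_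
  · exact (h.1.norm.aemeasurable.pow_const γ).aestronglyMeasurable
  · filter_upwards [hC] with t ht
    refine ⟨ht.1, ?_⟩
    refine le_trans (le_of_eq ?_) ht.2
    congr 1
    funext x
    exact Real.norm_of_nonneg (by positivity)

theorem integrable_density (hb : Bornology.IsBounded Ω) (hγ : 1 < γ)
    (h : MemLinftyLp Ω T γ ρ) :
    Integrable (fun z : ℝ × Eucl N => ρ z.1 z.2) (volume.restrict (cylinder Ω T)) := by
  have := isFiniteMeasure_restrict_cylinder (T := T) hb
  refine Integrable.mono' ((integrable_const (1 : ℝ)).add (integrable_rpow_density hγ h)) h.1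
    (ae_of_all _ fun z => ?_)
  exact le_one_add_rpow (abs_nonneg _) hγ.le

theorem integrable_bilin_two {α V W F : Type*} [MeasurableSpace α] {ν : Measure α}
    [NormedAddCommGroup V] [NormedSpace ℝ V] [NormedAddCommGroup W] [NormedSpace ℝ W]
    [NormedAddCommGroup F] [NormedSpace ℝ F]
    (b : V →L[ℝ] W →L[ℝ] F) {f : α → V} {g : α → W} (hf : MemLp f 2 ν) (hg : MemLp g 2 ν) :
    Integrable (fun x => b (f x) (g x)) ν :=
  memLp_one_iff_integrable.1 (b.memLp_of_bilin 1 hf hg)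

theorem integrable_bilin_top {α V W F : Type*} [MeasurableSpace α] {ν : Measure α}
    [NormedAddCommGroup V] [NormedSpace ℝ V] [NormedAddCommGroup W] [NormedSpace ℝ W]
    [NormedAddCommGroup F] [NormedSpace ℝ F]
    (b : V →L[ℝ] W →L[ℝ] F) {f : α → V} {g : α → W} (hf : MemLp f ∞ ν) (hg : Integrable g ν) :
    Integrable (fun x => b (f x) (g x)) ν :=
  memLp_one_iff_integrable.1 (b.memLp_of_bilin 1 hf (memLp_one_iff_integrable.2 hg))

/-- The kinetic energy is integrable over the cylinder. -/
theorem integrable_kinetic (hb : Bornology.IsBounded Ω)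
    (ha : 0 < a) (hγ : 1 < γ) (hq : IsTestOnPos q)
    (hnn : ∀ t ∈ Icc (0 : ℝ) T, ∀ᵐ x ∂(volume.restrict Ω), 0 ≤ ρ t x)
    (hint : ∀ t ∈ Icc (0 : ℝ) T, IntegrableOn (ρ t) Ω)
    (hρ : MemLinftyLp Ω T γ ρ) (hu : MemL2W012 Ω T u Du)
    (hE : EnergyInequality Ω T μ lam a γ q ρ u Du) :
    Integrable (fun z : ℝ × Eucl N => ρ z.1 z.2 * ‖u z.1 z.2‖ ^ 2)
      (volume.restrict (cylinder Ω T)) := by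
  have := isFiniteMeasure_restrict_of_isBounded hb
  obtain ⟨C, hC⟩ := exists_bound_slice_rpow hγ hρ
  obtain ⟨c, b, hbc, -, ⟨K, hK⟩, hdec, -⟩ := exists_pressurePotential_decomposition a γ hq
  have hS : Integrable (fun z : ℝ × Eucl N =>
      frob (stress μ lam (Du z.1 z.2)) (Du z.1 z.2)) (volume.restrict (cylinder Ω T)) :=
    integrable_bilin_two ((frobL N).comp (stressL N μ lam)) hu.2.1 hu.2.1
  set D := ∫ z in cylinder Ω T, ‖frob (stress μ lam (Du z.1 z.2)) (Du z.1 z.2)‖ with hD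
  set E₀ := ∫ x in Ω, energyDensity a γ q (ρ 0 x) (u 0 x) with hE₀
  set V := volume.real Ω with hV
  -- The kinetic energy is the total energy minus P(ρ). The energy inequality gives at most E₀ + D
  -- for the former; the isentropic part of P is nonnegative, and the rest is at least -(|c|(1 +
  -- ρ^γ) + K).
  refine integrable_cylinder_of_slices (f := fun t x => ρ t x * ‖u t x‖ ^ 2)
    (C := 2 * (E₀ + D + (|c| + K) * V + |c| * C)) ?_ ?_
  · exact hρ.1.mul (hu.1.1.norm.pow 2)
  · filter_upwards [hC, hE.2, ae_restrict_mem measurableSet_Ioo] with t h1 h2 ht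
    have ht' := Ioo_subset_Icc_self ht
    have hnt := hnn t ht'
    have habs : ∀ᵐ x ∂(volume.restrict Ω), |ρ t x| ^ γ = ρ t x ^ γ := by
      filter_upwards [hnt] with x hx
      rw [abs_of_nonneg hx]
    have iP : IntegrableOn (fun x => ρ t x ^ γ) Ω := h1.1.congr habs
    have ib : IntegrableOn (fun x => b (ρ t x)) Ω := by
      refine Integrable.mono' (integrable_const K)
        (hbc.continuous.comp_aestronglyMeasurable (hint t ht').1) ?_
      filter_upwards [hnt] with x hx using hK _ hx
    have iQ : IntegrableOn (fun x => pressurePotential a γ q (ρ t x)) Ω := by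
      simp only [hdec]
      exact (iP.const_mul _).add (((hint t ht').const_mul c).add ib)
    have ikin : IntegrableOn (fun x => ρ t x * ‖u t x‖ ^ 2) Ω := by
      refine ((h2.1.sub iQ).const_mul 2).congr (ae_of_all _ fun x => ?_)
      simp only [energyDensity, Pi.sub_apply]
      ring
    refine ⟨ikin, ?_⟩
    have e1 : ∫ x in Ω, ‖ρ t x * ‖u t x‖ ^ 2‖ = ∫ x in Ω, ρ t x * ‖u t x‖ ^ 2 := by
      refine integral_congr_ae ?_
      filter_upwards [hnt] with x hx
      exact Real.norm_of_nonneg (by positivity)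
    have e2 : ∫ x in Ω, ρ t x * ‖u t x‖ ^ 2 ≤ ∫ x in Ω,
        2 * (energyDensity a γ q (ρ t x) (u t x) + ((|c| + K) + |c| * |ρ t x| ^ γ)) := by
      refine integral_mono_ae ikin
        ((h2.1.add ((integrable_const _).add (h1.1.const_mul _))).const_mul 2) ?_
      filter_upwards [hnt] with x hx
      have f1 : 0 ≤ potential a γ (ρ t x) :=
        mul_nonneg (div_nonneg ha.le (by linarith)) (by positivity)
      have f2 := (abs_le.1 (hK _ hx)).1
      have f3 : |c * ρ t x| ≤ |c| * (1 + |ρ t x| ^ γ) := by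
        rw [abs_mul]
        exact mul_le_mul_of_nonneg_left (le_one_add_rpow (abs_nonneg _) hγ.le) (abs_nonneg _)
      have f4 := (abs_le.1 f3).1
      simp only [energyDensity, hdec]
      linarith
    have e3 : ∫ x in Ω,
        2 * (energyDensity a γ q (ρ t x) (u t x) + ((|c| + K) + |c| * |ρ t x| ^ γ)) =
        2 * ((∫ x in Ω, energyDensity a γ q (ρ t x) (u t x)) + ((|c| + K) * V
          + |c| * ∫ x in Ω, |ρ t x| ^ γ)) := by
      have i3 : Integrable (fun x => (|c| + K) + |c| * |ρ t x| ^ γ) (volume.restrict Ω) :=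
        (integrable_const _).add (h1.1.const_mul _)
      rw [integral_const_mul, integral_add h2.1 i3, integral_add (integrable_const _)
        (h1.1.const_mul _), integral_const_mul, integral_const, smul_eq_mul,
        measureReal_restrict_apply_univ, mul_comm V]
    -- The L¹ norm of the dissipation is enough here; its sign plays no role.
    have e4 : -D ≤ ∫ s in (0 : ℝ)..t, ∫ x in Ω, frob (stress μ lam (Du s x)) (Du s x) := by
      rw [intervalIntegral_eq_integral_cylinder ht.1.le ht.2.le hS]
      refine (abs_le.1 (le_trans (abs_integral_le_integral_abs) ?_)).1
      exact setIntegral_mono_set hS.norm (ae_of_all _ fun z => abs_nonneg _)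
        (LE.le.eventuallyLE (cylinder_mono ht.2.le))
    have e5 := mul_le_mul_of_nonneg_left h1.2 (abs_nonneg c)
    rw [e1]
    refine e2.trans ?_
    rw [e3]
    linarith [h2.2]

theorem integrable_momentum
    (hρm : AEStronglyMeasurable (fun z : ℝ × Eucl N => ρ z.1 z.2) (volume.restrict (cylinder Ω T)))
    (hum : AEStronglyMeasurable (fun z : ℝ × Eucl N => u z.1 z.2) (volume.restrict (cylinder Ω T)))
    (hnn : ∀ᵐ z ∂(volume.restrict (cylinder Ω T)), 0 ≤ ρ z.1 z.2)
    (hρ : Integrable (fun z : ℝ × Eucl N => ρ z.1 z.2) (volume.restrict (cylinder Ω T)))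
    (hk : Integrable (fun z : ℝ × Eucl N => ρ z.1 z.2 * ‖u z.1 z.2‖ ^ 2)
      (volume.restrict (cylinder Ω T))) :
    Integrable (fun z : ℝ × Eucl N => ρ z.1 z.2 • u z.1 z.2) (volume.restrict (cylinder Ω T)) := by
  refine Integrable.mono' (hρ.add hk) (hρm.smul hum) ?_
  filter_upwards [hnn] with z hz
  rw [norm_smul, Real.norm_of_nonneg hz, Pi.add_apply]
  have : ‖u z.1 z.2‖ ≤ 1 + ‖u z.1 z.2‖ ^ 2 := by nlinarith [sq_nonneg (‖u z.1 z.2‖ - 1)]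
  nlinarith

/-- Balance of the non-isentropic part of the pressure potential. -/
theorem renormalized_balance {c : ℝ} {b : ℝ → ℝ} (hbc : ContDiff ℝ 1 b)
    (hbR : ∃ R : ℝ, ∀ s, R ≤ s → deriv b s = 0) (hbK : ∃ K : ℝ, ∀ s, 0 ≤ s → |b s| ≤ K)
    (hbq : ∀ s, b s - deriv b s * s = -q s) (hb : Bornology.IsBounded Ω) (hT : 0 < T)
    (hnn : ∀ t ∈ Icc (0 : ℝ) T, ∀ᵐ x ∂(volume.restrict Ω), 0 ≤ ρ t x)
    (hint : ∀ t ∈ Icc (0 : ℝ) T, IntegrableOn (ρ t) Ω)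
    (hC : WeakContinuity Ω T ρ u) (hR : RenormalizedContinuity Ω T ρ u Du) :
    (∀ τ ∈ Icc (0 : ℝ) T, IntegrableOn (fun x => c * ρ τ x + b (ρ τ x)) Ω) ∧
    ∀ τ ∈ Icc (0 : ℝ) T,
      (∫ x in Ω, (c * ρ τ x + b (ρ τ x))) - (∫ x in Ω, (c * ρ 0 x + b (ρ 0 x))) =
        -∫ t in (0 : ℝ)..τ, ∫ x in Ω, q (ρ t x) * tr (Du t x) := by
  have := isFiniteMeasure_restrict_of_isBounded hb
  obtain ⟨K, hK⟩ := hbK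
  have ib : ∀ t ∈ Icc (0 : ℝ) T, IntegrableOn (fun x => b (ρ t x)) Ω := by
    intro t ht
    refine Integrable.mono' (integrable_const K)
      (hbc.continuous.comp_aestronglyMeasurable (hint t ht).1) ?_
    filter_upwards [hnn t ht] with x hx using hK _ hx
  refine ⟨fun t ht => ((hint t ht).const_mul c).add (ib t ht), fun τ hτ => ?_⟩
  have h0 : (0 : ℝ) ∈ Icc 0 T := ⟨le_rfl, hT.le⟩
  have hdW : ∀ s, 0 ≤ s → derivWithin b (Ici 0) s = deriv b s := fun s hs =>
    (hbc.differentiable (by simp) s).derivWithin (uniqueDiffOn_Ici 0 s hs)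
  -- With the test function 1, the continuity equation is conservation of mass and handles cρ, while
  -- the renormalized equation handles b(ρ) and produces -q(ρ) div u.
  have hone : IsC1 Ω T (fun _ _ => (1 : ℝ)) := contDiffOn_const
  have e1 := hC (fun _ _ => 1) hone τ hτ
  obtain ⟨R, hR'⟩ := hbR
  have e2 := hR b hbc.contDiffOn ⟨max R 0, fun s hs => by
    rw [hdW s ((le_max_right _ _).trans hs)]
    exact hR' s ((le_max_left _ _).trans hs)⟩ (fun _ _ => 1) hone τ hτ
  simp only [mul_one, deriv_const, mul_zero, fderiv_fun_const, Pi.zero_apply, zero_add,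
    zero_apply, integral_zero, intervalIntegral.integral_zero] at e1 e2
  rw [integral_add ((hint τ hτ).const_mul c) (ib τ hτ), integral_add ((hint 0 h0).const_mul c)
    (ib 0 h0), integral_const_mul, integral_const_mul]
  have e3 : (∫ t in (0 : ℝ)..τ, ∫ x in Ω,
      (b (ρ t x) - derivWithin b (Ici 0) (ρ t x) * ρ t x) * tr (Du t x)) =
      -∫ t in (0 : ℝ)..τ, ∫ x in Ω, q (ρ t x) * tr (Du t x) := by
    rw [← intervalIntegral.integral_neg]
    refine intervalIntegral.integral_congr fun t ht => ?_
    rw [uIcc_of_le hτ.1] at ht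
    rw [← integral_neg]
    refine integral_congr_ae ?_
    filter_upwards [hnn t ⟨ht.1, ht.2.trans hτ.2⟩] with x hx
    rw [hdW _ hx, hbq]
    ring
  rw [e3] at e2
  linear_combination c * e1 + e2

end WeakSolutionIntegrability

/-! ### The classical solution: non-conservative form, multipliers, bounds -/

section ClassicalSolutions

variable {N : ℕ} {Ω : Set (Eucl N)} {T μ lam a γ : ℝ} {q : ℝ → ℝ}
  {r : ℝ → Eucl N → ℝ} {U : ℝ → Eucl N → Eucl N}

theorem IsClassicalSolution.deriv_density (hc : IsClassicalSolution Ω T μ lam a γ q r U)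
    (hΩ : IsOpen Ω) {t : ℝ} {x : Eucl N} (ht : t ∈ Ioo 0 T) (hx : x ∈ Ω) :
    deriv (fun s => r s x) t =
      -(r t x * tr (fderiv ℝ (U t) x)) - fderiv ℝ (r t) x (U t x) := by
  have h := hc.continuity_eq t ht x hx
  rw [tr_fderiv_smul (hc.density_C1.hasFDerivAt_slice hΩ ht hx).differentiableAt
    (hc.velocity_C1.hasFDerivAt_slice hΩ ht hx).differentiableAt] at h
  linarith

theorem IsClassicalSolution.exists_lower_bound (hc : IsClassicalSolution Ω T μ lam a γ q r U)
    (hΩ : IsOpen Ω) (hb : Bornology.IsBounded Ω) (hne : Ω.Nonempty) (hT : 0 < T)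
    (hpos : ∀ x ∈ closure Ω, 0 < r 0 x) :
    ∃ δ > 0, ∀ t ∈ Icc (0 : ℝ) T, ∀ x ∈ closure Ω, δ ≤ r t x :=
  exists_lower_bound_density hΩ hb hne hc.density_C1 hc.velocity_C1 hc.no_slip hT
    hc.density_nonneg (fun _ ht _ hx => hc.deriv_density hΩ ht hx) hpos

/-- The tensor product of vectors as a continuous bilinear map. -/
def tensorL (N : ℕ) : Eucl N →L[ℝ] Eucl N →L[ℝ] (Eucl N →L[ℝ] Eucl N) :=
  (LinearMap.mk₂ ℝ tensor
    (fun v v' w => by ext1 x; simp [tensor])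
    (fun c v w => by ext1 x; simp only [tensor, ContinuousLinearMap.smulRight_apply, smul_apply,
      smul_comm c])
    (fun v w w' => by ext1 x; simp [tensor, add_smul])
    (fun c v w => by ext1 x; simp [tensor, mul_smul])).toContinuousBilinearMap

theorem tensorL_apply (v w : Eucl N) : tensorL N v w = tensor v w := rfl

theorem tensorDiv_tensor {V W : Eucl N → Eucl N} {x : Eucl N}
    (hV : DifferentiableAt ℝ V x) (hW : DifferentiableAt ℝ W x) :
    tensorDiv (fun y => tensor (V y) (W y)) x =
      fderiv ℝ V x (W x) + tr (fderiv ℝ W x) • V x := by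
  have hd : HasFDerivAt (fun y => tensor (V y) (W y)) _ x :=
    (tensorL N).hasFDerivAt_of_bilinear hV.hasFDerivAt hW.hasFDerivAt
  unfold tensorDiv
  rw [hd.fderiv, ← sum_apply_mul (fderiv ℝ V x) (W x), tr, Finset.sum_smul,
    ← Finset.sum_add_distrib]
  refine Finset.sum_congr rfl fun j _ => ?_
  have h1 : ∀ v : Eucl N, (inner ℝ v (stdVec j) : ℝ) = v j := fun v => by
    rw [inner_eq_sum]; simp [stdVec_apply]
  simp [tensorL_apply, tensor, h1, add_comm]

/-- The momentum equation in non-conservative form, tested with a vector. -/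
theorem IsClassicalSolution.inner_tensorDiv_stress
    (hc : IsClassicalSolution Ω T μ lam a γ q r U) (hΩ : IsOpen Ω) (hq : IsTestOnPos q)
    {t : ℝ} {x : Eucl N}
    (ht : t ∈ Ioo 0 T) (hx : x ∈ Ω) (hr : 0 < r t x) (v : Eucl N) :
    (inner ℝ (tensorDiv (fun y => stress μ lam (fderiv ℝ (U t) y)) x) v : ℝ) =
      r t x * (inner ℝ (deriv (fun s => U s x) t + fderiv ℝ (U t) x (U t x)) v : ℝ)
      + (r t x * enthalpyDeriv a γ (r t x) + deriv q (r t x)) * fderiv ℝ (r t) x v := by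
  rw [← hc.momentum_eq t ht x hx]
  have hrd := hc.density_C1.hasFDerivAt_slice hΩ ht hx
  have hUd := hc.velocity_C1.hasFDerivAt_slice hΩ ht hx
  have h1 : HasDerivAt (pressure a γ q)
      (r t x * enthalpyDeriv a γ (r t x) + deriv q (r t x)) (r t x) :=
    (hasDerivAt_rpow_pressure hr).add ((hq.1.differentiable (by simp) (r t x)).hasDerivAt)
  have h2 : HasFDerivAt (fun y => pressure a γ q (r t y))
      ((r t x * enthalpyDeriv a γ (r t x) + deriv q (r t x)) • fderiv ℝ (r t) x) x :=
    h1.comp_hasFDerivAt x hrd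
  have hrt := hc.density_C1.hasDerivAt hΩ ht hx
  have h3 : deriv (fun s => r s x • U s x) t =
      r t x • deriv (fun s => U s x) t + deriv (fun s => r s x) t • U t x :=
    (hrt.smul (hc.velocity_C1.hasDerivAt hΩ ht hx)).deriv
  have h4 : DifferentiableAt ℝ (fun y => r t y • U t y) x :=
    hrd.differentiableAt.smul hUd.differentiableAt
  rw [inner_add_left, inner_gradient_left, h2.fderiv, h3,
    tensorDiv_tensor h4 hUd.differentiableAt,
    fderiv_fun_smul hrd.differentiableAt hUd.differentiableAt, hc.deriv_density hΩ ht hx]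
  simp only [inner_add_left, inner_smul_left, add_apply,
    smul_apply, ContinuousLinearMap.smulRight_apply, smul_eq_mul,
    smul_smul, conj_trivial]
  ring

theorem IsC1.comp_of_contDiffOn (hr : IsC1 Ω T r) {f : ℝ → ℝ} {s : Set ℝ}
    (hf : ContDiffOn ℝ 1 f s) (hs : ∀ t ∈ Icc (0 : ℝ) T, ∀ x ∈ closure Ω, r t x ∈ s) :
    IsC1 Ω T (fun t x => f (r t x)) :=
  ContDiffOn.comp (g := f) (f := fun z : ℝ × Eucl N => r z.1 z.2) hf hr
    (fun z hz => hs z.1 hz.1 z.2 hz.2)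

theorem IsC1.comp_continuousOn (hr : IsC1 Ω T r) {f : ℝ → ℝ} {s : Set ℝ}
    (hf : ContinuousOn f s) (hs : ∀ t ∈ Icc (0 : ℝ) T, ∀ x ∈ closure Ω, r t x ∈ s) :
    ContinuousOn (fun z : ℝ × Eucl N => f (r z.1 z.2)) (Icc 0 T ×ˢ closure Ω) :=
  hf.comp hr.continuousOn (fun z hz => hs z.1 hz.1 z.2 hz.2)

theorem exists_bound_of_continuousOn_closed_cylinder {F : Type*} [NormedAddCommGroup F]
    {f : ℝ × Eucl N → F} (hb : Bornology.IsBounded Ω)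
    (hf : ContinuousOn f (Icc 0 T ×ˢ closure Ω)) :
    ∃ C : ℝ, ∀ t ∈ Ioo 0 T, ∀ x ∈ Ω, ‖f (t, x)‖ ≤ C := by
  obtain ⟨C, hC⟩ := (isCompact_closed_cylinder (T := T) hb).exists_bound_of_continuousOn hf
  exact ⟨C, fun t ht x hx => hC (t, x) ⟨Ioo_subset_Icc_self ht, subset_closure hx⟩⟩

theorem contDiffOn_enthalpy : ContDiffOn ℝ 1 (enthalpy a γ) (Ioi 0) :=
  contDiffOn_const.mul (contDiffOn_id.rpow_const_of_ne fun x (hx : 0 < x) => hx.ne')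

theorem continuousOn_enthalpyDeriv : ContinuousOn (enthalpyDeriv a γ) (Ioi 0) :=
  continuousOn_const.mul (continuousOn_id.rpow_const fun x (hx : 0 < x) => Or.inl hx.ne')

/-- The multiplier of the equation of continuity in the relative energy method. -/
def densityMultiplier (a γ : ℝ) (r : ℝ → Eucl N → ℝ) (U : ℝ → Eucl N → Eucl N) (t : ℝ)
    (x : Eucl N) : ℝ :=
  1 / 2 * ‖U t x‖ ^ 2 - enthalpy a γ (r t x)

theorem isC1_densityMultiplier (hr : IsC1 Ω T r) (hU : IsC1 Ω T U)
    (hpos : ∀ t ∈ Icc (0 : ℝ) T, ∀ x ∈ closure Ω, 0 < r t x) :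
    IsC1 Ω T (densityMultiplier a γ r U) :=
  (contDiffOn_const.mul (ContDiffOn.norm_sq ℝ hU)).sub
    (hr.comp_of_contDiffOn contDiffOn_enthalpy hpos)

theorem deriv_densityMultiplier (hγ : 1 < γ) (hr : IsC1 Ω T r) (hU : IsC1 Ω T U)
    (hΩ : IsOpen Ω) {t : ℝ} {x : Eucl N} (ht : t ∈ Ioo 0 T) (hx : x ∈ Ω) (hpos : 0 < r t x) :
    deriv (fun s => densityMultiplier a γ r U s x) t =
      (inner ℝ (U t x) (deriv (fun s => U s x) t) : ℝ)
        - enthalpyDeriv a γ (r t x) * deriv (fun s => r s x) t := by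
  have h1 := (hU.hasDerivAt hΩ ht hx).norm_sq.const_mul (1 / 2)
  have h2 := (hasDerivAt_enthalpy (a := a) hγ hpos).comp t (hr.hasDerivAt hΩ ht hx)
  have h3 : HasDerivAt (fun s => densityMultiplier a γ r U s x) _ t := h1.sub h2
  rw [h3.deriv]
  ring

theorem fderiv_densityMultiplier (hγ : 1 < γ) (hr : IsC1 Ω T r) (hU : IsC1 Ω T U)
    (hΩ : IsOpen Ω) {t : ℝ} {x : Eucl N} (ht : t ∈ Ioo 0 T) (hx : x ∈ Ω) (hpos : 0 < r t x)
    (v : Eucl N) :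
    fderiv ℝ (densityMultiplier a γ r U t) x v =
      (inner ℝ (U t x) (fderiv ℝ (U t) x v) : ℝ)
        - enthalpyDeriv a γ (r t x) * fderiv ℝ (r t) x v := by
  have h1 := (hU.hasFDerivAt_slice hΩ ht hx).norm_sq.const_mul (1 / 2)
  have h2 := (hasDerivAt_enthalpy (a := a) hγ hpos).comp_hasFDerivAt x
    (hr.hasFDerivAt_slice hΩ ht hx)
  have h3 : HasFDerivAt (densityMultiplier a γ r U t) _ x := h1.sub h2
  rw [h3.fderiv]
  simp

/-- Balance of the isentropic pressure of the strong solution. -/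
theorem integral_pressure_balance (hr : IsC1 Ω T r) (hΩ : IsOpen Ω)
    (hb : Bornology.IsBounded Ω)
    (hpos : ∀ t ∈ Icc (0 : ℝ) T, ∀ x ∈ closure Ω, 0 < r t x)
    (hint : Integrable (fun z : ℝ × Eucl N => r z.1 z.2 * enthalpyDeriv a γ (r z.1 z.2) *
      deriv (fun s => r s z.2) z.1) (volume.restrict (cylinder Ω T))) {τ : ℝ} (hτ : τ ∈ Ioo 0 T) :
    (∫ x in Ω, a * r τ x ^ γ) - (∫ x in Ω, a * r 0 x ^ γ) =
      ∫ z in cylinder Ω τ, r z.1 z.2 * enthalpyDeriv a γ (r z.1 z.2) *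
        deriv (fun s => r s z.2) z.1 := by
  have := isFiniteMeasure_restrict_of_isBounded hb
  have hint' := hint.mono_measure (Measure.restrict_mono (cylinder_mono hτ.2.le) le_rfl)
  have hcont : ContinuousOn (fun z : ℝ × Eucl N => a * r z.1 z.2 ^ γ)
      (Icc 0 T ×ˢ closure Ω) := hr.comp_continuousOn (s := Ioi 0) (f := fun s => a * s ^ γ)
    (continuousOn_const.mul (continuousOn_id.rpow_const fun x (hx : 0 < x) => Or.inl hx.ne')) hpos
  obtain ⟨C, hC⟩ := (isCompact_closed_cylinder (T := T) hb).exists_bound_of_continuousOn hcont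
  have hslice : ∀ t ∈ Icc (0 : ℝ) T, IntegrableOn (fun x => a * r t x ^ γ) Ω := by
    intro t ht
    have h1 : ContinuousOn (fun x => a * r t x ^ γ) Ω :=
      hcont.comp (f := fun x => (t, x)) (by fun_prop) (fun _ hx => ⟨ht, subset_closure hx⟩)
    refine Integrable.mono' (integrable_const C) (h1.aestronglyMeasurable hΩ.measurableSet)
      ((ae_restrict_iff' hΩ.measurableSet).2 (ae_of_all _ fun x hx =>
        hC (t, x) ⟨ht, subset_closure hx⟩))
  rw [← integral_sub (hslice τ (Ioo_subset_Icc_self hτ)) (hslice 0 ⟨le_rfl, hτ.1.le.trans hτ.2.le⟩)]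
  rw [restrict_cylinder] at hint' ⊢
  -- With x as the outer variable the inner integrand is the time derivative of a r^γ, and the
  -- fundamental theorem of calculus applies for almost every x.
  rw [integral_prod_symm _ hint']
  refine integral_congr_ae ?_
  filter_upwards [hint'.prod_left_ae, ae_restrict_mem hΩ.measurableSet] with x hx hxΩ
  have hxc := subset_closure hxΩ
  have hsub : Icc 0 τ ⊆ Icc 0 T := Icc_subset_Icc_right hτ.2.le
  rw [← integral_Ioc_eq_integral_Ioo, ← intervalIntegral.integral_of_le hτ.1.le]
  symm
  refine intervalIntegral.integral_eq_sub_of_hasDerivAt_of_le hτ.1.le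
    (f := fun t => a * r t x ^ γ) ?_ (fun t ht => ?_) ?_
  · exact hcont.comp (f := fun t => (t, x)) (by fun_prop) (fun t ht => ⟨hsub ht, hxc⟩)
  · have ht' : t ∈ Ioo 0 T := ⟨ht.1, ht.2.trans hτ.2⟩
    exact HasDerivAt.comp (h₂ := fun s => a * s ^ γ) t
      (hasDerivAt_rpow_pressure (hpos t (Ioo_subset_Icc_self ht') x hxc))
      (hr.hasDerivAt hΩ ht' hxΩ)
  · rw [intervalIntegrable_iff_integrableOn_Ioo_of_le hτ.1.le]
    exact hx

/-- All coefficients built from the strong solution are bounded by one constant. -/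
theorem IsClassicalSolution.exists_bound_coefficients
    (hc : IsClassicalSolution Ω T μ lam a γ q r U) (hΩ : IsOpen Ω) (hb : Bornology.IsBounded Ω)
    (hq : IsTestOnPos q) (hpos : ∀ t ∈ Icc (0 : ℝ) T, ∀ x ∈ closure Ω, 0 < r t x) :
    ∃ K : ℝ, 0 ≤ K ∧ ∀ t ∈ Ioo 0 T, ∀ x ∈ Ω, r t x ≤ K ∧ ‖U t x‖ ≤ K ∧
      ‖deriv (fun s => U s x) t‖ ≤ K ∧ ‖fderiv ℝ (U t) x‖ ≤ K ∧ ‖fderiv ℝ (r t) x‖ ≤ K ∧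
      |enthalpyDeriv a γ (r t x)| ≤ K ∧ |q (r t x)| ≤ K ∧ |deriv q (r t x)| ≤ K := by
  obtain ⟨K₁, h1⟩ := exists_bound_of_continuousOn_closed_cylinder hb hc.density_C1.continuousOn
  obtain ⟨K₂, h2⟩ := exists_bound_of_continuousOn_closed_cylinder hb hc.velocity_C1.continuousOn
  obtain ⟨K₃, h3⟩ := hc.velocity_C1.exists_bound_deriv_time hΩ hb
  obtain ⟨K₄, h4⟩ := hc.velocity_C1.exists_bound_fderiv_space hΩ hb
  obtain ⟨K₅, h5⟩ := hc.density_C1.exists_bound_fderiv_space hΩ hb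
  obtain ⟨K₆, h6⟩ := exists_bound_of_continuousOn_closed_cylinder hb
    (hc.density_C1.comp_continuousOn (continuousOn_enthalpyDeriv (a := a) (γ := γ)) hpos)
  obtain ⟨K₇, h7⟩ := hq.1.continuous.bounded_above_of_compact_support hq.2.1
  obtain ⟨K₈, h8⟩ := (hq.1.continuous_deriv (by simp)).bounded_above_of_compact_support
    hq.2.1.deriv
  refine ⟨|K₁| + |K₂| + |K₃| + |K₄| + |K₅| + |K₆| + |K₇| + |K₈|, by positivity,
    fun t ht x hx => ?_⟩
  have e1 := le_abs_self K₁
  have e2 := le_abs_self K₂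
  have e3 := le_abs_self K₃
  have e4 := le_abs_self K₄
  have e5 := le_abs_self K₅
  have e6 := le_abs_self K₆
  have e7 := le_abs_self K₇
  have e8 := le_abs_self K₈
  have p1 := abs_nonneg K₁
  have p2 := abs_nonneg K₂
  have p3 := abs_nonneg K₃
  have p4 := abs_nonneg K₄
  have p5 := abs_nonneg K₅
  have p6 := abs_nonneg K₆
  have p7 := abs_nonneg K₇
  have p8 := abs_nonneg K₈
  have g1 := (le_abs_self (r t x)).trans (h1 t ht x hx)
  have g2 := h2 t ht x hx
  have g3 := h3 t ht x hx
  have g4 := h4 t ht x hx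
  have g5 := h5 t ht x hx
  have g6 := h6 t ht x hx
  have g7 := h7 (r t x)
  have g8 := h8 (r t x)
  simp only [Real.norm_eq_abs] at g6 g7 g8
  refine ⟨?_, ?_, ?_, ?_, ?_, ?_, ?_, ?_⟩ <;> linarith

end ClassicalSolutions

/-! ### The relative energy inequality -/

section RelativeEnergy

variable {N : ℕ} {Ω : Set (Eucl N)} {T μ lam a γ : ℝ} {q : ℝ → ℝ}
  {ρ : ℝ → Eucl N → ℝ} {u : ℝ → Eucl N → Eucl N} {Du : ℝ → Eucl N → (Eucl N →L[ℝ] Eucl N)}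
  {r : ℝ → Eucl N → ℝ} {U : ℝ → Eucl N → Eucl N}

/-- The relative energy density. -/
def relEnergy (a γ s : ℝ) (v : Eucl N) (r : ℝ) (V : Eucl N) : ℝ :=
  1 / 2 * s * ‖v - V‖ ^ 2 + relPotential a γ s r

/-- The remainder of the relative energy inequality. -/
def remainder (a γ : ℝ) (q : ℝ → ℝ) (ρ : ℝ → Eucl N → ℝ) (u : ℝ → Eucl N → Eucl N)
    (Du : ℝ → Eucl N → (Eucl N →L[ℝ] Eucl N)) (r : ℝ → Eucl N → ℝ) (U : ℝ → Eucl N → Eucl N)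
    (t : ℝ) (x : Eucl N) : ℝ :=
  -(ρ t x * (inner ℝ (u t x - U t x) (fderiv ℝ (U t) x (u t x - U t x)) : ℝ))
    - (ρ t x - r t x) *
      ((inner ℝ (u t x - U t x) (deriv (fun s => U s x) t + fderiv ℝ (U t) x (U t x)) : ℝ)
        + enthalpyDeriv a γ (r t x) * fderiv ℝ (r t) x (u t x - U t x))
    - (a * ρ t x ^ γ - a * r t x ^ γ
        - r t x * enthalpyDeriv a γ (r t x) * (ρ t x - r t x)) * tr (fderiv ℝ (U t) x)
    + (q (ρ t x) - q (r t x)) * tr (Du t x - fderiv ℝ (U t) x)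

/-- The dissipation of the velocity difference. -/
def relDissipation (μ lam : ℝ) (Du : ℝ → Eucl N → (Eucl N →L[ℝ] Eucl N))
    (U : ℝ → Eucl N → Eucl N) (t : ℝ) (x : Eucl N) : ℝ :=
  frob (stress μ lam (Du t x - fderiv ℝ (U t) x)) (Du t x - fderiv ℝ (U t) x)

/-- Pointwise algebra behind the relative energy inequality, with all derivatives replaced by free
variables: k stands for H'(r), ps and pr for the isentropic pressures, qs and qr for the values of
q, B and G for the two velocity gradients, g for ∇r. The left side collects the balances; on the
right the remainder and the dissipation of u - U appear together with three groups that integrate to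
zero over Ω. Only the continuity equation of [r, U] is used. -/
theorem remainder_identity (μ lam ps pr k s r qs qr q' rt : ℝ) (u U Ut : Eucl N)
    (B G : Eucl N →L[ℝ] Eucl N) (g : Eucl N →L[ℝ] ℝ) (hrt : rt = -(r * tr B) - g U) :
    -frob (stress μ lam G) G + qs * tr G
      - ((inner ℝ (s • u) Ut : ℝ) + frob (tensor (s • u) u) B + (ps + qs) * tr B)
      + frob (stress μ lam G) B
      + (s * ((inner ℝ U Ut : ℝ) - k * rt) + s * ((inner ℝ U (B u) : ℝ) - k * g u))
      + r * k * rt =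
    (-(s * (inner ℝ (u - U) (B (u - U)) : ℝ))
      - (s - r) * ((inner ℝ (u - U) (Ut + B U) : ℝ) + k * g (u - U))
      - (ps - pr - r * k * (s - r)) * tr B + (qs - qr) * tr (G - B)
      - frob (stress μ lam (G - B)) (G - B))
    - (r * (inner ℝ (u - U) (Ut + B U) : ℝ) + (r * k + q') * g (u - U)
        + frob (stress μ lam B) (G - B))
    - (r * k * g U + pr * tr B)
    + (q' * g (u - U) + qr * tr (G - B)) := by
  simp only [frob_tensor, stress_sub, frob_sub_left, frob_sub_right, tr_sub, map_sub,
    inner_sub_left, inner_sub_right, inner_add_right, inner_smul_left, conj_trivial]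
  rw [hrt]
  ring

theorem memLp_top_slice {F : Type*} [NormedAddCommGroup F]
    [SecondCountableTopologyEither (Eucl N) F] {f : Eucl N → F} (hΩ : IsOpen Ω)
    (hb : Bornology.IsBounded Ω) (hf : ContinuousOn f (closure Ω)) :
    MemLp f ∞ (volume.restrict Ω) := by
  obtain ⟨C, hC⟩ := hb.isCompact_closure.exists_bound_of_continuousOn hf
  exact memLp_top_of_bound
    ((hf.mono subset_closure).aestronglyMeasurable hΩ.measurableSet) C
    ((ae_restrict_iff' hΩ.measurableSet).2 (ae_of_all _ fun x hx => hC x (subset_closure hx)))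

/-- Besides expanding |u - U|², this uses r H(r) - Π(r) = a r^γ. Each summand on the right has a
balance law in the definition of the two solutions, which dictates the multiplier ½|U|² - H(r). -/
theorem relEnergy_eq (hγ : 1 < γ) {c : ℝ} {b : ℝ → ℝ}
    (hdec : ∀ s, pressurePotential a γ q s = potential a γ s + (c * s + b s))
    {t : ℝ} {x : Eucl N} (hr : 0 < r t x) :
    relEnergy a γ (ρ t x) (u t x) (r t x) (U t x) =
      energyDensity a γ q (ρ t x) (u t x) - (c * ρ t x + b (ρ t x))
      - (inner ℝ (ρ t x • u t x) (U t x) : ℝ) + ρ t x * densityMultiplier a γ r U t x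
      + a * r t x ^ γ := by
  rw [relEnergy, energyDensity, hdec, relPotential, densityMultiplier,
    ← mul_enthalpy_sub_potential hγ hr, norm_sub_sq_real, inner_smul_left]
  simp only [conj_trivial]
  ring

/-- The relative energy at one instant, split into the quantities that are balanced. -/
theorem integral_relEnergy_slice (hΩ : IsOpen Ω) (hb : Bornology.IsBounded Ω) (hγ : 1 < γ)
    {c : ℝ} {b : ℝ → ℝ}
    (hdec : ∀ s, pressurePotential a γ q s = potential a γ s + (c * s + b s))
    (hr : IsC1 Ω T r) (hU : IsC1 Ω T U)
    (hpos : ∀ t ∈ Icc (0 : ℝ) T, ∀ x ∈ closure Ω, 0 < r t x) {t : ℝ} (ht : t ∈ Icc 0 T)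
    (hρ : IntegrableOn (ρ t) Ω) (hm : IntegrableOn (fun x => ρ t x • u t x) Ω)
    (hcb : IntegrableOn (fun x => c * ρ t x + b (ρ t x)) Ω)
    (hE : IntegrableOn (fun x => energyDensity a γ q (ρ t x) (u t x)) Ω) :
    IntegrableOn (fun x => relEnergy a γ (ρ t x) (u t x) (r t x) (U t x)) Ω ∧
    ∫ x in Ω, relEnergy a γ (ρ t x) (u t x) (r t x) (U t x) =
      (∫ x in Ω, energyDensity a γ q (ρ t x) (u t x)) - (∫ x in Ω, (c * ρ t x + b (ρ t x)))
      - (∫ x in Ω, (inner ℝ (ρ t x • u t x) (U t x) : ℝ))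
      + (∫ x in Ω, ρ t x * densityMultiplier a γ r U t x) + ∫ x in Ω, a * r t x ^ γ := by
  have := isFiniteMeasure_restrict_of_isBounded hb
  have i3 : IntegrableOn (fun x => (inner ℝ (ρ t x • u t x) (U t x) : ℝ)) Ω := by
    refine (integrable_bilin_top (innerSL ℝ) (memLp_top_slice hΩ hb (hU.continuousOn_slice ht))
      hm).congr (ae_of_all _ fun x => ?_)
    exact real_inner_comm (ρ t x • u t x) (U t x)
  have i4 : IntegrableOn (fun x => ρ t x * densityMultiplier a γ r U t x) Ω := by
    refine (integrable_bilin_top (ContinuousLinearMap.mul ℝ ℝ) (memLp_top_slice hΩ hb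
      ((isC1_densityMultiplier (a := a) (γ := γ) hr hU hpos).continuousOn_slice ht)) hρ).congr
      (ae_of_all _ fun x => ?_)
    simp [mul_comm]
  have i5 : IntegrableOn (fun x => a * r t x ^ γ) Ω := by
    refine (memLp_top_slice hΩ hb ?_).integrable le_top
    exact continuousOn_const.mul ((hr.continuousOn_slice ht).rpow_const fun x hx =>
      Or.inl (hpos t ht x hx).ne')
  have heq : ∀ x ∈ Ω, relEnergy a γ (ρ t x) (u t x) (r t x) (U t x) =
      energyDensity a γ q (ρ t x) (u t x) - (c * ρ t x + b (ρ t x))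
      - (inner ℝ (ρ t x • u t x) (U t x) : ℝ) + ρ t x * densityMultiplier a γ r U t x
      + a * r t x ^ γ := fun x hx => relEnergy_eq hγ hdec (hpos t ht x (subset_closure hx))
  have j2 := Integrable.sub hE hcb
  have j3 := j2.sub i3
  have j4 := j3.add i4
  refine ⟨(j4.add i5).congr ((ae_restrict_iff' hΩ.measurableSet).2
    (ae_of_all _ fun x hx => (heq x hx).symm)), ?_⟩
  rw [setIntegral_congr_fun hΩ.measurableSet heq]
  exact (integral_add j4 i5).trans (congrArg (· + _) ((integral_add j3 i4).trans
    (congrArg (· + _) ((integral_sub j2 i3).trans (congrArg (· - _) (integral_sub hE hcb))))))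

theorem IsC1.integral_div (hf : IsC1 Ω T r) (hΩ : IsOpen Ω) (hb : Bornology.IsBounded Ω) {t : ℝ}
    (ht : t ∈ Ioo 0 T) {v : Eucl N → Eucl N} {G : Eucl N → (Eucl N →L[ℝ] Eucl N)}
    (h : MemH10 Ω v G) :
    ∫ x in Ω, (fderiv ℝ (r t) x (v x) + r t x * tr (G x)) = 0 := by
  obtain ⟨C, hC⟩ := hf.exists_bound hb
  obtain ⟨C', hC'⟩ := hf.exists_bound_fderiv_space hΩ hb
  have ht' := Ioo_subset_Icc_self ht
  exact h.integral_div hΩ hb ((hf.contDiffOn_slice ht').mono subset_closure)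
    (fun x hx => hC t ht' x (subset_closure hx)) (fun x hx => hC' t ht x hx)

theorem IsClassicalSolution.memH10_velocity (hc : IsClassicalSolution Ω T μ lam a γ q r U)
    (hΩ : IsOpen Ω) (hb : Bornology.IsBounded Ω) {t : ℝ} (ht : t ∈ Ioo 0 T) :
    MemH10 Ω (U t) (fderiv ℝ (U t)) := by
  obtain ⟨C, hC⟩ := hc.velocity_C1.exists_bound_fderiv_space hΩ hb
  exact memH10_of_vanishing hΩ hb (hc.velocity_C2 t ht)
    (hc.velocity_C1.continuousOn_slice (Ioo_subset_Icc_self ht))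
    (hc.no_slip t (Ioo_subset_Icc_self ht)) (hC t ht)

/-- The strong momentum equation multiplied by v, with the stress divergence integrated by parts. It
will be applied to v = u - U. -/
theorem IsClassicalSolution.integral_stress (hc : IsClassicalSolution Ω T μ lam a γ q r U)
    (hΩ : IsOpen Ω) (hb : Bornology.IsBounded Ω) (hq : IsTestOnPos q)
    (hpos : ∀ t ∈ Icc (0 : ℝ) T, ∀ x ∈ closure Ω, 0 < r t x) {t : ℝ}
    (ht : t ∈ Ioo 0 T) {v : Eucl N → Eucl N} {G : Eucl N → (Eucl N →L[ℝ] Eucl N)}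
    (h : MemH10 Ω v G) :
    ∫ x in Ω, (r t x * (inner ℝ (v x)
        (deriv (fun s => U s x) t + fderiv ℝ (U t) x (U t x)) : ℝ)
      + (r t x * enthalpyDeriv a γ (r t x) + deriv q (r t x)) * fderiv ℝ (r t) x (v x)
      + frob (stress μ lam (fderiv ℝ (U t) x)) (G x)) = 0 := by
  obtain ⟨K, hK, hKb⟩ := hc.exists_bound_coefficients hΩ hb hq hpos
  have ht' := Ioo_subset_Icc_self ht
  have hid := fun x (hx : x ∈ Ω) => hc.inner_tensorDiv_stress hΩ hq ht hx
    (hpos t ht' x (subset_closure hx))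
  have hM : ContDiffOn ℝ 1 (fun y => stress μ lam (fderiv ℝ (U t) y)) Ω :=
    (stressL N μ lam).contDiff.comp_contDiffOn
      ((hc.velocity_C2 t ht).fderiv_of_isOpen hΩ (by norm_num))
  have h0 := h.integral_tensorDiv hΩ hb hM (C := ‖stressL N μ lam‖ * K)
    (fun x hx => ((stressL N μ lam).le_opNorm _).trans
      (mul_le_mul_of_nonneg_left (hKb t ht x hx).2.2.2.1 (norm_nonneg _)))
    -- Second derivatives of U may be unbounded near the boundary, so the bound on D = div S(∇U)
    -- comes from the momentum equation: tested with D itself, it gives |D|² ≤ C'|D|.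
    (C' := K * (K + K * K) + (K * K + K) * K) (fun x hx => by
      obtain ⟨k1, k2, k3, k4, k5, k6, k7, k8⟩ := hKb t ht x hx
      have hr0 := (hpos t ht' x (subset_closure hx)).le
      set D := tensorDiv (fun y => stress μ lam (fderiv ℝ (U t) y)) x with hD
      by_contra hlt
      push Not at hlt
      have hDpos : 0 < ‖D‖ := lt_of_le_of_lt (by positivity) hlt
      have h1 := hid x hx D
      rw [← hD, real_inner_self_eq_norm_sq] at h1
      have h2 : (inner ℝ (deriv (fun s => U s x) t + fderiv ℝ (U t) x (U t x)) D : ℝ)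
          ≤ (K + K * K) * ‖D‖ := by
        refine (real_inner_le_norm _ _).trans (mul_le_mul_of_nonneg_right ?_ (norm_nonneg _))
        refine (norm_add_le _ _).trans (add_le_add k3 ?_)
        exact ((fderiv ℝ (U t) x).le_opNorm _).trans (mul_le_mul k4 k2 (norm_nonneg _) hK)
      have h3 : r t x * (inner ℝ (deriv (fun s => U s x) t + fderiv ℝ (U t) x (U t x)) D : ℝ)
          ≤ K * ((K + K * K) * ‖D‖) :=
        (mul_le_mul_of_nonneg_left h2 hr0).trans (mul_le_mul_of_nonneg_right k1 (by positivity))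
      have h4 : (r t x * enthalpyDeriv a γ (r t x) + deriv q (r t x)) * fderiv ℝ (r t) x D
          ≤ (K * K + K) * (K * ‖D‖) := by
        refine (le_abs_self _).trans ?_
        rw [abs_mul]
        refine mul_le_mul ((abs_add_le _ _).trans (add_le_add ?_ k8)) ?_ (abs_nonneg _)
          (by positivity)
        · rw [abs_mul, abs_of_nonneg hr0]
          exact mul_le_mul k1 k6 (abs_nonneg _) hK
        · exact ((fderiv ℝ (r t) x).le_opNorm _).trans
            (mul_le_mul_of_nonneg_right k5 (norm_nonneg _))
      nlinarith)
  rw [← h0]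
  refine setIntegral_congr_fun hΩ.measurableSet fun x hx => ?_
  rw [hid x hx (v x), real_inner_comm (v x)]

/-- The relative energy inequality between a dissipative weak solution and a classical solution
with positive density and the same initial data. -/
theorem relative_energy_inequality (hΩ : IsOpen Ω) (hb : Bornology.IsBounded Ω) (hT : 0 < T)
    (ha : 0 < a) (hγ : 1 < γ) (hq : IsTestOnPos q)
    (hint : ∀ t ∈ Icc (0 : ℝ) T, IntegrableOn (ρ t) Ω ∧ IntegrableOn (fun x => ρ t x • u t x) Ω)
    (hnn : ∀ t ∈ Icc (0 : ℝ) T, ∀ᵐ x ∂(volume.restrict Ω), 0 ≤ ρ t x)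
    (hρ : MemLinftyLp Ω T γ ρ) (hu : MemL2W012 Ω T u Du)
    (hC : WeakContinuity Ω T ρ u) (hM : WeakMomentum Ω T μ lam a γ q ρ u Du)
    (hR : RenormalizedContinuity Ω T ρ u Du) (hE : EnergyInequality Ω T μ lam a γ q ρ u Du)
    (hc : IsClassicalSolution Ω T μ lam a γ q r U)
    (hpos : ∀ t ∈ Icc (0 : ℝ) T, ∀ x ∈ closure Ω, 0 < r t x)
    (hρ0 : ∀ᵐ x ∂(volume.restrict Ω), ρ 0 x = r 0 x)
    (hm0 : ∀ᵐ x ∂(volume.restrict Ω), ρ 0 x • u 0 x = r 0 x • U 0 x) :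
    Integrable (fun z : ℝ × Eucl N => remainder a γ q ρ u Du r U z.1 z.2
      - relDissipation μ lam Du U z.1 z.2) (volume.restrict (cylinder Ω T)) ∧
    ∀ᵐ τ ∂(volume.restrict (Ioo 0 T)),
      IntegrableOn (fun x => relEnergy a γ (ρ τ x) (u τ x) (r τ x) (U τ x)) Ω ∧
      ∫ x in Ω, relEnergy a γ (ρ τ x) (u τ x) (r τ x) (U τ x) ≤
        ∫ z in cylinder Ω τ, (remainder a γ q ρ u Du r U z.1 z.2
          - relDissipation μ lam Du U z.1 z.2) := by
  have := isFiniteMeasure_restrict_of_isBounded hb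
  have := isFiniteMeasure_restrict_cylinder (T := T) hb
  have hcm : MeasurableSet (cylinder Ω T) := (isOpen_cylinder hΩ).measurableSet
  have hr1 := hc.density_C1
  have hU1 := hc.velocity_C1
  obtain ⟨c, b, hbc, hbR, hbK, hdec, hbq⟩ := exists_pressurePotential_decomposition a γ hq
  obtain ⟨hcb, hbal⟩ := renormalized_balance (c := c) hbc hbR hbK hbq hb hT hnn
    (fun t ht => (hint t ht).1) hC hR
  set ν := (volume : Measure (ℝ × Eucl N)).restrict (cylinder Ω T) with hν
  -- the coefficients
  set Φ := densityMultiplier a γ r U with hΦ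
  have hΦ1 : IsC1 Ω T Φ := isC1_densityMultiplier hr1 hU1 hpos
  set P : ℝ → Eucl N → ℝ := fun t x => a * r t x ^ γ with hP
  have hP1 : IsC1 Ω T P := hr1.comp_of_contDiffOn (f := fun s => a * s ^ γ) (s := Ioi 0)
    (contDiffOn_const.mul (contDiffOn_id.rpow_const_of_ne fun x (hx : 0 < x) => hx.ne')) hpos
  set Q : ℝ → Eucl N → ℝ := fun t x => q (r t x) with hQ
  have hQ1 : IsC1 Ω T Q := hr1.comp_of_contDiffOn (f := q) (s := univ)
    (contDiff_infty.1 hq.1 1).contDiffOn (fun _ _ _ _ => mem_univ _)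
  have mr := hr1.memLp_top hΩ hb
  have mU := hU1.memLp_top hΩ hb
  have mUt := hU1.memLp_top_deriv_time hΩ hb
  have mB := hU1.memLp_top_fderiv_space hΩ hb
  have mtrB : MemLp (fun z : ℝ × Eucl N => tr (fderiv ℝ (U z.1) z.2)) ∞ ν :=
    (trL N).comp_memLp' mB
  -- integrability of the weak solution
  have hρnn : ∀ᵐ z ∂ν, 0 ≤ ρ z.1 z.2 := ae_cylinder_nonneg hρ.1 (by
    filter_upwards [ae_restrict_mem measurableSet_Ioo] with t ht
    exact hnn t (Ioo_subset_Icc_self ht))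
  have iρ : Integrable (fun z : ℝ × Eucl N => ρ z.1 z.2) ν := integrable_density hb hγ hρ
  have iργ : Integrable (fun z : ℝ × Eucl N => ρ z.1 z.2 ^ γ) ν := by
    refine (integrable_rpow_density hγ hρ).congr ?_
    filter_upwards [hρnn] with z hz
    rw [abs_of_nonneg hz]
  have ikin : Integrable (fun z : ℝ × Eucl N => ρ z.1 z.2 * ‖u z.1 z.2‖ ^ 2) ν :=
    integrable_kinetic hb ha hγ hq hnn (fun t ht => (hint t ht).1) hρ hu hE
  have im : Integrable (fun z : ℝ × Eucl N => ρ z.1 z.2 • u z.1 z.2) ν :=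
    integrable_momentum hρ.1 hu.1.1 hρnn iρ ikin
  obtain ⟨Kq, hKq⟩ := hq.1.continuous.bounded_above_of_compact_support hq.2.1
  have mqρ : MemLp (fun z : ℝ × Eucl N => q (ρ z.1 z.2)) ∞ ν :=
    memLp_top_of_bound (hq.1.continuous.comp_aestronglyMeasurable hρ.1) Kq
      (ae_of_all _ fun z => hKq _)
  have mDu : MemLp (fun z : ℝ × Eucl N => Du z.1 z.2) 2 ν := hu.2.1
  have iDu : Integrable (fun z : ℝ × Eucl N => Du z.1 z.2) ν := mDu.integrable (by norm_num)
  have itrDu : Integrable (fun z : ℝ × Eucl N => tr (Du z.1 z.2)) ν := (trL N).integrable_comp iDu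
  have iu : Integrable (fun z : ℝ × Eucl N => u z.1 z.2) ν := hu.1.integrable (by norm_num)
  have iU : Integrable (fun z : ℝ × Eucl N => U z.1 z.2) ν := mU.integrable le_top
  have iB : Integrable (fun z : ℝ × Eucl N => fderiv ℝ (U z.1) z.2) ν := mB.integrable le_top
  have iw : Integrable (fun z : ℝ × Eucl N => u z.1 z.2 - U z.1 z.2) ν := iu.sub iU
  have iΓ : Integrable (fun z : ℝ × Eucl N => Du z.1 z.2 - fderiv ℝ (U z.1) z.2) ν := iDu.sub iB
  have itrΓ : Integrable (fun z : ℝ × Eucl N => tr (Du z.1 z.2 - fderiv ℝ (U z.1) z.2)) ν :=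
    (trL N).integrable_comp iΓ
  -- the integrands of the weak formulation
  set F₁ : ℝ → Eucl N → ℝ := fun t x =>
    ρ t x * deriv (fun s => Φ s x) t + ρ t x * fderiv ℝ (Φ t) x (u t x) with hF₁
  set F₂ : ℝ → Eucl N → ℝ := fun t x =>
    (inner ℝ (ρ t x • u t x) (deriv (fun s => U s x) t) : ℝ)
      + frob (tensor (ρ t x • u t x) (u t x)) (fderiv ℝ (U t) x)
      + pressure a γ q (ρ t x) * tr (fderiv ℝ (U t) x) with hF₂
  set F₃ : ℝ → Eucl N → ℝ := fun t x =>
    frob (stress μ lam (Du t x)) (fderiv ℝ (U t) x) with hF₃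
  set F₄ : ℝ → Eucl N → ℝ := fun t x =>
    r t x * enthalpyDeriv a γ (r t x) * deriv (fun s => r s x) t with hF₄
  set F₅ : ℝ → Eucl N → ℝ := fun t x => q (ρ t x) * tr (Du t x) with hF₅
  set F₆ : ℝ → Eucl N → ℝ := fun t x => frob (stress μ lam (Du t x)) (Du t x) with hF₆
  have i₁ : Integrable (fun z : ℝ × Eucl N => F₁ z.1 z.2) ν := by
    refine ((integrable_bilin_top (ContinuousLinearMap.mul ℝ ℝ)
      (hΦ1.memLp_top_deriv_time hΩ hb) iρ).add (integrable_bilin_top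
      (ContinuousLinearMap.id ℝ (Eucl N →L[ℝ] ℝ)) (hΦ1.memLp_top_fderiv_space hΩ hb) im)).congr
      (ae_of_all _ fun z => ?_)
    simp [hF₁, mul_comm]
  have i₂ : Integrable (fun z : ℝ × Eucl N => F₂ z.1 z.2) ν := by
    have e1 : Integrable (fun z : ℝ × Eucl N =>
        (inner ℝ (ρ z.1 z.2 • u z.1 z.2) (deriv (fun s => U s z.2) z.1) : ℝ)) ν := by
      refine (integrable_bilin_top (innerSL ℝ) mUt im).congr (ae_of_all _ fun z => ?_)
      exact real_inner_comm (ρ z.1 z.2 • u z.1 z.2) (deriv (fun s => U s z.2) z.1)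
    have e2 : Integrable (fun z : ℝ × Eucl N =>
        frob (tensor (ρ z.1 z.2 • u z.1 z.2) (u z.1 z.2)) (fderiv ℝ (U z.1) z.2)) ν := by
      obtain ⟨K, hK⟩ := hU1.exists_bound_fderiv_space hΩ hb
      have hmeas : AEStronglyMeasurable (fun z : ℝ × Eucl N =>
          frob (tensor (ρ z.1 z.2 • u z.1 z.2) (u z.1 z.2)) (fderiv ℝ (U z.1) z.2)) ν :=
        (frobL N).aestronglyMeasurable_comp₂
          ((tensorL N).aestronglyMeasurable_comp₂ im.1 hu.1.1) mB.1
      refine Integrable.mono' (ikin.const_mul K) hmeas ?_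
      filter_upwards [hρnn, ae_restrict_mem hcm] with z hz hzc
      rw [frob_tensor, inner_smul_left, conj_trivial, norm_mul, Real.norm_of_nonneg hz]
      have h1 : ‖(inner ℝ (u z.1 z.2) (fderiv ℝ (U z.1) z.2 (u z.1 z.2)) : ℝ)‖ ≤
          ‖u z.1 z.2‖ * (K * ‖u z.1 z.2‖) := by
        refine (norm_inner_le_norm _ _).trans (mul_le_mul_of_nonneg_left ?_ (norm_nonneg _))
        exact ((fderiv ℝ (U z.1) z.2).le_opNorm _).trans
          (mul_le_mul_of_nonneg_right (hK z.1 hzc.1 z.2 hzc.2) (norm_nonneg _))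
      calc ρ z.1 z.2 * _ ≤ ρ z.1 z.2 * (‖u z.1 z.2‖ * (K * ‖u z.1 z.2‖)) :=
            mul_le_mul_of_nonneg_left h1 hz
        _ = K * (ρ z.1 z.2 * ‖u z.1 z.2‖ ^ 2) := by ring
    have e3 : Integrable (fun z : ℝ × Eucl N =>
        pressure a γ q (ρ z.1 z.2) * tr (fderiv ℝ (U z.1) z.2)) ν := by
      refine (integrable_bilin_top (ContinuousLinearMap.mul ℝ ℝ) mtrB
        ((iργ.const_mul a).add (mqρ.integrable le_top))).congr (ae_of_all _ fun z => ?_)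
      simp [pressure, mul_comm]
    exact (e1.add e2).add e3
  have i₃ : Integrable (fun z : ℝ × Eucl N => F₃ z.1 z.2) ν :=
    integrable_bilin_two ((frobL N).comp (stressL N μ lam)) mDu (mB.mono_exponent le_top)
  have hcyl : ∀ {z : ℝ × Eucl N}, z ∈ cylinder Ω T → 0 < r z.1 z.2 := fun hz =>
    hpos _ (Ioo_subset_Icc_self hz.1) _ (subset_closure hz.2)
  have i₄ : Integrable (fun z : ℝ × Eucl N => F₄ z.1 z.2) ν := by
    refine ((hP1.memLp_top_deriv_time hΩ hb).integrable le_top).congr ?_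
    filter_upwards [ae_restrict_mem hcm] with z hz
    exact (HasDerivAt.comp (h₂ := fun s => a * s ^ γ) z.1 (hasDerivAt_rpow_pressure (hcyl hz))
      (hr1.hasDerivAt hΩ hz.1 hz.2)).deriv
  have i₅ : Integrable (fun z : ℝ × Eucl N => F₅ z.1 z.2) ν :=
    integrable_bilin_top (ContinuousLinearMap.mul ℝ ℝ) mqρ itrDu
  have i₆ : Integrable (fun z : ℝ × Eucl N => F₆ z.1 z.2) ν :=
    integrable_bilin_two ((frobL N).comp (stressL N μ lam)) mDu mDu
  have iJ : Integrable (fun z : ℝ × Eucl N => -F₆ z.1 z.2 + F₅ z.1 z.2 - F₂ z.1 z.2 + F₃ z.1 z.2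
      + F₁ z.1 z.2 + F₄ z.1 z.2) ν :=
    ((((i₆.neg.add i₅).sub i₂).add i₃).add i₁).add i₄
  -- the terms that vanish by integration by parts
  set Z₁ : ℝ → Eucl N → ℝ := fun t x =>
    r t x * (inner ℝ (u t x - U t x)
        (deriv (fun s => U s x) t + fderiv ℝ (U t) x (U t x)) : ℝ)
      + (r t x * enthalpyDeriv a γ (r t x) + deriv q (r t x)) * fderiv ℝ (r t) x (u t x - U t x)
      + frob (stress μ lam (fderiv ℝ (U t) x)) (Du t x - fderiv ℝ (U t) x) with hZ₁
  set Z₂ : ℝ → Eucl N → ℝ := fun t x =>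
    fderiv ℝ (P t) x (U t x) + P t x * tr (fderiv ℝ (U t) x) with hZ₂
  set Z₃ : ℝ → Eucl N → ℝ := fun t x =>
    fderiv ℝ (Q t) x (u t x - U t x) + Q t x * tr (Du t x - fderiv ℝ (U t) x) with hZ₃
  have hPd : ∀ z ∈ cylinder Ω T, ∀ v, fderiv ℝ (P z.1) z.2 v =
      r z.1 z.2 * enthalpyDeriv a γ (r z.1 z.2) * fderiv ℝ (r z.1) z.2 v := by
    intro z hz v
    have h : HasFDerivAt (P z.1) _ z.2 :=
      HasDerivAt.comp_hasFDerivAt (h₂ := fun s => a * s ^ γ) z.2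
        (hasDerivAt_rpow_pressure (hcyl hz)) (hr1.hasFDerivAt_slice hΩ hz.1 hz.2)
    rw [h.fderiv]
    simp
  have hQd : ∀ z ∈ cylinder Ω T, ∀ v, fderiv ℝ (Q z.1) z.2 v =
      deriv q (r z.1 z.2) * fderiv ℝ (r z.1) z.2 v := by
    intro z hz v
    have h : HasFDerivAt (Q z.1) _ z.2 :=
      HasDerivAt.comp_hasFDerivAt (h₂ := q) z.2
        (hq.1.differentiable (by simp) _).hasDerivAt (hr1.hasFDerivAt_slice hΩ hz.1 hz.2)
    rw [h.fderiv]
    simp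
  have idiv : ∀ {f : ℝ → Eucl N → ℝ} (_ : IsC1 Ω T f) {v : ℝ × Eucl N → Eucl N}
      {G : ℝ × Eucl N → ℝ}, Integrable v ν → Integrable G ν →
      Integrable (fun z => fderiv ℝ (f z.1) z.2 (v z) + f z.1 z.2 * G z) ν := fun hf _ _ hv hG =>
    (integrable_bilin_top (ContinuousLinearMap.id ℝ (Eucl N →L[ℝ] ℝ))
      (hf.memLp_top_fderiv_space hΩ hb) hv).add
      (integrable_bilin_top (ContinuousLinearMap.mul ℝ ℝ) (hf.memLp_top hΩ hb) hG)
  have k₂ : Integrable (fun z : ℝ × Eucl N => Z₂ z.1 z.2) ν :=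
    idiv hP1 iU ((trL N).integrable_comp iB)
  have k₃ : Integrable (fun z : ℝ × Eucl N => Z₃ z.1 z.2) ν := idiv hQ1 iw itrΓ
  have k₁ : Integrable (fun z : ℝ × Eucl N => Z₁ z.1 z.2) ν := by
    have mBU : MemLp (fun z : ℝ × Eucl N => fderiv ℝ (U z.1) z.2 (U z.1 z.2)) ∞ ν :=
      (ContinuousLinearMap.id ℝ (Eucl N →L[ℝ] Eucl N)).memLp_of_bilin ∞ mB mU
    have e1 := integrable_bilin_top (ContinuousLinearMap.mul ℝ ℝ) mr
      (integrable_bilin_top (innerSL ℝ) (mUt.add mBU) iw)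
    have e2 := (integrable_bilin_top (ContinuousLinearMap.id ℝ (Eucl N →L[ℝ] ℝ))
      (hP1.memLp_top_fderiv_space hΩ hb) iw).add (integrable_bilin_top
      (ContinuousLinearMap.id ℝ (Eucl N →L[ℝ] ℝ)) (hQ1.memLp_top_fderiv_space hΩ hb) iw)
    have e3 := integrable_bilin_top ((frobL N).comp (stressL N μ lam)) mB iΓ
    refine ((e1.add e2).add e3).congr ?_
    filter_upwards [ae_restrict_mem hcm] with z hz
    have e : ∀ v w : Eucl N, innerSL ℝ v w = (inner ℝ w v : ℝ) := fun v w => real_inner_comm w v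
    simp only [Pi.add_apply, ContinuousLinearMap.mul_apply', e,
      ContinuousLinearMap.id_apply, ContinuousLinearMap.comp_apply, frobL_apply, stressL_apply,
      hPd z hz, hQd z hz, hZ₁]
    ring
  have hw0 : ∀ᵐ t ∂(volume.restrict (Ioo 0 T)), MemH10 Ω (fun x => u t x - U t x)
      (fun x => Du t x - fderiv ℝ (U t) x) := by
    filter_upwards [hu.2.2, ae_restrict_mem measurableSet_Ioo] with t h1 h2
    exact h1.memH10.sub (hc.memH10_velocity hΩ hb h2)
  -- The first integral is the strong momentum equation tested with u - U. The other two are the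
  -- divergences of a r^γ U and of q(r)(u - U), whose fields vanish on the boundary in the
  -- generalized sense.
  have hZ₁0 : ∀ᵐ t ∂(volume.restrict (Ioo 0 T)), ∫ x in Ω, Z₁ t x = 0 := by
    filter_upwards [hw0, ae_restrict_mem measurableSet_Ioo] with t h1 h2
    exact hc.integral_stress hΩ hb hq hpos h2 h1
  have hZ₂0 : ∀ᵐ t ∂(volume.restrict (Ioo 0 T)), ∫ x in Ω, Z₂ t x = 0 := by
    filter_upwards [ae_restrict_mem measurableSet_Ioo] with t h2
    exact hP1.integral_div hΩ hb h2 (hc.memH10_velocity hΩ hb h2)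
  have hZ₃0 : ∀ᵐ t ∂(volume.restrict (Ioo 0 T)), ∫ x in Ω, Z₃ t x = 0 := by
    filter_upwards [hw0, ae_restrict_mem measurableSet_Ioo] with t h1 h2
    exact hQ1.integral_div hΩ hb h2 h1
  -- the pointwise identity
  have hpt : ∀ z ∈ cylinder Ω T, -F₆ z.1 z.2 + F₅ z.1 z.2 - F₂ z.1 z.2 + F₃ z.1 z.2
      + F₁ z.1 z.2 + F₄ z.1 z.2 + Z₁ z.1 z.2 + Z₂ z.1 z.2 - Z₃ z.1 z.2 =
      remainder a γ q ρ u Du r U z.1 z.2 - relDissipation μ lam Du U z.1 z.2 := by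
    intro z hz
    have h := remainder_identity μ lam (a * ρ z.1 z.2 ^ γ) (a * r z.1 z.2 ^ γ)
      (enthalpyDeriv a γ (r z.1 z.2)) (ρ z.1 z.2) (r z.1 z.2) (q (ρ z.1 z.2)) (q (r z.1 z.2))
      (deriv q (r z.1 z.2)) (deriv (fun s => r s z.2) z.1) (u z.1 z.2) (U z.1 z.2)
      (deriv (fun s => U s z.2) z.1) (fderiv ℝ (U z.1) z.2) (Du z.1 z.2) (fderiv ℝ (r z.1) z.2)
      (hc.deriv_density hΩ hz.1 hz.2)
    simp only [hF₁, hF₂, hF₃, hF₄, hF₅, hF₆, hZ₁, hZ₂, hZ₃, hPd z hz, hQd z hz, hΦ,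
      deriv_densityMultiplier hγ hr1 hU1 hΩ hz.1 hz.2 (hcyl hz),
      fderiv_densityMultiplier hγ hr1 hU1 hΩ hz.1 hz.2 (hcyl hz), remainder, relDissipation,
      pressure]
    simp only [hP, hQ]
    linear_combination h
  have iJZ := ((iJ.add k₁).add k₂).sub k₃
  have hpt' := (ae_restrict_iff' hcm).2 (ae_of_all (volume : Measure (ℝ × Eucl N)) hpt)
  refine ⟨iJZ.congr hpt', ?_⟩
  have h0T : (0 : ℝ) ∈ Icc 0 T := ⟨le_rfl, hT.le⟩
  -- Only the initial momenta are assumed to agree; positivity of r(0) turns this into equality of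
  -- the velocities.
  have hX0 : ∫ x in Ω, relEnergy a γ (ρ 0 x) (u 0 x) (r 0 x) (U 0 x) = 0 := by
    refine integral_eq_zero_of_ae ?_
    filter_upwards [hρ0, hm0, ae_restrict_mem hΩ.measurableSet] with x h1 h2 hx
    rw [h1] at h2
    have h3 : u 0 x = U 0 x :=
      smul_right_injective _ (hpos 0 h0T x (subset_closure hx)).ne' h2
    simp [relEnergy, relPotential, h1, h3]
  have hs0 := (integral_relEnergy_slice hΩ hb hγ hdec hr1 hU1 hpos h0T (hint 0 h0T).1
    (hint 0 h0T).2 (hcb 0 h0T) hE.1).2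
  rw [hX0] at hs0
  filter_upwards [hE.2, ae_restrict_mem measurableSet_Ioo] with τ hEτ hτ
  have hτ' := Ioo_subset_Icc_self hτ
  obtain ⟨hiτ, hsτ⟩ := integral_relEnergy_slice hΩ hb hγ hdec hr1 hU1 hpos hτ' (hint τ hτ').1
    (hint τ hτ').2 (hcb τ hτ') hEτ.1
  refine ⟨hiτ, ?_⟩
  have hsub : (volume : Measure (ℝ × Eucl N)).restrict (cylinder Ω τ) ≤ ν :=
    Measure.restrict_mono (cylinder_mono hτ.2.le) le_rfl
  -- One balance for each of the five parts of the relative energy. All are identities except the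
  -- energy inequality `w5`.
  have w1 := hC Φ hΦ1 τ hτ'
  have w2 := hM U hU1 hc.no_slip τ hτ'
  have w3 := hbal τ hτ'
  have w4 := integral_pressure_balance (a := a) (γ := γ) hr1 hΩ hb hpos i₄ hτ
  have w5 := hEτ.2
  rw [intervalIntegral_eq_integral_cylinder hτ.1.le hτ.2.le i₁] at w1
  rw [intervalIntegral_eq_integral_cylinder hτ.1.le hτ.2.le i₂,
    intervalIntegral_eq_integral_cylinder hτ.1.le hτ.2.le i₃] at w2
  rw [intervalIntegral_eq_integral_cylinder hτ.1.le hτ.2.le i₅] at w3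
  rw [intervalIntegral_eq_integral_cylinder hτ.1.le hτ.2.le i₆] at w5
  have hJ : ∫ z in cylinder Ω τ, (-F₆ z.1 z.2 + F₅ z.1 z.2 - F₂ z.1 z.2 + F₃ z.1 z.2
      + F₁ z.1 z.2 + F₄ z.1 z.2) =
      -(∫ z in cylinder Ω τ, F₆ z.1 z.2) + (∫ z in cylinder Ω τ, F₅ z.1 z.2)
      - (∫ z in cylinder Ω τ, F₂ z.1 z.2) + (∫ z in cylinder Ω τ, F₃ z.1 z.2)
      + (∫ z in cylinder Ω τ, F₁ z.1 z.2) + ∫ z in cylinder Ω τ, F₄ z.1 z.2 := by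
    have j₁ := i₁.mono_measure hsub
    have j₂ := i₂.mono_measure hsub
    have j₃ := i₃.mono_measure hsub
    have j₄ := i₄.mono_measure hsub
    have j₅ := i₅.mono_measure hsub
    have j₆ := i₆.mono_measure hsub
    have s1 := j₆.neg.add j₅
    have s2 := s1.sub j₂
    have s3 := s2.add j₃
    have s4 := s3.add j₁
    refine (integral_add s4 j₄).trans (congrArg (· + _) ?_)
    refine (integral_add s3 j₁).trans (congrArg (· + _) ?_)
    refine (integral_add s2 j₃).trans (congrArg (· + _) ?_)
    refine (integral_sub s1 j₂).trans (congrArg (· - _) ?_)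
    refine (integral_add j₆.neg j₅).trans (congrArg (· + _) ?_)
    exact integral_neg _
  have hJR : ∫ z in cylinder Ω τ, (remainder a γ q ρ u Du r U z.1 z.2
      - relDissipation μ lam Du U z.1 z.2) =
      ∫ z in cylinder Ω τ, (-F₆ z.1 z.2 + F₅ z.1 z.2 - F₂ z.1 z.2 + F₃ z.1 z.2
      + F₁ z.1 z.2 + F₄ z.1 z.2) := by
    have l0 := iJ.mono_measure hsub
    have l1 := k₁.mono_measure hsub
    have l2 := k₂.mono_measure hsub
    have l3 := k₃.mono_measure hsub
    have hae : ∀ᵐ z ∂(volume.restrict (cylinder Ω τ)), -F₆ z.1 z.2 + F₅ z.1 z.2 - F₂ z.1 z.2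
        + F₃ z.1 z.2 + F₁ z.1 z.2 + F₄ z.1 z.2 + Z₁ z.1 z.2 + Z₂ z.1 z.2 - Z₃ z.1 z.2 =
        remainder a γ q ρ u Du r U z.1 z.2 - relDissipation μ lam Du U z.1 z.2 :=
      ae_mono hsub hpt'
    rw [← integral_congr_ae hae]
    refine (integral_sub ((l0.add l1).add l2) l3).trans ?_
    rw [integral_cylinder_eq_zero hτ.1.le hτ.2.le k₃ hZ₃0, sub_zero]
    refine (integral_add (l0.add l1) l2).trans ?_
    rw [integral_cylinder_eq_zero hτ.1.le hτ.2.le k₂ hZ₂0, add_zero]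
    refine (integral_add l0 l1).trans ?_
    rw [integral_cylinder_eq_zero hτ.1.le hτ.2.le k₁ hZ₁0, add_zero]
  rw [hJR, hJ, hsτ]
  linarith

end RelativeEnergy

/-! ### Gronwall and conclusion -/

section Uniqueness

/-- Gronwall's inequality for an integrable function that is dominated by its primitive almost
everywhere. -/
theorem integral_nonpos_of_ae_le_mul_integral {X : ℝ → ℝ} {T C : ℝ} (hT : 0 < T)
    (hX : IntegrableOn X (Ioo 0 T)) (h0 : ∀ᵐ t ∂(volume.restrict (Ioo 0 T)), 0 ≤ X t)
    (h : ∀ᵐ τ ∂(volume.restrict (Ioo 0 T)), X τ ≤ C * ∫ t in (0 : ℝ)..τ, X t) :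
    ∫ t in (0 : ℝ)..T, X t ≤ 0 := by
  set I := (Ioo 0 T).indicator X with hI
  have iI : Integrable I := (integrable_indicator_iff measurableSet_Ioo).2 hX
  have hIX : ∀ τ ∈ Icc (0 : ℝ) T, ∫ t in (0 : ℝ)..τ, I t = ∫ t in (0 : ℝ)..τ, X t := by
    intro τ hτ
    rw [intervalIntegral.integral_of_le hτ.1, intervalIntegral.integral_of_le hτ.1,
      integral_Ioc_eq_integral_Ioo, integral_Ioc_eq_integral_Ioo]
    refine setIntegral_congr_fun measurableSet_Ioo fun t ht => ?_
    exact indicator_of_mem (s := Ioo 0 T) ⟨ht.1, ht.2.trans_le hτ.2⟩ X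
  have hI0 : ∀ᵐ t, 0 ≤ I t := by
    filter_upwards [(ae_restrict_iff' measurableSet_Ioo).1 h0] with t ht
    exact indicator_apply_nonneg ht
  set Y : ℝ → ℝ := fun τ => ∫ t in (0 : ℝ)..τ, I t with hY
  have hYc : Continuous Y := intervalIntegral.continuous_primitive
    (fun _ _ => iI.intervalIntegrable) 0
  have hY0 : ∀ τ, 0 ≤ τ → 0 ≤ Y τ := fun τ hτ =>
    intervalIntegral.integral_nonneg_of_ae hτ hI0
  -- X is only integrable, so its primitive Y need not be differentiable everywhere. Integrating
  -- once more gives Z of class C¹ with 0 ≤ Z' = Y ≤ C Z and Z(0) = 0, to which the classical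
  -- Gronwall lemma applies.
  set Z : ℝ → ℝ := fun τ => ∫ t in (0 : ℝ)..τ, Y t with hZ
  have hZd : ∀ τ, HasDerivAt Z (Y τ) τ := fun τ =>
    intervalIntegral.integral_hasDerivAt_right (hYc.intervalIntegrable _ _)
      (hYc.stronglyMeasurableAtFilter _ _) hYc.continuousAt
  have hZ0 : ∀ τ, 0 ≤ τ → 0 ≤ Z τ := fun τ hτ =>
    intervalIntegral.integral_nonneg hτ fun t ht => hY0 t ht.1
  have hYZ : ∀ τ ∈ Icc (0 : ℝ) T, Y τ ≤ C * Z τ := by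
    intro τ hτ
    simp only [hY, hZ]
    rw [← intervalIntegral.integral_const_mul, intervalIntegral.integral_of_le hτ.1,
      intervalIntegral.integral_of_le hτ.1, integral_Ioc_eq_integral_Ioo,
      integral_Ioc_eq_integral_Ioo]
    refine integral_mono_ae iI.integrableOn
      (((hYc.const_smul C).intervalIntegrable 0 τ).1.mono_set Ioo_subset_Ioc_self) ?_
    have h' := ae_mono (Measure.restrict_mono (μ := volume) (Ioo_subset_Ioo_right hτ.2) le_rfl) h
    filter_upwards [h', ae_restrict_mem measurableSet_Ioo] with t h1 h2
    have h3 : t ∈ Ioo 0 T := ⟨h2.1, h2.2.trans_le hτ.2⟩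
    rw [← hIX t (Ioo_subset_Icc_self h3)] at h1
    rw [hI, indicator_of_mem h3]
    exact h1
  have hZT : Z T = 0 := by
    refine eq_zero_of_abs_deriv_le_mul_abs_self_of_eq_zero_right (f' := Y) (K := C) (a := 0)
      (b := T) (fun t _ => (hZd t).continuousAt.continuousWithinAt)
      (fun t _ => (hZd t).hasDerivWithinAt) (by simp [hZ]) (fun t ht => ?_) T ⟨hT.le, le_rfl⟩
    rw [Real.norm_of_nonneg (hY0 t ht.1), Real.norm_of_nonneg (hZ0 t ht.1)]
    exact hYZ t (Ico_subset_Icc_self ht)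
  have hT' : T ∈ Icc 0 T := ⟨hT.le, le_rfl⟩
  have := hYZ T hT'
  rw [hZT, mul_zero] at this
  rwa [← hIX T hT']

variable {N : ℕ} {Ω : Set (Eucl N)} {T μ lam a γ : ℝ} {q : ℝ → ℝ}
  {ρ : ℝ → Eucl N → ℝ} {u : ℝ → Eucl N → Eucl N} {Du : ℝ → Eucl N → (Eucl N →L[ℝ] Eucl N)}
  {r : ℝ → Eucl N → ℝ} {U : ℝ → Eucl N → Eucl N}

theorem integrable_relEnergy (hΩ : IsOpen Ω) (hb : Bornology.IsBounded Ω)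
    (ha : 0 < a) (hγ : 1 < γ) (hq : IsTestOnPos q)
    (hint : ∀ t ∈ Icc (0 : ℝ) T, IntegrableOn (ρ t) Ω)
    (hnn : ∀ t ∈ Icc (0 : ℝ) T, ∀ᵐ x ∂(volume.restrict Ω), 0 ≤ ρ t x)
    (hρ : MemLinftyLp Ω T γ ρ) (hu : MemL2W012 Ω T u Du)
    (hE : EnergyInequality Ω T μ lam a γ q ρ u Du)
    (hr : IsC1 Ω T r) (hU : IsC1 Ω T U)
    (hpos : ∀ t ∈ Icc (0 : ℝ) T, ∀ x ∈ closure Ω, 0 < r t x) :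
    Integrable (fun z : ℝ × Eucl N => relEnergy a γ (ρ z.1 z.2) (u z.1 z.2) (r z.1 z.2)
      (U z.1 z.2)) (volume.restrict (cylinder Ω T)) := by
  have := isFiniteMeasure_restrict_cylinder (T := T) hb
  obtain ⟨c, b, -, -, -, hdec, -⟩ := exists_pressurePotential_decomposition a γ hq
  set ν := (volume : Measure (ℝ × Eucl N)).restrict (cylinder Ω T) with hν
  have hρnn : ∀ᵐ z ∂ν, 0 ≤ ρ z.1 z.2 := ae_cylinder_nonneg hρ.1 (by
    filter_upwards [ae_restrict_mem measurableSet_Ioo] with t ht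
    exact hnn t (Ioo_subset_Icc_self ht))
  have iρ : Integrable (fun z : ℝ × Eucl N => ρ z.1 z.2) ν := integrable_density hb hγ hρ
  have iργ : Integrable (fun z : ℝ × Eucl N => |ρ z.1 z.2| ^ γ) ν := integrable_rpow_density hγ hρ
  have ikin : Integrable (fun z : ℝ × Eucl N => ρ z.1 z.2 * ‖u z.1 z.2‖ ^ 2) ν :=
    integrable_kinetic hb ha hγ hq hnn hint hρ hu hE
  have im : Integrable (fun z : ℝ × Eucl N => ρ z.1 z.2 • u z.1 z.2) ν :=
    integrable_momentum hρ.1 hu.1.1 hρnn iρ ikin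
  have iP : Integrable (fun z : ℝ × Eucl N => a * r z.1 z.2 ^ γ) ν :=
    ((hr.comp_of_contDiffOn (f := fun s => a * s ^ γ) (s := Ioi 0) (contDiffOn_const.mul
      (contDiffOn_id.rpow_const_of_ne fun x (hx : 0 < x) => hx.ne')) hpos).memLp_top
      hΩ hb).integrable le_top
  have iΦ := integrable_bilin_top (ContinuousLinearMap.mul ℝ ℝ)
    ((isC1_densityMultiplier (a := a) (γ := γ) hr hU hpos).memLp_top hΩ hb) iρ
  have iU := integrable_bilin_top (innerSL ℝ) (hU.memLp_top hΩ hb) im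
  refine (((((ikin.const_mul (1 / 2)).add (iργ.const_mul (a / (γ - 1)))).sub iU).add iΦ).add
    iP).congr ?_
  filter_upwards [hρnn, ae_restrict_mem (isOpen_cylinder hΩ).measurableSet] with z h1 h2
  rw [relEnergy_eq hγ hdec (hpos _ (Ioo_subset_Icc_self h2.1) _ (subset_closure h2.2)),
    energyDensity, hdec, potential]
  have e : ∀ v w : Eucl N, innerSL ℝ v w = (inner ℝ w v : ℝ) := fun v w => real_inner_comm w v
  simp only [Pi.add_apply, Pi.sub_apply, ContinuousLinearMap.mul_apply', e, abs_of_nonneg h1]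
  ring

/-- The remainder is controlled by the relative energy and an arbitrarily small fraction of
the dissipation. -/
theorem exists_remainder_le (hΩ : IsOpen Ω) (hb : Bornology.IsBounded Ω)
    (ha : 0 < a) (hγ : 1 < γ) (hq : IsTestOnPos q) (hc : IsClassicalSolution Ω T μ lam a γ q r U)
    {r₀ : ℝ} (hr₀ : 0 < r₀) (hlow : ∀ t ∈ Icc (0 : ℝ) T, ∀ x ∈ closure Ω, r₀ ≤ r t x)
    {δ : ℝ} (hδ : 0 < δ) :
    ∃ C ≥ 0, ∀ t ∈ Ioo 0 T, ∀ x ∈ Ω, 0 ≤ ρ t x →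
      remainder a γ q ρ u Du r U t x ≤
        C * relEnergy a γ (ρ t x) (u t x) (r t x) (U t x)
          + δ * (‖u t x - U t x‖ ^ 2 + tr (Du t x - fderiv ℝ (U t) x) ^ 2) := by
  have hpos : ∀ t ∈ Icc (0 : ℝ) T, ∀ x ∈ closure Ω, 0 < r t x := fun t ht x hx =>
    hr₀.trans_le (hlow t ht x hx)
  obtain ⟨K, hK, hbd⟩ := hc.exists_bound_coefficients hΩ hb hq hpos
  -- KB bounds |∇U|; KF bounds |∂_t U| + |∇U||U| + |H'(r)||∇r|; Kt bounds |div U| ≤ N|∇U|. The upper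
  -- end max(K, r₀) makes the density interval nonempty in any case.
  obtain ⟨C, hC, h⟩ := exists_remainder_bound ha hγ hq hr₀ (le_max_right K r₀) (KB := K)
    (KF := K + K * K + K * K) (Kt := N * K) hK (by positivity) (by positivity) hδ
  refine ⟨C, hC, fun t ht x hx hs => ?_⟩
  obtain ⟨k1, k2, k3, k4, k5, k6, -, -⟩ := hbd t ht x hx
  have hl := hlow t (Ioo_subset_Icc_self ht) x (subset_closure hx)
  have hr : 0 < r t x := hr₀.trans_le hl
  refine le_trans ?_ (h (r t x) ⟨hl, k1.trans (le_max_left _ _)⟩ (ρ t x) hs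
    ‖u t x - U t x‖ (norm_nonneg _) (tr (Du t x - fderiv ℝ (U t) x)))
  -- For the power law the pressure is (γ-1) times the potential, so the same factor relates their
  -- Bregman distances.
  have hpq : a * ρ t x ^ γ - a * r t x ^ γ - r t x * enthalpyDeriv a γ (r t x) * (ρ t x - r t x) =
      (γ - 1) * relPotential a γ (ρ t x) (r t x) := by
    rw [← sub_one_mul_potential hγ, ← sub_one_mul_potential hγ, ← sub_one_mul_enthalpy hγ hr,
      relPotential]
    ring
  have hrel := mul_nonneg (sub_nonneg.2 hγ.le) (relPotential_nonneg ha hγ hs hr)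
  rw [remainder, hpq]
  set w := u t x - U t x
  have e1 : -(ρ t x * (inner ℝ w (fderiv ℝ (U t) x w) : ℝ)) ≤ K * (ρ t x * ‖w‖ ^ 2) := by
    have h1 : |(inner ℝ w (fderiv ℝ (U t) x w) : ℝ)| ≤ ‖w‖ * (K * ‖w‖) :=
      (abs_real_inner_le_norm _ _).trans (mul_le_mul_of_nonneg_left
        (((fderiv ℝ (U t) x).le_opNorm _).trans
          (mul_le_mul_of_nonneg_right k4 (norm_nonneg _))) (norm_nonneg _))
    have h2 := mul_le_mul_of_nonneg_left ((neg_le_abs _).trans h1) hs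
    linarith
  have e2 : -((ρ t x - r t x) *
      ((inner ℝ w (deriv (fun s => U s x) t + fderiv ℝ (U t) x (U t x)) : ℝ)
        + enthalpyDeriv a γ (r t x) * fderiv ℝ (r t) x w)) ≤
      (K + K * K + K * K) * (|ρ t x - r t x| * ‖w‖) := by
    have h1 : |(inner ℝ w (deriv (fun s => U s x) t + fderiv ℝ (U t) x (U t x)) : ℝ)| ≤
        ‖w‖ * (K + K * K) :=
      (abs_real_inner_le_norm _ _).trans (mul_le_mul_of_nonneg_left
        ((norm_add_le _ _).trans (add_le_add k3 (((fderiv ℝ (U t) x).le_opNorm _).trans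
          (mul_le_mul k4 k2 (norm_nonneg _) hK)))) (norm_nonneg _))
    have h2 : |enthalpyDeriv a γ (r t x) * fderiv ℝ (r t) x w| ≤ K * (K * ‖w‖) := by
      rw [abs_mul]
      exact mul_le_mul k6 (((fderiv ℝ (r t) x).le_opNorm _).trans
        (mul_le_mul_of_nonneg_right k5 (norm_nonneg _))) (abs_nonneg _) hK
    refine (neg_le_abs _).trans ?_
    rw [abs_mul]
    refine (mul_le_mul_of_nonneg_left ((abs_add_le _ _).trans (add_le_add h1 h2))
      (abs_nonneg _)).trans (le_of_eq (by ring))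
  have e3 : -((γ - 1) * relPotential a γ (ρ t x) (r t x) * tr (fderiv ℝ (U t) x)) ≤
      N * K * ((γ - 1) * relPotential a γ (ρ t x) (r t x)) := by
    have h1 := mul_le_mul_of_nonneg_left ((neg_le_abs _).trans ((abs_tr_le _).trans
      (mul_le_mul_of_nonneg_left k4 (Nat.cast_nonneg N)))) hrel
    linarith
  have e4 := (le_abs_self ((q (ρ t x) - q (r t x)) * tr (Du t x - fderiv ℝ (U t) x))).trans_eq
    (abs_mul _ _)
  linarith

/-- Weak-strong uniqueness for a classical solution with positive density. -/
theorem weak_strong_uniqueness (hN : 0 < N) (hΩ : IsOpen Ω) (hb : Bornology.IsBounded Ω)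
    (hne : Ω.Nonempty) (hT : 0 < T) (hμ : 0 < μ) (hlam : 0 ≤ lam) (hvisc : N = 1 → 0 < lam)
    (ha : 0 < a) (hγ : 1 < γ) (hq : IsTestOnPos q)
    (hw : IsDissipativeWeakSolution Ω T μ lam a γ q ρ u)
    (hc : IsClassicalSolution Ω T μ lam a γ q r U) (hpos₀ : ∀ x ∈ closure Ω, 0 < r 0 x)
    (hρ0 : ∀ᵐ x ∂(volume.restrict Ω), ρ 0 x = r 0 x)
    (hm0 : ∀ᵐ x ∂(volume.restrict Ω), ρ 0 x • u 0 x = r 0 x • U 0 x) :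
    ∀ᵐ z ∂(volume.restrict (cylinder Ω T)),
      ρ z.1 z.2 = r z.1 z.2 ∧ u z.1 z.2 = U z.1 z.2 := by
  obtain ⟨hint, hnn, hρ, -, Du, hu, hC, hM, hR, hE⟩ := hw
  obtain ⟨r₀, hr₀, hlow⟩ := hc.exists_lower_bound hΩ hb hne hT hpos₀
  have hpos : ∀ t ∈ Icc (0 : ℝ) T, ∀ x ∈ closure Ω, 0 < r t x := fun t ht x hx =>
    hr₀.trans_le (hlow t ht x hx)
  have := isFiniteMeasure_restrict_cylinder (T := T) hb
  have hcm : MeasurableSet (cylinder Ω T) := (isOpen_cylinder hΩ).measurableSet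
  obtain ⟨iRD, hREI⟩ := relative_energy_inequality hΩ hb hT ha hγ hq hint hnn hρ hu hC hM hR hE hc
    hpos hρ0 hm0
  -- The Korn–Poincaré constant δ also serves as the parameter in the remainder estimate, so the
  -- dissipation absorbs the δ-terms completely.
  obtain ⟨δ, hδ, hcoer⟩ := exists_coercivity_stress_of_memH10 hN hΩ hb hμ hlam hvisc
  obtain ⟨C, hC0, hrem⟩ := exists_remainder_le (ρ := ρ) (u := u) (Du := Du) hΩ hb ha hγ hq hc
    hr₀ hlow hδ
  set ν := (volume : Measure (ℝ × Eucl N)).restrict (cylinder Ω T) with hν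
  set e : ℝ → Eucl N → ℝ := fun t x => relEnergy a γ (ρ t x) (u t x) (r t x) (U t x) with he
  have ie : Integrable (fun z : ℝ × Eucl N => e z.1 z.2) ν :=
    integrable_relEnergy hΩ hb ha hγ hq (fun t ht => (hint t ht).1) hnn hρ hu hE hc.density_C1
      hc.velocity_C1 hpos
  have hρnn : ∀ᵐ z ∂ν, 0 ≤ ρ z.1 z.2 := ae_cylinder_nonneg hρ.1 (by
    filter_upwards [ae_restrict_mem measurableSet_Ioo] with t ht
    exact hnn t (Ioo_subset_Icc_self ht))
  have he0 : ∀ {t : ℝ} {x : Eucl N}, t ∈ Ioo 0 T → x ∈ Ω → 0 ≤ ρ t x → 0 ≤ e t x :=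
    fun ht hx hs => add_nonneg (by positivity)
      (relPotential_nonneg ha hγ hs (hpos _ (Ioo_subset_Icc_self ht) _ (subset_closure hx)))
  -- the dissipation controls the velocity difference
  have mw : MemLp (fun z : ℝ × Eucl N => u z.1 z.2 - U z.1 z.2) 2 ν :=
    hu.1.sub ((hc.velocity_C1.memLp_top hΩ hb).mono_exponent le_top)
  have mΓ : MemLp (fun z : ℝ × Eucl N => Du z.1 z.2 - fderiv ℝ (U z.1) z.2) 2 ν :=
    hu.2.1.sub ((hc.velocity_C1.memLp_top_fderiv_space hΩ hb).mono_exponent le_top)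
  -- What is left of the δ-terms after subtracting the dissipation. It has no sign pointwise, but
  -- its integral over Ω is nonpositive at almost every time, since Korn's inequality holds only
  -- after integration.
  set d : ℝ → Eucl N → ℝ := fun t x =>
    δ * (‖u t x - U t x‖ ^ 2 + tr (Du t x - fderiv ℝ (U t) x) ^ 2)
      - relDissipation μ lam Du U t x with hd
  have idd : Integrable (fun z : ℝ × Eucl N => d z.1 z.2) ν := by
    have mtr : MemLp (fun z : ℝ × Eucl N => tr (Du z.1 z.2 - fderiv ℝ (U z.1) z.2)) 2 ν :=
      (trL N).comp_memLp' mΓ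
    exact (((mw.integrable_norm_pow two_ne_zero).add mtr.integrable_sq).const_mul δ).sub
      (integrable_bilin_two ((frobL N).comp (stressL N μ lam)) mΓ mΓ)
  have hd0 : ∀ᵐ t ∂(volume.restrict (Ioo 0 T)), ∫ x in Ω, d t x ≤ 0 := by
    filter_upwards [hu.2.2, ae_restrict_mem measurableSet_Ioo] with t h1 h2
    have hm := h1.memH10.sub (hc.memH10_velocity hΩ hb h2)
    have j1 : IntegrableOn (fun x => ‖u t x - U t x‖ ^ 2
        + tr (Du t x - fderiv ℝ (U t) x) ^ 2) Ω :=
      (hm.1.integrable_norm_pow two_ne_zero).add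
        (MemLp.integrable_sq ((trL N).comp_memLp' hm.2.1))
    have j3 : IntegrableOn (fun x => relDissipation μ lam Du U t x) Ω :=
      integrable_bilin_two ((frobL N).comp (stressL N μ lam)) hm.2.1 hm.2.1
    simp only [hd]
    rw [integral_sub (j1.const_mul δ) j3, integral_const_mul]
    exact sub_nonpos.2 (hcoer _ _ hm)
  have hmain : ∀ᵐ τ ∂(volume.restrict (Ioo 0 T)),
      ∫ x in Ω, e τ x ≤ C * ∫ t in (0 : ℝ)..τ, ∫ x in Ω, e t x := by
    filter_upwards [hREI, ae_restrict_mem measurableSet_Ioo] with τ h1 hτ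
    have hsub : (volume : Measure (ℝ × Eucl N)).restrict (cylinder Ω τ) ≤ ν :=
      Measure.restrict_mono (cylinder_mono hτ.2.le) le_rfl
    rw [intervalIntegral_eq_integral_cylinder hτ.1.le hτ.2.le ie]
    have h2 : ∫ z in cylinder Ω τ, d z.1 z.2 ≤ 0 := by
      rw [← intervalIntegral_eq_integral_cylinder hτ.1.le hτ.2.le idd,
        intervalIntegral.integral_of_le hτ.1.le, integral_Ioc_eq_integral_Ioo]
      exact integral_nonpos_of_ae (ae_mono (Measure.restrict_mono
        (Ioo_subset_Ioo_right hτ.2.le) le_rfl) hd0)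
    have ie' := (ie.mono_measure hsub).const_mul C
    have id' := idd.mono_measure hsub
    calc ∫ x in Ω, e τ x ≤ _ := h1.2
      _ ≤ ∫ z in cylinder Ω τ, (C * e z.1 z.2 + d z.1 z.2) := by
          refine integral_mono_ae (iRD.mono_measure hsub) (ie'.add id') (ae_mono hsub ?_)
          filter_upwards [hρnn, ae_restrict_mem hcm] with z hz hzc
          have := hrem z.1 hzc.1 z.2 hzc.2 hz
          simp only [hd, he]
          linarith
      _ = C * (∫ z in cylinder Ω τ, e z.1 z.2) + ∫ z in cylinder Ω τ, d z.1 z.2 := by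
          rw [integral_add ie' id', integral_const_mul]
      _ ≤ _ := by linarith
  have hX : IntegrableOn (fun t => ∫ x in Ω, e t x) (Ioo 0 T) := by
    rw [hν, restrict_cylinder] at ie
    exact ie.integral_prod_left
  have hX0 : ∀ᵐ t ∂(volume.restrict (Ioo 0 T)), 0 ≤ ∫ x in Ω, e t x := by
    filter_upwards [ae_restrict_mem measurableSet_Ioo] with t ht
    refine integral_nonneg_of_ae ?_
    filter_upwards [hnn t (Ioo_subset_Icc_self ht), ae_restrict_mem hΩ.measurableSet] with x h1 h2
    exact he0 ht h2 h1
  have hfin := integral_nonpos_of_ae_le_mul_integral hT hX hX0 hmain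
  rw [intervalIntegral_eq_integral_cylinder hT.le le_rfl ie] at hfin
  have hnonneg : ∀ᵐ z ∂ν, 0 ≤ e z.1 z.2 := by
    filter_upwards [hρnn, ae_restrict_mem hcm] with z hz hzc
    exact he0 hzc.1 hzc.2 hz
  have hzero := (integral_eq_zero_iff_of_nonneg_ae hnonneg ie).1
    (le_antisymm hfin (integral_nonneg_of_ae hnonneg))
  obtain ⟨K, -, hbd⟩ := hc.exists_bound_coefficients hΩ hb hq hpos
  obtain ⟨κ, hκ, hκe⟩ := exists_coercivity_relPotential ha hγ hr₀ (le_max_right K r₀)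
  filter_upwards [hzero, hρnn, ae_restrict_mem hcm] with z hz hs hzc
  have hl := hlow z.1 (Ioo_subset_Icc_self hzc.1) z.2 (subset_closure hzc.2)
  have hk := hκe (r z.1 z.2) ⟨hl, (hbd z.1 hzc.1 z.2 hzc.2).1.trans (le_max_left _ _)⟩ _ hs
  have hp := relPotential_nonneg ha hγ hs (hr₀.trans_le hl)
  have hkin : 0 ≤ 1 / 2 * ρ z.1 z.2 * ‖u z.1 z.2 - U z.1 z.2‖ ^ 2 := by positivity
  have hz' : 1 / 2 * ρ z.1 z.2 * ‖u z.1 z.2 - U z.1 z.2‖ ^ 2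
      + relPotential a γ (ρ z.1 z.2) (r z.1 z.2) = 0 := hz
  -- Both nonnegative parts of the relative energy vanish. Coercivity of the relative potential
  -- gives equality of the densities first; then ρ > 0, and the kinetic part gives equality of the
  -- velocities.
  have h1 : ρ z.1 z.2 = r z.1 z.2 := by
    by_contra hne'
    have h2 : 0 < |ρ z.1 z.2 - r z.1 z.2| := abs_pos.2 (sub_ne_zero.2 hne')
    have h3 : 0 < (ρ z.1 z.2 - r z.1 z.2) ^ 2 := by rw [← sq_abs]; positivity
    have h4 := mul_pos hκ (lt_min h3 h2)
    linarith
  refine ⟨h1, ?_⟩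
  have h2 : 0 < ρ z.1 z.2 := by rw [h1]; exact hr₀.trans_le hl
  have h3 : 1 / 2 * ρ z.1 z.2 * ‖u z.1 z.2 - U z.1 z.2‖ ^ 2 = 0 := by linarith
  have h4 : ‖u z.1 z.2 - U z.1 z.2‖ ^ 2 = 0 :=
    (mul_eq_zero.1 h3).resolve_left (by positivity)
  exact sub_eq_zero.1 (norm_eq_zero.1 (pow_eq_zero_iff two_ne_zero |>.1 h4))

end Uniqueness

end CompressibleNS

end

theorem theorem1 (N : ℕ) (hN : N = 1 ∨ N = 2 ∨ N = 3)
    (Ω : Set (CompressibleNS.Eucl N)) (hΩ : CompressibleNS.IsBoundedLipschitzDomain Ω)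
    (T : ℝ) (hT : 0 < T)
    (μ lam : ℝ) (hμ : 0 < μ) (hlam : 0 ≤ lam) (hvisc : N = 1 → 0 < lam)
    (a γ : ℝ) (ha : 0 < a) (hγ : 1 < γ)
    (q : ℝ → ℝ) (hq : CompressibleNS.IsTestOnPos q)
    (ρ : ℝ → CompressibleNS.Eucl N → ℝ)
    (u : ℝ → CompressibleNS.Eucl N → CompressibleNS.Eucl N)
    (hw : CompressibleNS.IsDissipativeWeakSolution Ω T μ lam a γ q ρ u)
    (r : ℝ → CompressibleNS.Eucl N → ℝ)
    (U : ℝ → CompressibleNS.Eucl N → CompressibleNS.Eucl N)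
    (hc : CompressibleNS.IsClassicalSolution Ω T μ lam a γ q r U)
    (hpos : ∀ x ∈ closure Ω, 0 < r 0 x)
    (hρ0 : ∀ᵐ x ∂(volume.restrict Ω), ρ 0 x = r 0 x)
    (hm0 : ∀ᵐ x ∂(volume.restrict Ω), ρ 0 x • u 0 x = r 0 x • U 0 x) :
    ∀ᵐ z ∂(volume.restrict (CompressibleNS.cylinder Ω T)),
      ρ z.1 z.2 = r z.1 z.2 ∧ u z.1 z.2 = U z.1 z.2 := by
  have hN' : 0 < N := by omega
  exact CompressibleNS.weak_strong_uniqueness hN' hΩ.isOpen hΩ.isBounded hΩ.isConnected.nonempty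
    hT hμ hlam hvisc ha hγ hq hw hc hpos hρ0 hm0
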